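/- Let $\Omega=(a,b)$ be a bounded open interval, $n\in(0,3)$, $T>0$, $p\in[1,\infty)$, and let $u_{in}\in H^1(\Omega)$, $u_{in}\ge 0$, $\int_\Omega u_{in}\,dx=1$. For $\varepsilon\in(0,1)$ set $$B(s)=\int_0^s\int_r^\infty\frac{dv\,dr}{v^{n-1}+v^2},\qquad B^\varepsilon(s)=\frac{1}{|\ln\varepsilon|}B(s/\varepsilon).$$ Let $u^{\varepsilon}\ge 0$ denote a (continuous) weak solution of $$|\ln\varepsilon|^{-1}\partial_t u+\partial_x\big((\varepsilon^{3-n}u^n+u^3)\,\partial_{xxx}u\big)=0\ \text{ in }(0,\infty)\times\Omega,\qquad (\varepsilon^{3-n}u^n+u^3)\,u_{xxx}=0,\ u_x=0\ \text{ on }(0,\infty)\times\partial\Omega,\qquad u(0,\cdot)=u_{in},$$ such that $u^\varepsilon(t,\cdot)$ is $C^1$ on $\overline\Omega$ for a.e. $t>0$ and which, for all $t>0$, satisfies $\int_\Omega u^\varepsilon(t)\,dx=\int_\Omega u_{in}\,dx$, the energy inequality $$\int_\Omega\tfrac12|u^\varepsilon_x(t)|^2dx+\int_0^t\!\!\int_{\{u^\varepsilon>0\}}|\ln\varepsilon|\big(\varepsilon^{3-n}(u^\varepsilon)^n+(u^\varepsilon)^3\big)|u^\varepsilon_{xxx}|^2dx\,ds\le\int_\Omega\tfrac12|\partial_xu_{in}|^2dx,$$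 and, with $\rho^\varepsilon=B^\varepsilon(u^\varepsilon)$, the entropy inequality $$\int_\Omega\rho^\varepsilon(t)\,dx\ \ge\ \int_0^t\!\!\int_{\{u^\varepsilon>0\}} u^\varepsilon|u^\varepsilon_{xx}|^2dx\,ds+\int_\Omega\rho^\varepsilon(0)\,dx ,$$ and for which $\partial_t\rho^\varepsilon=T^\varepsilon+\partial_xR^\varepsilon$ holds weakly, tested against smooth functions of $(t,x)$ with compact support in $(0,\infty)\times\mathbb R$ (so they need not vanish on $\partial\Omega$, and $\langle\partial_xR^\varepsilon,\varphi\rangle=-\int_\Omega R^\varepsilon\varphi_x\,dx$), where $$R^\varepsilon=-|\ln\varepsilon|\,(B^{\varepsilon})'(u^\varepsilon)\big(\varepsilon^{3-n}(u^\varepsilon)^{n-1}+(u^\varepsilon)^2\big)u^\varepsilon u^\varepsilon_{xxx}\,\chi_{\{u^\varepsilon>0\}},\qquad \langle T^\varepsilon,\varphi\rangle=\int_{\{u^\varepsilon>0\}} u^\varepsilon(u^\varepsilon_{xx})^2\varphi\,dx-\tfrac56\int_\Omega (u^\varepsilon_x)^3\varphi_x\,dx-\tfrac12\int_\Omega u^\varepsilon(u^\varepsilon_x)^2\varphi_{xx}\,dx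 .$$ Let $\varepsilon_k\in(0,1)$, $\varepsilon_k\to0$, be such that $\rho^{\varepsilon_k}\to\rho$ strongly in $L^p(0,T;W^{-1,1}(\Omega))$ for some function $\rho\in L^1((0,T)\times\Omega)$. Then $\rho$ has a version, still denoted by $\rho$, which is defined for every $t\in[0,T]$, is nondecreasing in time, is left-continuous on $(0,T]$ with values in $L^1(\Omega)$, and satisfies $\rho(0,\cdot)=\chi_{\{u_{in}>0\}}$; and for this version $$\liminf_{k\to\infty}\big|\{x\in\Omega:\ u^{\varepsilon_k}(t,x)\ge\varepsilon_k\}\big|\ \ge\ \int_\Omega\rho(t,x)\,dx\ \ge\ \min\Big\{\big(63\,t+|\{u_{in}>0\}|^7\big)^{1/7},\,|\Omega|\Big\}\qquad\text{for all }t\in[0,T].$$ Moreover, let $\Sigma(t)=\{x\in\Omega:\ \exists r>0,\ \int_{B_r(x)\cap\Omega}[1-\rho(t,y)]\,dy=0\}$. If $t_0\in[0,T]$ and $\partial\Sigma(t_0)\subset\Omega$, then $$\int_\Omega\rho(t,x)\,dx\ \ge\ \big(1008\,t+|\{u_{in}>0\}|^7\big)^{1/7}\qquad\text{for all }t\in[0,t_0].$$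 -/

import Mathlib

open MeasureTheory Set Filter Topology

noncomputable section

namespace ThinFilm

/-- `g` is the derivative of `f` on `U ⊆ ℝ` in the Sobolev (`W^{1,1}_loc`) sense, `f` being the
absolutely continuous representative: on each compact interval contained in `U`, `g` is
integrable and `f` is a primitive of `g`. -/
def IsSobolevDerivOn (U : Set ℝ) (f g : ℝ → ℝ) : Prop :=
  ∀ x y : ℝ, x ≤ y → Icc x y ⊆ U →
    IntervalIntegrable g volume x y ∧ ∫ z in x..y, g z = f y - f x

/-- `B'(s) = ∫_s^∞ dv / (v^{n-1} + v^2)`. -/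
def dB (n s : ℝ) : ℝ := ∫ v in Ioi s, 1 / (v ^ (n - 1) + v ^ 2)

/-- `B(s) = ∫_0^s ∫_r^∞ dv / (v^{n-1} + v^2) dr`. -/
def B (n s : ℝ) : ℝ := ∫ r in (0 : ℝ)..s, dB n r

/-- `B^ε(s) = B(s/ε) / |ln ε|`. -/
def Beps (n ε s : ℝ) : ℝ := B n (s / ε) / |Real.log ε|

/-- The derivative `(B^ε)'(s) = B'(s/ε) / (ε |ln ε|)`. -/
def dBeps (n ε s : ℝ) : ℝ := dB n (s / ε) / (ε * |Real.log ε|)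

/-- The mobility `ε^{3-n} s^n + s^3`. -/
def mobility (n ε s : ℝ) : ℝ := ε ^ (3 - n) * s ^ n + s ^ 3

/-- The space-time cylinder `(0, ∞) × (a, b)`. -/
def cylinder (a b : ℝ) : Set (ℝ × ℝ) := Ioi 0 ×ˢ Ioo a b

/-- The part of the cylinder where `u > 0`. -/
def posSet (a b : ℝ) (u : ℝ → ℝ → ℝ) : Set (ℝ × ℝ) := {z ∈ cylinder a b | 0 < u z.1 z.2}

/-- Smooth functions on `ℝ × ℝ` with compact support contained in `(0, ∞) × ℝ`. Their restrictions
to `(0, ∞) × [a, b]` are test functions that need not vanish at `x = a` and `x = b`. -/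
def IsTestFunction (φ : ℝ → ℝ → ℝ) : Prop :=
  ContDiff ℝ (⊤ : ℕ∞) (Function.uncurry φ) ∧ HasCompactSupport (Function.uncurry φ) ∧
    tsupport (Function.uncurry φ) ⊆ Ioi (0 : ℝ) ×ˢ (univ : Set ℝ)

/-- The function `ρ^ε = B^ε(u)`. -/
def rhoOf (n ε : ℝ) (u : ℝ → ℝ → ℝ) (t x : ℝ) : ℝ := Beps n ε (u t x)

/-- The flux `R^ε = - |ln ε| (B^ε)'(u) (ε^{3-n} u^{n-1} + u^2) u u_xxx` (used where `u > 0`). -/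
def fluxR (n ε : ℝ) (u uxxx : ℝ → ℝ → ℝ) (t x : ℝ) : ℝ :=
  -|Real.log ε| * dBeps n ε (u t x) * (ε ^ (3 - n) * u t x ^ (n - 1) + u t x ^ 2) *
    (u t x * uxxx t x)

/-- Admissible initial data on `(a, b)`: a nonnegative function of class `H¹` (continuous
representative on `[a, b]`, with derivative `duin ∈ L²`), of mass one. -/
structure IsInitialDatum (a b : ℝ) (uin duin : ℝ → ℝ) : Prop where
  nonneg : ∀ x ∈ Icc a b, 0 ≤ uin x
  deriv : IsSobolevDerivOn (Icc a b) uin duin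
  deriv_memLp : MemLp duin 2 (volume.restrict (Ioo a b))
  mass : ∫ x in Ioo a b, uin x = 1

/-- `u` is a nonnegative weak solution of
`|ln ε|⁻¹ u_t + ((ε^{3-n} u^n + u^3) u_xxx)_x = 0` on `(0, ∞) × (a, b)`, with null flux and
`u_x = 0` at `x = a, b`, and with initial datum `uin`, which conserves mass, satisfies the energy
and the entropy inequalities, and for which `ρ^ε = B^ε(u)` solves `∂_t ρ^ε = T^ε + ∂_x R^ε`.
The functions `ux`, `uxx`, `uxxx` are the spatial derivatives of `u`: `ux` on `[a, b]`, the other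
two on the open set `{u > 0}`. -/
structure IsSolution (n a b ε : ℝ) (uin duin : ℝ → ℝ) (u ux uxx uxxx : ℝ → ℝ → ℝ) : Prop where
  /-- `u` denotes the continuous representative. -/
  continuousOn : ContinuousOn (Function.uncurry u) (Ici 0 ×ˢ Icc a b)
  nonneg : ∀ t, 0 ≤ t → ∀ x ∈ Icc a b, 0 ≤ u t x
  initial : ∀ x ∈ Icc a b, u 0 x = uin x
  ux_meas : AEStronglyMeasurable (Function.uncurry ux) (volume.restrict (cylinder a b))
  uxx_meas : AEStronglyMeasurable (Function.uncurry uxx) (volume.restrict (posSet a b u))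
  uxxx_meas : AEStronglyMeasurable (Function.uncurry uxxx) (volume.restrict (posSet a b u))
  deriv_one : ∀ t, 0 < t → IsSobolevDerivOn (Icc a b) (u t) (ux t)
  /-- For almost every time, `u` is `C¹` on `[a, b]` and `u_x = 0` at the end points. -/
  neumann : ∀ᵐ t ∂(volume.restrict (Ioi (0 : ℝ))),
    ContinuousOn (ux t) (Icc a b) ∧ ux t a = 0 ∧ ux t b = 0
  deriv_two : ∀ᵐ t ∂(volume.restrict (Ioi (0 : ℝ))),
    IsSobolevDerivOn {x ∈ Ioo a b | 0 < u t x} (ux t) (uxx t)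
  deriv_three : ∀ᵐ t ∂(volume.restrict (Ioi (0 : ℝ))),
    IsSobolevDerivOn {x ∈ Ioo a b | 0 < u t x} (uxx t) (uxxx t)
  /-- Weak form of the equation; the test functions need not vanish at `x = a, b`, which encodes
  the null flux condition. -/
  equation : ∀ φ, IsTestFunction φ →
    |Real.log ε|⁻¹ * (∫ z in cylinder a b, u z.1 z.2 * deriv (fun s => φ s z.2) z.1) +
      ∫ z in posSet a b u, mobility n ε (u z.1 z.2) * uxxx z.1 z.2 * deriv (φ z.1) z.2 = 0
  mass : ∀ t, 0 < t → ∫ x in Ioo a b, u t x = ∫ x in Ioo a b, uin x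
  energy : ∀ t, 0 < t →
    (∫⁻ x in Ioo a b, ENNReal.ofReal (1 / 2 * ux t x ^ 2)) +
      (∫⁻ z in {z ∈ posSet a b u | z.1 < t},
        ENNReal.ofReal (|Real.log ε| * mobility n ε (u z.1 z.2) * uxxx z.1 z.2 ^ 2)) ≤
    ∫⁻ x in Ioo a b, ENNReal.ofReal (1 / 2 * duin x ^ 2)
  entropy : ∀ t, 0 < t →
    (∫⁻ z in {z ∈ posSet a b u | z.1 < t}, ENNReal.ofReal (u z.1 z.2 * uxx z.1 z.2 ^ 2)) +
      ENNReal.ofReal (∫ x in Ioo a b, rhoOf n ε u 0 x) ≤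
    ENNReal.ofReal (∫ x in Ioo a b, rhoOf n ε u t x)
  /-- Weak form of `∂_t ρ^ε = T^ε + ∂_x R^ε`, where
  `⟨T^ε, φ⟩ = ∫ u u_xx² φ - (5/6) ∫ u_x³ φ_x - (1/2) ∫ u u_x² φ_xx`. -/
  rho_equation : ∀ φ, IsTestFunction φ →
    -(∫ z in cylinder a b, rhoOf n ε u z.1 z.2 * deriv (fun s => φ s z.2) z.1) =
      ((∫ z in posSet a b u, u z.1 z.2 * uxx z.1 z.2 ^ 2 * φ z.1 z.2)
        - 5 / 6 * (∫ z in cylinder a b, ux z.1 z.2 ^ 3 * deriv (φ z.1) z.2)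
        - 1 / 2 * (∫ z in cylinder a b, u z.1 z.2 * ux z.1 z.2 ^ 2 *
            iteratedDeriv 2 (φ z.1) z.2))
      - ∫ z in posSet a b u, fluxR n ε u uxxx z.1 z.2 * deriv (φ z.1) z.2

/-- The norm of `W^{-1,1}(a, b)`, the dual norm of `W_0^{1,∞}(a, b)`, of the distribution
`φ ↦ ∫_a^b g φ`. -/
def negSobolevNorm (a b : ℝ) (g : ℝ → ℝ) : ENNReal :=
  ⨆ (φ : ℝ → ℝ) (_ : ContDiff ℝ (⊤ : ℕ∞) φ ∧ HasCompactSupport φ ∧ tsupport φ ⊆ Ioo a b ∧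
      ∀ x, |φ x| ≤ 1 ∧ |deriv φ x| ≤ 1),
    ENNReal.ofReal |∫ x in Ioo a b, g x * φ x|

/-- Strong convergence `r k → ρ` in `L^p(0, T; W^{-1,1}(a, b))`. -/
def TendstoLpNegSobolev (p T a b : ℝ) (r : ℕ → ℝ → ℝ → ℝ) (ρ : ℝ → ℝ → ℝ) : Prop :=
  Tendsto (fun k => ∫⁻ t in Ioo 0 T, negSobolevNorm a b (fun x => r k t x - ρ t x) ^ p)
    atTop (𝓝 0)

/-- `r` is the version of `ρ ∈ L¹((0, T) × (a, b))` defined for every time `t ∈ [0, T]`: it agrees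
with `ρ`, it is nondecreasing in time, left-continuous in time with values in `L¹(a, b)`, and at
`t = 0` it is the indicator function of `{uin > 0}`. -/
structure IsTimeVersion (T a b : ℝ) (uin : ℝ → ℝ) (ρ r : ℝ → ℝ → ℝ) : Prop where
  integrable : ∀ t ∈ Icc 0 T, IntegrableOn (r t) (Ioo a b)
  ae_eq : ∀ᵐ t ∂(volume.restrict (Ioo 0 T)), r t =ᵐ[volume.restrict (Ioo a b)] ρ t
  mono : ∀ s ∈ Icc 0 T, ∀ t ∈ Icc 0 T, s ≤ t → r s ≤ᵐ[volume.restrict (Ioo a b)] r t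
  left_cont : ∀ t ∈ Ioc 0 T,
    Tendsto (fun s => ∫ x in Ioo a b, |r s x - r t x|) (𝓝[<] t) (𝓝 0)
  initial : ∀ x ∈ Ioo a b, r 0 x = {y | 0 < uin y}.indicator (fun _ => (1 : ℝ)) x

/-- The open set `Σ = {x ∈ (a, b) : ∃ r > 0, ∫_{B_r(x) ∩ (a, b)} (1 - f) = 0}` attached to a
profile `f`. -/
def SigmaSet (a b : ℝ) (f : ℝ → ℝ) : Set ℝ :=
  {x ∈ Ioo a b | ∃ r > 0, ∫ y in Metric.ball x r ∩ Ioo a b, (1 - f y) = 0}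

end ThinFilm

end

noncomputable section

namespace ThinFilm

section

/-! ### Calculus of Sobolev derivatives on the line -/

theorem IsSobolevDerivOn.mono {U V : Set ℝ} {f g : ℝ → ℝ} (h : IsSobolevDerivOn U f g)
    (hVU : V ⊆ U) : IsSobolevDerivOn V f g :=
  fun x y hxy hs => h x y hxy (hs.trans hVU)

theorem IsSobolevDerivOn.congr {U : Set ℝ} {f g f' g' : ℝ → ℝ} (h : IsSobolevDerivOn U f g)
    (hf : EqOn f' f U) (hg : EqOn g' g U) : IsSobolevDerivOn U f' g' := by
  intro x y hxy hs
  obtain ⟨h1, h2⟩ := h x y hxy hs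
  have hEq : EqOn g g' (Icc x y) := fun z hz => (hg (hs hz)).symm
  refine ⟨h1.congr (hEq.mono (by rw [uIoc_of_le hxy]; exact Ioc_subset_Icc_self)), ?_⟩
  rw [hf (hs (left_mem_Icc.2 hxy)), hf (hs (right_mem_Icc.2 hxy)), ← h2]
  exact intervalIntegral.integral_congr (by rw [uIcc_of_le hxy]; exact hEq.symm)

theorem IsSobolevDerivOn.eq_add_integral {U : Set ℝ} {f g : ℝ → ℝ} (h : IsSobolevDerivOn U f g)
    {x y : ℝ} (hs : Icc x y ⊆ U) {z : ℝ} (hz : z ∈ Icc x y) :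
    f z = f x + ∫ w in x..z, g w := by
  rw [(h x z hz.1 ((Icc_subset_Icc_right hz.2).trans hs)).2]; ring

theorem IsSobolevDerivOn.absolutelyContinuousOnInterval {U : Set ℝ} {f g : ℝ → ℝ}
    (h : IsSobolevDerivOn U f g) {x y : ℝ} (hxy : x ≤ y) (hs : Icc x y ⊆ U) :
    AbsolutelyContinuousOnInterval f x y := by
  have h1 := (h x y hxy hs).1.absolutelyContinuousOnInterval_intervalIntegral
    (c := x) left_mem_uIcc
  rw [absolutelyContinuousOnInterval_iff] at h1 ⊢
  intro e he
  obtain ⟨δ, hδ, H⟩ := h1 e he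
  refine ⟨δ, hδ, fun E hE hsum => ?_⟩
  refine lt_of_eq_of_lt (Finset.sum_congr rfl fun i hi => ?_) (H E hE hsum)
  obtain ⟨m1, m2⟩ := hE.1 i hi
  rw [uIcc_of_le hxy] at m1 m2
  rw [h.eq_add_integral hs m1, h.eq_add_integral hs m2, dist_add_left]

theorem IsSobolevDerivOn.continuousOn {U : Set ℝ} {f g : ℝ → ℝ}
    (h : IsSobolevDerivOn U f g) {x y : ℝ} (hxy : x ≤ y) (hs : Icc x y ⊆ U) :
    ContinuousOn f (Icc x y) := by
  have := (h.absolutelyContinuousOnInterval hxy hs).continuousOn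
  rwa [uIcc_of_le hxy] at this

theorem IsSobolevDerivOn.ae_hasDerivAt {U : Set ℝ} {f g : ℝ → ℝ}
    (h : IsSobolevDerivOn U f g) {x y : ℝ} (hxy : x ≤ y) (hs : Icc x y ⊆ U) :
    ∀ᵐ z, z ∈ Ioo x y → HasDerivAt f (g z) z := by
  filter_upwards [(h x y hxy hs).1.ae_hasDerivAt_integral] with z hz hzI
  have h1 := (hz (by rw [uIcc_of_le hxy]; exact Ioo_subset_Icc_self hzI) x left_mem_uIcc).const_add
    (f x)
  refine h1.congr_of_eventuallyEq ?_
  filter_upwards [Icc_mem_nhds hzI.1 hzI.2] with w hw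
  exact h.eq_add_integral hs hw

theorem _root_.AbsolutelyContinuousOnInterval.integral_eq_sub_of_ae {Q q : ℝ → ℝ} {x y : ℝ}
    (hxy : x ≤ y) (hQ : AbsolutelyContinuousOnInterval Q x y)
    (hq : ∀ᵐ z, z ∈ Ioo x y → HasDerivAt Q (q z) z) :
    IntervalIntegrable q volume x y ∧ ∫ z in x..y, q z = Q y - Q x := by
  have hae : ∀ᵐ z, z ∈ uIoc x y → deriv Q z = q z := by
    have : ∀ᵐ z : ℝ, z ≠ y := by simp [ae_iff, measure_singleton]
    filter_upwards [hq, this] with z hz hzy hzI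
    rw [uIoc_of_le hxy] at hzI
    exact (hz ⟨hzI.1, lt_of_le_of_ne hzI.2 hzy⟩).deriv
  refine ⟨hQ.intervalIntegrable_deriv.congr_ae ?_, ?_⟩
  · rwa [Filter.EventuallyEq, ae_restrict_iff' measurableSet_uIoc]
  · rw [← hQ.integral_deriv_eq_sub]
    exact (intervalIntegral.integral_congr_ae hae).symm

theorem IsSobolevDerivOn.mul {U : Set ℝ} {f g f' g' : ℝ → ℝ} (hf : IsSobolevDerivOn U f f')
    (hg : IsSobolevDerivOn U g g') :
    IsSobolevDerivOn U (fun x => f x * g x) (fun x => f' x * g x + f x * g' x) := by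
  intro x y hxy hs
  refine ((hf.absolutelyContinuousOnInterval hxy hs).fun_mul
    (hg.absolutelyContinuousOnInterval hxy hs)).integral_eq_sub_of_ae hxy ?_
  filter_upwards [hf.ae_hasDerivAt hxy hs, hg.ae_hasDerivAt hxy hs] with z h1 h2 hz
  exact (h1 hz).fun_mul (h2 hz)

theorem IsSobolevDerivOn.add {U : Set ℝ} {f g f' g' : ℝ → ℝ} (hf : IsSobolevDerivOn U f f')
    (hg : IsSobolevDerivOn U g g') :
    IsSobolevDerivOn U (fun x => f x + g x) (fun x => f' x + g' x) := by
  intro x y hxy hs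
  obtain ⟨h1, h2⟩ := hf x y hxy hs
  obtain ⟨h3, h4⟩ := hg x y hxy hs
  refine ⟨h1.add h3, ?_⟩
  rw [intervalIntegral.integral_add h1 h3, h2, h4]; ring

theorem IsSobolevDerivOn.const_mul {U : Set ℝ} {f f' : ℝ → ℝ} (c : ℝ)
    (hf : IsSobolevDerivOn U f f') :
    IsSobolevDerivOn U (fun x => c * f x) (fun x => c * f' x) := by
  intro x y hxy hs
  obtain ⟨h1, h2⟩ := hf x y hxy hs
  refine ⟨h1.const_mul c, ?_⟩
  rw [intervalIntegral.integral_const_mul, h2]; ring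

theorem IsSobolevDerivOn.mul_abs_self {U : Set ℝ} {f f' : ℝ → ℝ} (hf : IsSobolevDerivOn U f f') :
    IsSobolevDerivOn U (fun x => f x * |f x|) (fun x => 2 * |f x| * f' x) := by
  intro x y hxy hs
  have hac := hf.absolutelyContinuousOnInterval hxy hs
  have habs : AbsolutelyContinuousOnInterval (fun z => |f z|) x y := by
    rw [absolutelyContinuousOnInterval_iff] at hac ⊢
    intro e he
    obtain ⟨δ, hδ, H⟩ := hac e he
    refine ⟨δ, hδ, fun E hE hsum => lt_of_le_of_lt (Finset.sum_le_sum fun i _ => ?_) (H E hE hsum)⟩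
    rw [Real.dist_eq, Real.dist_eq]
    exact abs_abs_sub_abs_le_abs_sub _ _
  refine (hac.fun_mul habs).integral_eq_sub_of_ae hxy ?_
  filter_upwards [hf.ae_hasDerivAt hxy hs] with z h1 hz
  have key : HasDerivAt (fun s : ℝ => s * |s|) (2 * |f z|) (f z) := by
    rcases lt_trichotomy (f z) 0 with h | h | h
    · have : HasDerivAt (fun s : ℝ => -(s ^ 2)) (2 * |f z|) (f z) := by
        rw [abs_of_neg h]
        convert! ((hasDerivAt_pow 2 (f z))).fun_neg using 1
        norm_num
      refine this.congr_of_eventuallyEq ?_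
      filter_upwards [Iio_mem_nhds h] with s hs
      rw [abs_of_neg hs]; ring
    · rw [h, abs_zero, mul_zero, hasDerivAt_iff_tendsto_slope_zero]
      have : Tendsto (fun t : ℝ => |t|) (𝓝[≠] 0) (𝓝 0) := by
        have := (continuous_abs (G := ℝ)).tendsto 0
        rw [abs_zero] at this
        exact this.mono_left nhdsWithin_le_nhds
      refine this.congr' ?_
      filter_upwards [self_mem_nhdsWithin] with t ht
      have : t ≠ 0 := ht
      simp [this]
    · have : HasDerivAt (fun s : ℝ => (s ^ 2)) (2 * |f z|) (f z) := by
        rw [abs_of_pos h]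
        convert! (hasDerivAt_pow 2 (f z)) using 1
        norm_num
      refine this.congr_of_eventuallyEq ?_
      filter_upwards [Ioi_mem_nhds h] with s hs
      rw [abs_of_pos hs]; ring
  exact key.comp z (h1 hz)

theorem isSobolevDerivOn_of_hasDerivAt {U : Set ℝ} {f f' : ℝ → ℝ}
    (hf : ∀ x ∈ U, HasDerivAt f (f' x) x) (hc : ContinuousOn f' U) :
    IsSobolevDerivOn U f f' := by
  intro x y hxy hs
  have hi : IntervalIntegrable f' volume x y :=
    (hc.mono (by rwa [uIcc_of_le hxy])).intervalIntegrable
  exact ⟨hi, intervalIntegral.integral_eq_sub_of_hasDerivAt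
    (fun z hz => hf z (hs (by rwa [uIcc_of_le hxy] at hz))) hi⟩

theorem IsSobolevDerivOn.hasDerivAt {a b : ℝ} {f g : ℝ → ℝ} (h : IsSobolevDerivOn (Ioo a b) f g)
    (hg : ContinuousOn g (Ioo a b)) {x : ℝ} (hx : x ∈ Ioo a b) : HasDerivAt f (g x) x := by
  obtain ⟨c, hac, hcx⟩ := exists_between hx.1
  obtain ⟨d, hxd, hdb⟩ := exists_between hx.2
  have hs : Icc c d ⊆ Ioo a b := fun z hz => ⟨hac.trans_le hz.1, hz.2.trans_lt hdb⟩
  have hcont : ContinuousAt g x := hg.continuousAt (Ioo_mem_nhds hx.1 hx.2)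
  have h1 : HasDerivAt (fun z => ∫ w in c..z, g w) (g x) x := by
    refine intervalIntegral.integral_hasDerivAt_right
      (h c x hcx.le ((Icc_subset_Icc_right hxd.le).trans hs)).1 ?_ hcont
    exact hg.stronglyMeasurableAtFilter isOpen_Ioo x hx
  refine (h1.const_add (f c)).congr_of_eventuallyEq ?_
  filter_upwards [Icc_mem_nhds hcx hxd] with w hw
  exact h.eq_add_integral hs hw

theorem isSobolevDerivOn_of_local {U : Set ℝ} {Q q : ℝ → ℝ}
    (h : ∀ x ∈ U, ∃ r > 0, IsSobolevDerivOn (Ioo (x - r) (x + r)) Q q) :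
    IsSobolevDerivOn U Q q := by
  intro x y hxy hs
  choose! r hr hQ using h
  let c : Icc x y → Set (Icc x y) := fun i => {z | (z : ℝ) ∈ Ioo (i - r i : ℝ) (i + r i)}
  obtain ⟨t, ht0, htm, ⟨m, hm⟩, htc⟩ := exists_monotone_Icc_subset_open_cover_Icc hxy (c := c)
    (fun i => isOpen_Ioo.preimage continuous_subtype_val)
    (fun z _ => mem_iUnion.2 ⟨z, by
      have := hr z (hs z.2)
      exact ⟨by linarith, by linarith⟩⟩)
  have step : ∀ k, IntervalIntegrable q volume (t k) (t (k + 1)) ∧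
      ∫ z in (t k : ℝ)..t (k + 1), q z = Q (t (k + 1)) - Q (t k) := by
    intro k
    obtain ⟨i, hi⟩ := htc k
    have hle : (t k : ℝ) ≤ t (k + 1) := htm (Nat.le_succ k)
    refine hQ i (hs i.2) _ _ hle fun z hz => ?_
    exact hi (show (⟨z, (t k).2.1.trans hz.1, hz.2.trans (t (k + 1)).2.2⟩ : Icc x y) ∈
      Icc (t k) (t (k + 1)) from ⟨hz.1, hz.2⟩)
  have all : ∀ k, IntervalIntegrable q volume x (t k) ∧
      ∫ z in x..t k, q z = Q (t k) - Q x := by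
    intro k
    induction k with
    | zero => rw [show ((t 0 : Icc x y) : ℝ) = x from ht0]; simp
    | succ k ih =>
      refine ⟨ih.1.trans (step k).1, ?_⟩
      rw [← intervalIntegral.integral_add_adjacent_intervals ih.1 (step k).1, ih.2, (step k).2]
      ring
  have := all m
  rwa [show ((t m : Icc x y) : ℝ) = y from hm m le_rfl] at this

/-- A function which is locally a primitive on `{f > 0}` and vanishes where `f < δ` is a primitive
on the whole interval. -/
theorem isSobolevDerivOn_of_pos {a b δ : ℝ} {f Q q : ℝ → ℝ} (hf : ContinuousOn f (Ioo a b))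
    (hδ : 0 < δ) (hQ : IsSobolevDerivOn {x ∈ Ioo a b | 0 < f x} Q q)
    (h0 : ∀ x ∈ Ioo a b, f x < δ → Q x = 0 ∧ q x = 0) : IsSobolevDerivOn (Ioo a b) Q q := by
  refine isSobolevDerivOn_of_local fun x hx => ?_
  have hcx : ContinuousAt f x := hf.continuousAt (isOpen_Ioo.mem_nhds hx)
  by_cases hfx : 0 < f x
  · obtain ⟨r, hr, hb⟩ := Metric.mem_nhds_iff.1
      (Filter.inter_mem (isOpen_Ioo.mem_nhds hx) (hcx.eventually (lt_mem_nhds hfx)))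
    refine ⟨r, hr, hQ.mono ?_⟩
    rw [← Real.ball_eq_Ioo]
    exact fun z hz => ⟨(hb hz).1, (hb hz).2⟩
  · obtain ⟨r, hr, hb⟩ := Metric.mem_nhds_iff.1
      (Filter.inter_mem (isOpen_Ioo.mem_nhds hx)
        (hcx.eventually (gt_mem_nhds (lt_of_le_of_lt (not_lt.1 hfx) hδ))))
    refine ⟨r, hr, ?_⟩
    rw [← Real.ball_eq_Ioo]
    have hz : IsSobolevDerivOn (Metric.ball x r) (fun _ => 0) (fun _ => 0) := by
      intro y z _ _; simp
    exact hz.congr (fun z hz => (h0 z (hb hz).1 (hb hz).2).1)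
      (fun z hz => (h0 z (hb hz).1 (hb hz).2).2)

end

section

/-! ### A smooth convex truncation -/

/-- A smooth nondecreasing function, equal to `0` on `(-∞, δ]` and to `1` on `[2δ, ∞)`. -/
def ramp (δ s : ℝ) : ℝ := Real.smoothTransition (s / δ - 1)

/-- The primitive of `ramp δ`, a smooth convex approximation of `s ↦ (s - δ)₊`. -/
def cut (δ s : ℝ) : ℝ := ∫ r in (0 : ℝ)..s, ramp δ r

theorem ramp_nonneg (δ s : ℝ) : 0 ≤ ramp δ s := Real.smoothTransition.nonneg _

theorem ramp_le_one (δ s : ℝ) : ramp δ s ≤ 1 := Real.smoothTransition.le_one _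

theorem ramp_of_le {δ s : ℝ} (hδ : 0 < δ) (hs : s ≤ δ) : ramp δ s = 0 :=
  Real.smoothTransition.zero_of_nonpos (by
    have : s / δ ≤ 1 := (div_le_one hδ).2 hs
    linarith)

theorem ramp_of_ge {δ s : ℝ} (hδ : 0 < δ) (hs : 2 * δ ≤ s) : ramp δ s = 1 :=
  Real.smoothTransition.one_of_one_le (by
    have : 2 ≤ s / δ := (le_div_iff₀ hδ).2 hs
    linarith)

theorem contDiff_ramp (δ : ℝ) : ContDiff ℝ 1 (ramp δ) := by
  unfold ramp
  exact (Real.smoothTransition.contDiff (n := 1)).comp ((contDiff_id.div_const δ).sub contDiff_const)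

theorem continuous_ramp (δ : ℝ) : Continuous (ramp δ) := (contDiff_ramp δ).continuous

theorem hasDerivAt_ramp (δ s : ℝ) : HasDerivAt (ramp δ) (deriv (ramp δ) s) s :=
  ((contDiff_ramp δ).differentiable one_ne_zero s).hasDerivAt

theorem continuous_deriv_ramp (δ : ℝ) : Continuous (deriv (ramp δ)) :=
  (contDiff_ramp δ).continuous_deriv le_rfl

theorem monotone_ramp {δ : ℝ} (hδ : 0 < δ) : Monotone (ramp δ) := fun s t hst =>
  Real.smoothTransition.monotone (by gcongr)

theorem deriv_ramp_nonneg {δ : ℝ} (hδ : 0 < δ) (s : ℝ) : 0 ≤ deriv (ramp δ) s :=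
  (monotone_ramp hδ).deriv_nonneg

theorem deriv_ramp_of_lt {δ s : ℝ} (hδ : 0 < δ) (hs : s < δ) : deriv (ramp δ) s = 0 := by
  have : ramp δ =ᶠ[𝓝 s] fun _ => 0 := by
    filter_upwards [gt_mem_nhds hs] with r hr using ramp_of_le hδ (le_of_lt hr)
  rw [this.deriv_eq, deriv_const]

theorem ramp_anti {δ η s : ℝ} (hη : 0 < η) (hηδ : η ≤ δ) (hs : 0 ≤ s) : ramp δ s ≤ ramp η s :=
  Real.smoothTransition.monotone (by gcongr)

theorem hasDerivAt_cut (δ s : ℝ) : HasDerivAt (cut δ) (ramp δ s) s :=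
  intervalIntegral.integral_hasDerivAt_right ((continuous_ramp δ).intervalIntegrable _ _)
    (continuous_ramp δ).stronglyMeasurable.stronglyMeasurableAtFilter (continuous_ramp δ).continuousAt

theorem continuous_cut (δ : ℝ) : Continuous (cut δ) :=
  continuous_iff_continuousAt.2 fun s => (hasDerivAt_cut δ s).continuousAt

theorem cut_of_le {δ s : ℝ} (hδ : 0 < δ) (hs : s ≤ δ) : cut δ s = 0 := by
  have : ∫ r in (0 : ℝ)..s, ramp δ r = ∫ r in (0 : ℝ)..s, (0 : ℝ) :=
    intervalIntegral.integral_congr fun r hr => ramp_of_le hδ (by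
      rcases le_total 0 s with h | h
      · rw [uIcc_of_le h] at hr; exact hr.2.trans hs
      · rw [uIcc_of_ge h] at hr; exact hr.2.trans hδ.le)
  rw [cut, this]; simp

theorem cut_nonneg {δ s : ℝ} (hδ : 0 < δ) : 0 ≤ cut δ s := by
  rcases le_total 0 s with h | h
  · exact intervalIntegral.integral_nonneg h fun r _ => ramp_nonneg δ r
  · rw [cut_of_le hδ (h.trans hδ.le)]

theorem cut_le (δ : ℝ) {s : ℝ} (hs : 0 ≤ s) : cut δ s ≤ s := by
  have := intervalIntegral.integral_mono_on (μ := volume) hs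
    ((continuous_ramp δ).intervalIntegrable 0 s) ((continuous_const (y := (1 : ℝ))).intervalIntegrable 0 s) (fun r _ => ramp_le_one δ r)
  simpa [cut] using this

theorem sub_le_cut {δ s : ℝ} (hδ : 0 < δ) : s - 2 * δ ≤ cut δ s := by
  rcases le_total s (2 * δ) with h | h
  · linarith [cut_nonneg (s := s) hδ]
  · have h1 : cut δ s = cut δ (2 * δ) + ∫ r in (2 * δ)..s, ramp δ r :=
      (intervalIntegral.integral_add_adjacent_intervals
        ((continuous_ramp δ).intervalIntegrable _ _)
        ((continuous_ramp δ).intervalIntegrable _ _)).symm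
    have h2 : ∫ r in (2 * δ)..s, ramp δ r = ∫ r in (2 * δ)..s, (1 : ℝ) :=
      intervalIntegral.integral_congr fun r hr => ramp_of_ge hδ (by
        rw [uIcc_of_le h] at hr; exact hr.1)
    rw [h2] at h1
    have h3 := cut_nonneg (s := 2 * δ) hδ
    simp at h1
    linarith

theorem cut_anti {δ η s : ℝ} (hη : 0 < η) (hηδ : η ≤ δ) (hs : 0 ≤ s) : cut δ s ≤ cut η s :=
  intervalIntegral.integral_mono_on hs ((continuous_ramp δ).intervalIntegrable 0 s)
    ((continuous_ramp η).intervalIntegrable 0 s) fun _ hr => ramp_anti hη hηδ hr.1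

/-! ### Spatial profiles -/

/-- A nonnegative `C¹` profile `f` on `[a, b]` with derivatives `g`, `h`, `k` (the last two on
`{f > 0}`), with `g = 0` at the end points and finite entropy dissipation. -/
structure IsProfile (a b : ℝ) (f g h k : ℝ → ℝ) : Prop where
  lt : a < b
  nonneg : ∀ x ∈ Icc a b, 0 ≤ f x
  deriv_one : IsSobolevDerivOn (Icc a b) f g
  g_cont : ContinuousOn g (Icc a b)
  g_left : g a = 0
  g_right : g b = 0
  deriv_two : IsSobolevDerivOn {x ∈ Ioo a b | 0 < f x} g h
  deriv_three : IsSobolevDerivOn {x ∈ Ioo a b | 0 < f x} h k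
  diss : IntegrableOn ({x ∈ Ioo a b | 0 < f x}.indicator fun x => f x * h x ^ 2) (Ioo a b)

/-- The entropy dissipation `∫_{f > 0} f h²` of a profile. -/
def dissip (a b : ℝ) (f h : ℝ → ℝ) : ℝ :=
  ∫ x in Ioo a b, {x ∈ Ioo a b | 0 < f x}.indicator (fun x => f x * h x ^ 2) x

variable {a b : ℝ} {f g h k : ℝ → ℝ}

theorem dissip_term_nonneg (a b : ℝ) (f h : ℝ → ℝ) (x : ℝ) :
    0 ≤ {x ∈ Ioo a b | 0 < f x}.indicator (fun x => f x * h x ^ 2) x :=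
  indicator_nonneg (fun _ hx => mul_nonneg hx.2.le (sq_nonneg _)) x

theorem dissip_nonneg (a b : ℝ) (f h : ℝ → ℝ) : 0 ≤ dissip a b f h :=
  integral_nonneg fun x => dissip_term_nonneg a b f h x

namespace IsProfile

theorem cont (hP : IsProfile a b f g h k) : ContinuousOn f (Icc a b) :=
  hP.deriv_one.continuousOn hP.lt.le Subset.rfl

theorem hasDerivAt (hP : IsProfile a b f g h k) {x : ℝ} (hx : x ∈ Ioo a b) :
    HasDerivAt f (g x) x :=
  (hP.deriv_one.mono Ioo_subset_Icc_self).hasDerivAt (hP.g_cont.mono Ioo_subset_Icc_self) hx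

theorem g_eq_zero (hP : IsProfile a b f g h k) {x : ℝ} (hx : x ∈ Icc a b) (hf : f x = 0) :
    g x = 0 := by
  rcases eq_or_lt_of_le hx.1 with rfl | h1
  · exact hP.g_left
  rcases eq_or_lt_of_le hx.2 with rfl | h2
  · exact hP.g_right
  refine IsLocalMin.hasDerivAt_eq_zero ?_ (hP.hasDerivAt ⟨h1, h2⟩)
  filter_upwards [Icc_mem_nhds h1 h2] with y hy
  rw [hf]; exact hP.nonneg y hy

theorem dissip_intervalIntegrable (hP : IsProfile a b f g h k) {x y : ℝ} (hxy : x ≤ y)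
    (hx : a < x) (hy : y < b) : IntervalIntegrable
      ({x ∈ Ioo a b | 0 < f x}.indicator fun x => f x * h x ^ 2) volume x y := by
  rw [intervalIntegrable_iff_integrableOn_Ioc_of_le hxy]
  exact hP.diss.mono_set fun z hz => ⟨hx.trans hz.1, hz.2.trans_lt hy⟩

theorem dissip_integral_le (hP : IsProfile a b f g h k) {x y : ℝ} (hxy : x ≤ y)
    (hx : a < x) (hy : y < b) : ∫ z in x..y,
      {x ∈ Ioo a b | 0 < f x}.indicator (fun x => f x * h x ^ 2) z ≤ dissip a b f h := by
  rw [intervalIntegral.integral_of_le hxy]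
  refine setIntegral_mono_set hP.diss (ae_of_all _ fun z => dissip_term_nonneg a b f h z) ?_
  exact LE.le.eventuallyLE fun z hz => ⟨hx.trans hz.1, hz.2.trans_lt hy⟩

/-- Composition of the profile with a `C¹` function. -/
theorem comp_deriv (hP : IsProfile a b f g h k) {H H' : ℝ → ℝ} (hH : ∀ s, HasDerivAt H (H' s) s)
    (hH' : Continuous H') : IsSobolevDerivOn (Icc a b) (fun x => H (f x)) (fun x => H' (f x) * g x) := by
  have hHc : Continuous H := continuous_iff_continuousAt.2 fun s => (hH s).continuousAt
  intro x y hxy hs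
  have hc : ContinuousOn (fun x => H' (f x) * g x) (Icc x y) :=
    ((hH'.comp_continuousOn hP.cont).mul hP.g_cont).mono hs
  have hi : IntervalIntegrable (fun x => H' (f x) * g x) volume x y :=
    (show ContinuousOn _ (uIcc x y) by rwa [uIcc_of_le hxy]).intervalIntegrable
  refine ⟨hi, intervalIntegral.integral_eq_sub_of_hasDerivAt_of_le hxy
    ((hHc.comp_continuousOn hP.cont).mono hs) (fun z hz => ?_) hi⟩
  have hz' : z ∈ Ioo a b := ⟨(hs (left_mem_Icc.2 hxy)).1.trans_lt hz.1,
    hz.2.trans_le (hs (right_mem_Icc.2 hxy)).2⟩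
  exact (hH (f z)).comp z (hP.hasDerivAt hz')

end IsProfile

theorem integral_le_of_forall_interior {F Q : ℝ → ℝ} {C : ℝ} (hab : a < b)
    (hF : ContinuousOn F (Icc a b)) (hQ : ContinuousOn Q (Icc a b)) (hQa : Q a = 0)
    (hQb : Q b = 0)
    (h : ∀ x y, a < x → x ≤ y → y < b → ∫ z in x..y, F z ≤ Q y - Q x + C) :
    ∫ z in a..b, F z ≤ C := by
  have hFi : IntervalIntegrable F volume a b :=
    (show ContinuousOn _ (uIcc a b) by rwa [uIcc_of_le hab.le]).intervalIntegrable
  have hG : ContinuousOn (fun x => ∫ z in a..x, F z) (Icc a b) := by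
    have := intervalIntegral.continuousOn_primitive_interval
      (f := F) (a := a) (b := b) (μ := volume) (by
        rw [uIcc_of_le hab.le]; exact hF.integrableOn_Icc)
    rwa [uIcc_of_le hab.le] at this
  have ta : Tendsto (fun s : ℝ => a + s) (𝓝[>] 0) (𝓝[Icc a b] a) := by
    refine tendsto_nhdsWithin_iff.2 ⟨?_, ?_⟩
    · have : Tendsto (fun s : ℝ => a + s) (𝓝 0) (𝓝 (a + 0)) := tendsto_const_nhds.add tendsto_id
      rw [add_zero] at this
      exact this.mono_left nhdsWithin_le_nhds
    · filter_upwards [Ioo_mem_nhdsGT (show (0 : ℝ) < b - a by linarith)] with s hs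
      exact ⟨by linarith [hs.1], by linarith [hs.2]⟩
  have tb : Tendsto (fun s : ℝ => b - s) (𝓝[>] 0) (𝓝[Icc a b] b) := by
    refine tendsto_nhdsWithin_iff.2 ⟨?_, ?_⟩
    · have : Tendsto (fun s : ℝ => b - s) (𝓝 0) (𝓝 (b - 0)) := tendsto_const_nhds.sub tendsto_id
      rw [sub_zero] at this
      exact this.mono_left nhdsWithin_le_nhds
    · filter_upwards [Ioo_mem_nhdsGT (show (0 : ℝ) < b - a by linarith)] with s hs
      exact ⟨by linarith [hs.2], by linarith [hs.1]⟩
  have ma := left_mem_Icc.2 hab.le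
  have mb := right_mem_Icc.2 hab.le
  have T1 := ((hG b mb).tendsto.comp tb).sub ((hG a ma).tendsto.comp ta)
  have T2 := (((hQ b mb).tendsto.comp tb).sub ((hQ a ma).tendsto.comp ta)).add_const C
  simp only [Function.comp_def, hQa, hQb, sub_self, zero_add, intervalIntegral.integral_same,
    sub_zero] at T1 T2
  refine le_of_tendsto_of_tendsto T1 T2 ?_
  filter_upwards [Ioo_mem_nhdsGT (show (0 : ℝ) < (b - a) / 2 by linarith)] with s hs
  have h1 : a < a + s := by linarith [hs.1]
  have h2 : a + s ≤ b - s := by linarith [hs.2]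
  have h3 : b - s < b := by linarith [hs.1]
  refine le_of_eq_of_le ?_ (h _ _ h1 h2 h3)
  refine intervalIntegral.integral_interval_sub_left ?_ ?_
  · exact hFi.mono_set (by
      rw [uIcc_of_le hab.le, uIcc_of_le (by linarith)]; exact Icc_subset_Icc_right h3.le)
  · exact hFi.mono_set (by
      rw [uIcc_of_le hab.le, uIcc_of_le (by linarith)]; exact Icc_subset_Icc_right (by linarith))

theorem sq_le_mul_of_forall_le {x A B : ℝ} (hx : 0 ≤ x) (hA : 0 ≤ A) (hB : 0 ≤ B)
    (h : ∀ μ > 0, x ≤ 1 / 2 * (μ * A + B / μ)) : x ^ 2 ≤ A * B := by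
  refine le_of_forall_pos_le_add fun e he => ?_
  obtain ⟨d, hd, hde⟩ : ∃ d > 0, (A + d) * (B + d) ≤ A * B + e := by
    refine ⟨min 1 (e / (A + B + 1)), by positivity, ?_⟩
    have h1 := min_le_left 1 (e / (A + B + 1))
    have h2 := min_le_right 1 (e / (A + B + 1))
    have h0 : 0 < min 1 (e / (A + B + 1)) := by positivity
    set d := min 1 (e / (A + B + 1))
    have h3 : d * (A + B + 1) ≤ e := (le_div_iff₀ (by positivity)).1 h2
    nlinarith
  have hA' : 0 < A + d := by linarith
  have hB' : 0 < B + d := by linarith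
  have hs : 0 < √((A + d) * (B + d)) := Real.sqrt_pos.2 (by positivity)
  have hsq := Real.sq_sqrt (show 0 ≤ (A + d) * (B + d) by positivity)
  set r := √((A + d) * (B + d))
  have key := h (r / (A + d)) (by positivity)
  have e1 : B / (r / (A + d)) ≤ r := by
    rw [div_div_eq_mul_div, div_le_iff₀ hs]; nlinarith
  have e2 : r / (A + d) * A ≤ r := by
    rw [div_mul_eq_mul_div, div_le_iff₀ hA']; nlinarith
  have : x ≤ r := by linarith
  calc x ^ 2 ≤ r ^ 2 := by gcongr
    _ ≤ _ := by rw [hsq]; exact hde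

namespace IsProfile

theorem bernis_aux (hP : IsProfile a b f g h k) {δ η : ℝ} (hη : 0 < η) (hηδ : η ≤ δ) :
    ∫ x in a..b, (ramp η (f x) - ramp δ (f x)) * |g x| ^ 3 ≤
      √(2 * δ) * (dissip a b f h + ∫ x in a..b, g x ^ 2) := by
  have hδ : 0 < δ := hη.trans_le hηδ
  set W : ℝ → ℝ := fun s => cut η s - cut δ s with hW
  have hWd : ∀ s, HasDerivAt W (ramp η s - ramp δ s) s := fun s =>
    (hasDerivAt_cut η s).sub (hasDerivAt_cut δ s)
  have hWc : Continuous W := (continuous_cut η).sub (continuous_cut δ)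
  have hW' : Continuous fun s => ramp η s - ramp δ s := (continuous_ramp η).sub (continuous_ramp δ)
  have hsub : {x ∈ Ioo a b | 0 < f x} ⊆ Icc a b := fun x hx => Ioo_subset_Icc_self hx.1
  have hQ := isSobolevDerivOn_of_pos (hP.cont.mono Ioo_subset_Icc_self) hη
    (((hP.comp_deriv hWd hW').mono hsub).mul hP.deriv_two.mul_abs_self) (by
      intro x _ hx
      have : W (f x) = 0 := by
        simp [hW, cut_of_le hη hx.le, cut_of_le hδ (hx.le.trans hηδ)]
      simp [this, ramp_of_le hη hx.le, ramp_of_le hδ (hx.le.trans hηδ)])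
  have hFc : ContinuousOn (fun x => (ramp η (f x) - ramp δ (f x)) * |g x| ^ 3) (Icc a b) :=
    (hW'.comp_continuousOn hP.cont).mul (hP.g_cont.abs.pow 3)
  have hgc : ContinuousOn (fun x => g x ^ 2) (Icc a b) := hP.g_cont.pow 2
  refine integral_le_of_forall_interior (Q := fun x => W (f x) * (g x * |g x|)) hP.lt hFc
    ((hWc.comp_continuousOn hP.cont).mul (hP.g_cont.mul hP.g_cont.abs))
    (by simp [hP.g_left]) (by simp [hP.g_right]) fun x y hx hxy hy => ?_
  have hs : Icc x y ⊆ Ioo a b := fun z hz => ⟨hx.trans_le hz.1, hz.2.trans_lt hy⟩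
  have hs' : uIcc x y ⊆ Icc a b := by
    rw [uIcc_of_le hxy]; exact hs.trans Ioo_subset_Icc_self
  obtain ⟨hqi, hq⟩ := hQ x y hxy hs
  rw [← hq]
  have hFi := (hFc.mono hs').intervalIntegrable (μ := volume)
  have hgi := (hgc.mono hs').intervalIntegrable (μ := volume)
  have hDi := hP.dissip_intervalIntegrable hxy hx hy
  have hg_le : ∫ z in x..y, g z ^ 2 ≤ ∫ z in a..b, g z ^ 2 :=
    intervalIntegral.integral_mono_interval hx.le hxy hy.le
      (ae_of_all _ fun z => sq_nonneg (g z))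
      (show ContinuousOn _ (uIcc a b) by rwa [uIcc_of_le hP.lt.le]).intervalIntegrable
  have hD_le := hP.dissip_integral_le hxy hx hy
  have hR : ∫ z in x..y, √(2 * δ) * ({x ∈ Ioo a b | 0 < f x}.indicator
      (fun x => f x * h x ^ 2) z + g z ^ 2) ≤
      √(2 * δ) * (dissip a b f h + ∫ x in a..b, g x ^ 2) := by
    rw [intervalIntegral.integral_const_mul, intervalIntegral.integral_add hDi hgi]
    gcongr
  refine le_trans ?_ (add_le_add_right hR _)
  rw [← intervalIntegral.integral_add hqi ((hDi.add hgi).const_mul _)]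
  refine intervalIntegral.integral_mono_on hxy hFi (hqi.add ((hDi.add hgi).const_mul _)) ?_
  intro z hz
  have hz' := hs hz
  have hf0 := hP.nonneg z (Ioo_subset_Icc_self hz')
  have hW0 : 0 ≤ W (f z) := sub_nonneg.2 (cut_anti hη hηδ hf0)
  have e3 : |g z| ^ 3 = g z * (g z * |g z|) := by
    rw [show |g z| ^ 3 = |g z| ^ 2 * |g z| by ring, sq_abs]; ring
  rw [e3]
  have key : -(W (f z) * (2 * |g z| * h z)) ≤ √(2 * δ) * ({x ∈ Ioo a b | 0 < f x}.indicator
      (fun x => f x * h x ^ 2) z + g z ^ 2) := by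
    by_cases hpos : 0 < f z
    · rw [indicator_of_mem (show z ∈ {x ∈ Ioo a b | 0 < f x} from ⟨hz', hpos⟩)]
      have w1 : W (f z) ≤ √(2 * δ) * √(f z) := by
        rw [← Real.sqrt_mul (by positivity)]
        refine Real.le_sqrt_of_sq_le ?_
        have a1 : W (f z) ≤ f z := by
          have := cut_le η hf0
          have := cut_nonneg (s := f z) hδ
          simp only [hW]; linarith
        have a2 : W (f z) ≤ 2 * δ := by
          have := cut_le η hf0
          have := sub_le_cut (s := f z) hδ
          simp only [hW]; linarith
        nlinarith
      have hsf := Real.sq_sqrt hf0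
      have h1 : -(W (f z) * (2 * |g z| * h z)) ≤ W (f z) * (2 * |g z| * |h z|) := by
        have := neg_abs_le (h z)
        have h2 : 0 ≤ W (f z) * (2 * |g z|) := by positivity
        nlinarith
      have h2 : W (f z) * (2 * |g z| * |h z|) ≤ (√(2 * δ) * √(f z)) * (2 * |g z| * |h z|) := by
        gcongr
      have h3 : √(f z) * (2 * |g z| * |h z|) ≤ f z * h z ^ 2 + g z ^ 2 := by
        have h4 := sq_nonneg (√(f z) * |h z| - |g z|)
        have h5 : (√(f z) * |h z| - |g z|) ^ 2 = √(f z) ^ 2 * |h z| ^ 2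
          - √(f z) * (2 * |g z| * |h z|) + |g z| ^ 2 := by ring
        rw [h5, hsf, sq_abs, sq_abs] at h4
        linarith
      calc _ ≤ _ := h1
        _ ≤ _ := h2
        _ = √(2 * δ) * (√(f z) * (2 * |g z| * |h z|)) := by ring
        _ ≤ _ := by gcongr
    · have : W (f z) = 0 := by
        have : f z ≤ 0 := not_lt.1 hpos
        simp [hW, cut_of_le hη (this.trans hη.le), cut_of_le hδ (this.trans hδ.le)]
      rw [this]
      have := dissip_term_nonneg a b f h z
      simp only [zero_mul, neg_zero]
      positivity
  have e4 : ∀ r : ℝ, r * (g z * (g z * |g z|)) = r * g z * (g z * |g z|) := fun r => by ring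
  rw [e4]
  linarith

/-- A Bernis-type inequality: the cubic slope integral near the zero set is controlled by the
entropy dissipation and the energy. -/
theorem integral_one_sub_ramp_le (hP : IsProfile a b f g h k) {δ : ℝ} (hδ : 0 < δ) :
    ∫ x in a..b, (1 - ramp δ (f x)) * |g x| ^ 3 ≤
      √(2 * δ) * (dissip a b f h + ∫ x in a..b, g x ^ 2) := by
  have hT : Tendsto (fun n : ℕ => ∫ x in a..b,
      (ramp (δ / (n + 1)) (f x) - ramp δ (f x)) * |g x| ^ 3) atTop
      (𝓝 (∫ x in a..b, (1 - ramp δ (f x)) * |g x| ^ 3)) := by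
    have hu : uIcc a b = Icc a b := uIcc_of_le hP.lt.le
    have hI : uIoc a b ⊆ Icc a b := by rw [uIoc_of_le hP.lt.le]; exact Ioc_subset_Icc_self
    refine intervalIntegral.tendsto_integral_filter_of_dominated_convergence (fun x => |g x| ^ 3)
      ?_ ?_ ?_ ?_
    · refine Eventually.of_forall fun n => ?_
      refine ContinuousOn.aestronglyMeasurable ?_ measurableSet_uIoc
      exact ((((continuous_ramp _).comp_continuousOn hP.cont).sub
        ((continuous_ramp _).comp_continuousOn hP.cont)).mul (hP.g_cont.abs.pow 3)).mono hI
    · refine Eventually.of_forall fun n => ae_of_all _ fun x _ => ?_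
      rw [Real.norm_eq_abs, abs_mul, abs_of_nonneg (show 0 ≤ |g x| ^ 3 by positivity)]
      refine mul_le_of_le_one_left (by positivity) ?_
      rw [abs_le]
      have := ramp_nonneg δ (f x)
      have := ramp_le_one δ (f x)
      have := ramp_nonneg (δ / (n + 1)) (f x)
      have := ramp_le_one (δ / (n + 1)) (f x)
      constructor <;> linarith
    · exact (show ContinuousOn _ (uIcc a b) by rw [hu]; exact hP.g_cont.abs.pow 3).intervalIntegrable
    · refine ae_of_all _ fun x hx => ?_
      have hx' := hI hx
      rcases eq_or_lt_of_le (hP.nonneg x hx') with h0 | h0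
      · simp [hP.g_eq_zero hx' h0.symm]
      · have hlim : Tendsto (fun n : ℕ => 2 * (δ / ((n : ℝ) + 1))) atTop (𝓝 0) := by
          have := (tendsto_one_div_add_atTop_nhds_zero_nat (𝕜 := ℝ)).const_mul (2 * δ)
          rw [mul_zero] at this
          exact this.congr fun n => by ring
        refine Tendsto.congr' ?_ tendsto_const_nhds
        filter_upwards [hlim.eventually (gt_mem_nhds h0)] with n hn
        rw [ramp_of_ge (by positivity) hn.le]
  refine le_of_tendsto hT (Eventually.of_forall fun n => ?_)
  refine hP.bernis_aux (by positivity) (div_le_self hδ.le ?_)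
  have : (0 : ℝ) ≤ n := n.cast_nonneg
  linarith

end IsProfile

end

section

variable {a b : ℝ} {f g h k : ℝ → ℝ}

namespace IsProfile

theorem measurableSet_superlevel (hP : IsProfile a b f g h k) (δ : ℝ) :
    MeasurableSet {x ∈ Ioo a b | δ < f x} :=
  ((hP.cont.mono Ioo_subset_Icc_self).isOpen_inter_preimage isOpen_Ioo isOpen_Ioi).measurableSet

theorem indicator_intervalIntegrable (hP : IsProfile a b f g h k) (δ p q : ℝ) :
    IntervalIntegrable ({z ∈ Ioo a b | δ < f z}.indicator (fun _ => (1 : ℝ))) volume p q := by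
  have h1 : IntervalIntegrable (fun _ => (1 : ℝ)) volume p q := intervalIntegrable_const
  rw [intervalIntegrable_iff] at h1 ⊢
  exact h1.indicator (hP.measurableSet_superlevel δ)

theorem intervalIntegrable (_hP : IsProfile a b f g h k) {F : ℝ → ℝ} (hF : ContinuousOn F (Icc a b))
    {x y : ℝ} (hx : x ∈ Icc a b) (hy : y ∈ Icc a b) : IntervalIntegrable F volume x y :=
  (hF.mono (ordConnected_Icc.uIcc_subset hx hy)).intervalIntegrable

theorem integral_ramp_le (hP : IsProfile a b f g h k) {δ : ℝ} (hδ : 0 < δ) :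
    (∫ x in a..b, ramp δ (f x) * g x ^ 2) ^ 2 ≤ dissip a b f h * ∫ x in a..b, cut δ (f x) := by
  have hcutc : ContinuousOn (fun x => cut δ (f x)) (Icc a b) :=
    (continuous_cut δ).comp_continuousOn hP.cont
  have hFc : ContinuousOn (fun x => ramp δ (f x) * g x ^ 2) (Icc a b) :=
    ((continuous_ramp δ).comp_continuousOn hP.cont).mul (hP.g_cont.pow 2)
  have ha := left_mem_Icc.2 hP.lt.le
  have hb := right_mem_Icc.2 hP.lt.le
  refine sq_le_mul_of_forall_le (intervalIntegral.integral_nonneg hP.lt.le fun x _ =>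
    mul_nonneg (ramp_nonneg _ _) (sq_nonneg _)) (dissip_nonneg a b f h)
    (intervalIntegral.integral_nonneg hP.lt.le fun x _ => cut_nonneg hδ) fun μ hμ => ?_
  have hsub : {x ∈ Ioo a b | 0 < f x} ⊆ Icc a b := fun x hx => Ioo_subset_Icc_self hx.1
  have hQ := isSobolevDerivOn_of_pos (hP.cont.mono Ioo_subset_Icc_self) hδ
    (((hP.comp_deriv (hasDerivAt_cut δ) (continuous_ramp δ)).mono hsub).mul hP.deriv_two) (by
      intro x _ hx
      simp [cut_of_le hδ hx.le, ramp_of_le hδ hx.le])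
  refine integral_le_of_forall_interior (Q := fun x => cut δ (f x) * g x) hP.lt hFc
    (hcutc.mul hP.g_cont) (by simp [hP.g_left]) (by simp [hP.g_right]) fun x y hx hxy hy => ?_
  have hs : Icc x y ⊆ Ioo a b := fun z hz => ⟨hx.trans_le hz.1, hz.2.trans_lt hy⟩
  have hx' : x ∈ Icc a b := Ioo_subset_Icc_self (hs (left_mem_Icc.2 hxy))
  have hy' : y ∈ Icc a b := Ioo_subset_Icc_self (hs (right_mem_Icc.2 hxy))
  obtain ⟨hqi, hq⟩ := hQ x y hxy hs
  rw [← hq]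
  have hFi := hP.intervalIntegrable hFc hx' hy'
  have hci := hP.intervalIntegrable hcutc hx' hy'
  have hDi := hP.dissip_intervalIntegrable hxy hx hy
  have hc_le : ∫ z in x..y, cut δ (f z) ≤ ∫ z in a..b, cut δ (f z) :=
    intervalIntegral.integral_mono_interval hx.le hxy hy.le
      (ae_of_all _ fun z => cut_nonneg hδ) (hP.intervalIntegrable hcutc ha hb)
  have hD_le := hP.dissip_integral_le hxy hx hy
  have hR : ∫ z in x..y, (1 / 2 * μ * {x ∈ Ioo a b | 0 < f x}.indicator
      (fun x => f x * h x ^ 2) z + 1 / (2 * μ) * cut δ (f z)) ≤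
      1 / 2 * (μ * dissip a b f h + (∫ x in a..b, cut δ (f x)) / μ) := by
    rw [intervalIntegral.integral_add (hDi.const_mul _) (hci.const_mul _),
      intervalIntegral.integral_const_mul, intervalIntegral.integral_const_mul]
    have e : 1 / 2 * (μ * dissip a b f h + (∫ x in a..b, cut δ (f x)) / μ) =
      1 / 2 * μ * dissip a b f h + 1 / (2 * μ) * ∫ x in a..b, cut δ (f x) := by
      field_simp
    rw [e]
    gcongr
  refine le_trans ?_ (add_le_add_right hR _)
  have hRi := (hDi.const_mul (1 / 2 * μ)).add (hci.const_mul (1 / (2 * μ)))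
  rw [← intervalIntegral.integral_add hqi hRi]
  refine intervalIntegral.integral_mono_on hxy hFi (hqi.add hRi) fun z hz => ?_
  have hz' := hs hz
  have hf0 := hP.nonneg z (Ioo_subset_Icc_self hz')
  have key : -(cut δ (f z) * h z) ≤ 1 / 2 * μ * {x ∈ Ioo a b | 0 < f x}.indicator
      (fun x => f x * h x ^ 2) z + 1 / (2 * μ) * cut δ (f z) := by
    by_cases hpos : 0 < f z
    · rw [indicator_of_mem (show z ∈ {x ∈ Ioo a b | 0 < f x} from ⟨hz', hpos⟩)]
      have h1 : cut δ (f z) * h z ^ 2 ≤ f z * h z ^ 2 := by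
        gcongr; exact cut_le δ hf0
      have h0 : 0 ≤ cut δ (f z) := cut_nonneg hδ
      have h2 : 0 ≤ cut δ (f z) * (μ * h z + 1) ^ 2 / (2 * μ) := by positivity
      have h3 : cut δ (f z) * (μ * h z + 1) ^ 2 / (2 * μ) = 1 / 2 * μ * (cut δ (f z) * h z ^ 2)
        + cut δ (f z) * h z + 1 / (2 * μ) * cut δ (f z) := by
        field_simp; ring
      rw [h3] at h2
      have h4 := mul_le_mul_of_nonneg_left h1 (show 0 ≤ 1 / 2 * μ by positivity)
      linarith
    · have : cut δ (f z) = 0 := cut_of_le hδ ((not_lt.1 hpos).trans hδ.le)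
      rw [this]
      have := dissip_term_nonneg a b f h z
      simp only [zero_mul, neg_zero, mul_zero, add_zero]
      positivity
  have e4 : ramp δ (f z) * g z ^ 2 = ramp δ (f z) * g z * g z := by ring
  rw [e4]
  linarith

/-- A Poincaré-type inequality on the superlevel set `{f > δ}`, with the sharp constant. -/
theorem integral_cut_le (hP : IsProfile a b f g h k) {δ : ℝ} (hδ : 0 < δ) {x y : ℝ}
    (hx : a ≤ x) (hxy : x ≤ y) (hy : y ≤ b) {s c : ℝ}
    (hs : s = ∫ z in x..y, {z ∈ Ioo a b | δ < f z}.indicator (fun _ => (1 : ℝ)) z)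
    (hxc : f x ≤ δ ∨ c = 0) (hyc : f y ≤ δ ∨ c = s) {μ : ℝ} (hμ : 0 < μ) :
    ∫ z in x..y, cut δ (f z) ≤
      1 / 2 * (μ * (∫ z in x..y, ramp δ (f z) * g z ^ 2) + (((s - c) ^ 3 + c ^ 3) / 3) / μ) := by
  set S := {z ∈ Ioo a b | δ < f z} with hS
  set ι : ℝ → ℝ := S.indicator fun _ => 1 with hι
  have hIcc : Icc x y ⊆ Icc a b := Icc_subset_Icc hx hy
  have hιi : ∀ p q, IntervalIntegrable ι volume p q := fun p q =>
    hP.indicator_intervalIntegrable δ p q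
  set Λ : ℝ → ℝ := fun z => (∫ w in x..z, ι w) + (-c) with hΛ
  have hΛd : IsSobolevDerivOn (Icc x y) Λ ι := by
    intro p q _ _
    refine ⟨hιi p q, ?_⟩
    rw [← intervalIntegral.integral_interval_sub_left (hιi x q) (hιi x p)]
    simp [hΛ]
  have hΛx : Λ x = -c := by simp [hΛ]
  have hΛy : Λ y = s - c := by rw [hs]; rfl
  have hw := (hP.comp_deriv (hasDerivAt_cut δ) (continuous_ramp δ)).mono hIcc
  have hl := left_mem_Icc.2 hxy
  have hr := right_mem_Icc.2 hxy
  obtain ⟨i1, e1⟩ := (hw.mul hΛd) x y hxy Subset.rfl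
  obtain ⟨i2, e2⟩ := (hΛd.mul (hΛd.mul hΛd)) x y hxy Subset.rfl
  have hbx : cut δ (f x) * Λ x = 0 := by
    rcases hxc with h0 | h0
    · rw [cut_of_le hδ h0, zero_mul]
    · rw [hΛx, h0]; simp
  have hby : cut δ (f y) * Λ y = 0 := by
    rcases hyc with h0 | h0
    · rw [cut_of_le hδ h0, zero_mul]
    · rw [hΛy, h0]; simp
  beta_reduce at e1 e2
  rw [hbx, hby, sub_zero] at e1
  have hFc : ContinuousOn (fun x => ramp δ (f x) * g x ^ 2) (Icc a b) :=
    ((continuous_ramp δ).comp_continuousOn hP.cont).mul (hP.g_cont.pow 2)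
  have iF := hP.intervalIntegrable hFc (hIcc hl) (hIcc hr)
  have iC := hP.intervalIntegrable ((continuous_cut δ).comp_continuousOn hP.cont) (hIcc hl) (hIcc hr)
  have hV : ((s - c) ^ 3 + c ^ 3) / 3 = 1 / 3 * ∫ z in x..y,
      (ι z * (Λ z * Λ z) + Λ z * (ι z * Λ z + Λ z * ι z)) := by
    rw [e2, hΛx, hΛy]; ring
  have hfin : 1 / 2 * (μ * (∫ z in x..y, ramp δ (f z) * g z ^ 2)
      + (((s - c) ^ 3 + c ^ 3) / 3) / μ) = ∫ z in x..y, (1 / 2 * μ * (ramp δ (f z) * g z ^ 2)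
        + 1 / (6 * μ) * (ι z * (Λ z * Λ z) + Λ z * (ι z * Λ z + Λ z * ι z))
        + (ramp δ (f z) * g z * Λ z + cut δ (f z) * ι z)) := by
    rw [intervalIntegral.integral_add ((iF.const_mul _).add (i2.const_mul _)) i1,
      intervalIntegral.integral_add (iF.const_mul _) (i2.const_mul _),
      intervalIntegral.integral_const_mul, intervalIntegral.integral_const_mul, e1, hV]
    field_simp
    ring_nf
  rw [hfin]
  refine intervalIntegral.integral_mono_on_of_le_Ioo hxy iC
    (((iF.const_mul _).add (i2.const_mul _)).add i1) fun z hz => ?_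
  have hz' : z ∈ Ioo a b := ⟨hx.trans_lt hz.1, hz.2.trans_le hy⟩
  by_cases hzS : δ < f z
  · have hι1 : ι z = 1 := indicator_of_mem (show z ∈ S from ⟨hz', hzS⟩) _
    rw [hι1]
    have r0 := ramp_nonneg δ (f z)
    have r1 := ramp_le_one δ (f z)
    have p1 : 0 ≤ (μ * (ramp δ (f z) * g z) + Λ z) ^ 2 / (2 * μ) := by positivity
    have p2 : (μ * (ramp δ (f z) * g z) + Λ z) ^ 2 / (2 * μ) =
      1 / 2 * μ * (ramp δ (f z) ^ 2 * g z ^ 2) + ramp δ (f z) * g z * Λ z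
        + 1 / (6 * μ) * (3 * Λ z ^ 2) := by
      field_simp
      ring
    have p3 : ramp δ (f z) ^ 2 * g z ^ 2 ≤ ramp δ (f z) * g z ^ 2 := by
      gcongr
      nlinarith
    have p4 := mul_le_mul_of_nonneg_left p3 (show 0 ≤ 1 / 2 * μ by positivity)
    have p5 : 1 * (Λ z * Λ z) + Λ z * (1 * Λ z + Λ z * 1) = 3 * Λ z ^ 2 := by ring
    rw [p5]
    linarith
  · have hι0 : ι z = 0 := indicator_of_notMem (fun hm => hzS hm.2) _
    rw [hι0, ramp_of_le hδ (not_lt.1 hzS), cut_of_le hδ (not_lt.1 hzS)]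
    simp

theorem volume_superlevel (hP : IsProfile a b f g h k) (δ : ℝ) :
    volume.real {z ∈ Ioo a b | δ < f z} =
      ∫ z in a..b, {z ∈ Ioo a b | δ < f z}.indicator (fun _ => (1 : ℝ)) z := by
  rw [intervalIntegral.integral_of_le hP.lt.le, integral_Ioc_eq_integral_Ioo,
    integral_indicator (hP.measurableSet_superlevel δ), setIntegral_const, smul_eq_mul, mul_one,
    measureReal_restrict_apply (hP.measurableSet_superlevel δ)]
  congr 1
  exact (inter_eq_left.2 fun x hx => hx.1).symm

theorem cube_le_aux (hP : IsProfile a b f g h k) {δ : ℝ} (hδ : 0 < δ) {V : ℝ} (hV : 0 ≤ V)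
    (H : ∀ μ > 0, ∫ z in a..b, cut δ (f z) ≤
      1 / 2 * (μ * (∫ z in a..b, ramp δ (f z) * g z ^ 2) + V / μ)) :
    (∫ x in a..b, cut δ (f x)) ^ 3 ≤ dissip a b f h * V ^ 2 := by
  have hm : 0 ≤ ∫ x in a..b, cut δ (f x) :=
    intervalIntegral.integral_nonneg hP.lt.le fun x _ => cut_nonneg hδ
  have he : 0 ≤ ∫ z in a..b, ramp δ (f z) * g z ^ 2 :=
    intervalIntegral.integral_nonneg hP.lt.le fun x _ => mul_nonneg (ramp_nonneg _ _) (sq_nonneg _)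
  have h1 := sq_le_mul_of_forall_le hm he hV H
  have h2 := hP.integral_ramp_le hδ
  have hD := dissip_nonneg a b f h
  set m := ∫ x in a..b, cut δ (f x)
  set e := ∫ z in a..b, ramp δ (f z) * g z ^ 2
  rcases eq_or_lt_of_le hm with h0 | h0
  · rw [← h0]
    have : 0 ≤ dissip a b f h * V ^ 2 := mul_nonneg hD (sq_nonneg _)
    simpa using this
  · have h3 : m ^ 3 * m ≤ (dissip a b f h * V ^ 2) * m := by
      calc m ^ 3 * m = (m ^ 2) ^ 2 := by ring
        _ ≤ (e * V) ^ 2 := by gcongr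
        _ = e ^ 2 * V ^ 2 := by ring
        _ ≤ (dissip a b f h * m) * V ^ 2 := by gcongr
        _ = _ := by ring
    exact le_of_mul_le_mul_right h3 h0

/-- Lower bound of the dissipation for a profile that is small at both end points. -/
theorem cube_le_of_endpoints (hP : IsProfile a b f g h k) {δ : ℝ} (hδ : 0 < δ)
    (ha : f a ≤ δ) (hb : f b ≤ δ) :
    144 * (∫ x in a..b, cut δ (f x)) ^ 3 ≤
      dissip a b f h * volume.real {z ∈ Ioo a b | δ < f z} ^ 6 := by
  set s := volume.real {z ∈ Ioo a b | δ < f z} with hs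
  have hs0 : 0 ≤ s := measureReal_nonneg
  have := hP.cube_le_aux hδ (V := s ^ 3 / 12) (by positivity) fun μ hμ => by
    refine (hP.integral_cut_le hδ le_rfl hP.lt.le le_rfl (hP.volume_superlevel δ) (c := s / 2)
      (Or.inl ha) (Or.inl hb) hμ).trans (le_of_eq ?_)
    rw [← hs]; ring
  nlinarith

/-- Lower bound of the dissipation for a profile that is small at some point. -/
theorem cube_le_of_exists (hP : IsProfile a b f g h k) {δ : ℝ} (hδ : 0 < δ) {x : ℝ}
    (hx : x ∈ Icc a b) (hfx : f x ≤ δ) :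
    9 * (∫ x in a..b, cut δ (f x)) ^ 3 ≤
      dissip a b f h * volume.real {z ∈ Ioo a b | δ < f z} ^ 6 := by
  set s := volume.real {z ∈ Ioo a b | δ < f z} with hs
  have hs0 : 0 ≤ s := measureReal_nonneg
  have := hP.cube_le_aux hδ (V := s ^ 3 / 3) (by positivity) fun μ hμ => by
    have ha := left_mem_Icc.2 hP.lt.le
    have hb := right_mem_Icc.2 hP.lt.le
    have hcc : ContinuousOn (fun z => cut δ (f z)) (Icc a b) :=
      (continuous_cut δ).comp_continuousOn hP.cont
    have hFc : ContinuousOn (fun x => ramp δ (f x) * g x ^ 2) (Icc a b) :=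
      ((continuous_ramp δ).comp_continuousOn hP.cont).mul (hP.g_cont.pow 2)
    have hιi : ∀ p q, IntervalIntegrable
        ({z ∈ Ioo a b | δ < f z}.indicator (fun _ => (1 : ℝ))) volume p q := hP.indicator_intervalIntegrable δ
    set s₁ := ∫ z in a..x, {z ∈ Ioo a b | δ < f z}.indicator (fun _ => (1 : ℝ)) z with hs₁
    set s₂ := ∫ z in x..b, {z ∈ Ioo a b | δ < f z}.indicator (fun _ => (1 : ℝ)) z with hs₂
    have hi0 : ∀ z, 0 ≤ {z ∈ Ioo a b | δ < f z}.indicator (fun _ => (1 : ℝ)) z :=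
      fun z => indicator_nonneg (fun _ _ => zero_le_one) z
    have h1 : 0 ≤ s₁ := intervalIntegral.integral_nonneg hx.1 fun z _ => hi0 z
    have h2 : 0 ≤ s₂ := intervalIntegral.integral_nonneg hx.2 fun z _ => hi0 z
    have h12 : s₁ + s₂ = s := by
      rw [hs, hP.volume_superlevel δ]
      exact intervalIntegral.integral_add_adjacent_intervals (hιi _ _) (hιi _ _)
    have k1 := hP.integral_cut_le hδ le_rfl hx.1 hx.2 hs₁ (c := 0) (Or.inr rfl) (Or.inl hfx) hμ
    have k2 := hP.integral_cut_le hδ hx.1 hx.2 le_rfl hs₂ (c := s₂) (Or.inl hfx) (Or.inr rfl) hμ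
    rw [← intervalIntegral.integral_add_adjacent_intervals (hP.intervalIntegrable hcc ha hx)
        (hP.intervalIntegrable hcc hx hb),
      ← intervalIntegral.integral_add_adjacent_intervals (hP.intervalIntegrable hFc ha hx)
        (hP.intervalIntegrable hFc hx hb)]
    have h3 : s₁ ^ 3 + s₂ ^ 3 ≤ s ^ 3 := by
      rw [← h12]
      have : 0 ≤ s₁ * s₂ * (s₁ + s₂) := by positivity
      nlinarith
    have h4 : ((s₁ - 0) ^ 3 + 0 ^ 3) / 3 / μ + ((s₂ - s₂) ^ 3 + s₂ ^ 3) / 3 / μ ≤ s ^ 3 / 3 / μ := by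
      rw [← add_div, ← add_div]
      gcongr
      linarith
    linarith
  nlinarith

end IsProfile

end

section

variable {a b : ℝ} {f g h k : ℝ → ℝ}

/-- The spatial production functional `∫_{f>0} f h² φ - (5/6) ∫ g³ φ' - (1/2) ∫ f g² φ''`. -/
def production (a b : ℝ) (f g h φ φ₁ φ₂ : ℝ → ℝ) : ℝ :=
  ∫ x in Ioo a b, ({x ∈ Ioo a b | 0 < f x}.indicator (fun x => f x * h x ^ 2) x * φ x
    - 5 / 6 * (g x ^ 3 * φ₁ x) - 1 / 2 * (f x * g x ^ 2 * φ₂ x))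

namespace IsProfile

theorem integrableOn (_hP : IsProfile a b f g h k) {F : ℝ → ℝ} (hF : ContinuousOn F (Icc a b)) :
    IntegrableOn F (Ioo a b) :=
  hF.integrableOn_Icc.mono_set Ioo_subset_Icc_self

theorem production_integrable (hP : IsProfile a b f g h k) {φ φ₁ φ₂ : ℝ → ℝ}
    (h0 : Continuous φ) (h1 : Continuous φ₁) (h2 : Continuous φ₂) :
    IntegrableOn (fun x => {x ∈ Ioo a b | 0 < f x}.indicator (fun x => f x * h x ^ 2) x * φ x
    - 5 / 6 * (g x ^ 3 * φ₁ x) - 1 / 2 * (f x * g x ^ 2 * φ₂ x)) (Ioo a b) := by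
  refine Integrable.sub (Integrable.sub ?_ ?_) ?_
  · obtain ⟨C, hC⟩ := isCompact_Icc.exists_bound_of_continuousOn (s := Icc a b) h0.continuousOn
    refine hP.diss.mul_bdd (c := C) h0.aestronglyMeasurable ?_
    filter_upwards [ae_restrict_mem measurableSet_Ioo] with x hx
    exact hC x (Ioo_subset_Icc_self hx)
  · exact hP.integrableOn (((hP.g_cont.pow 3).mul h1.continuousOn).const_mul _)
  · exact hP.integrableOn (((hP.cont.mul (hP.g_cont.pow 2)).mul h2.continuousOn).const_mul _)

/-- The production functional is bounded from below by a small quantity. -/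
theorem neg_le_production (hP : IsProfile a b f g h k)
    (hK : IntegrableOn ({x ∈ Ioo a b | 0 < f x}.indicator fun x => f x ^ 3 * k x ^ 2) (Ioo a b))
    {φ φ₁ φ₂ : ℝ → ℝ} (hφ : ∀ x, HasDerivAt φ (φ₁ x) x) (hφ₁ : ∀ x, HasDerivAt φ₁ (φ₂ x) x)
    (hφ₂ : Continuous φ₂) {x y : ℝ} (hx : a < x) (hxy : x ≤ y) (hy : y < b)
    (hsupp : ∀ z, z ∉ Ioo x y → φ z = 0 ∧ φ₁ z = 0 ∧ φ₂ z = 0) {C : ℝ}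
    (hφ0 : ∀ z, 0 ≤ φ z) (hC : ∀ z, φ z ≤ C) (hC₁ : ∀ z, |φ₁ z| ≤ C) (hC₂ : ∀ z, |φ₂ z| ≤ C)
    {δ μ : ℝ} (hδ : 0 < δ) (hμ : 0 < μ) :
    -(C * (μ / 2 * (∫ x in Ioo a b, {x ∈ Ioo a b | 0 < f x}.indicator
          (fun x => f x ^ 3 * k x ^ 2) x) + 1 / (2 * μ * δ) * (∫ x in a..b, g x ^ 2)
        + √(2 * δ) * (dissip a b f h + ∫ x in a..b, g x ^ 2) + δ * ∫ x in a..b, g x ^ 2)) ≤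
      production a b f g h φ φ₁ φ₂ := by
  have hC0 : 0 ≤ C := (hφ0 0).trans (hC 0)
  have c0 : Continuous φ := continuous_iff_continuousAt.2 fun z => (hφ z).continuousAt
  have c1 : Continuous φ₁ := continuous_iff_continuousAt.2 fun z => (hφ₁ z).continuousAt
  set P := {x ∈ Ioo a b | 0 < f x} with hPdef
  have hsub : P ⊆ Icc a b := fun x hx => Ioo_subset_Icc_self hx.1
  set q : ℝ → ℝ := fun z => cut δ (f z) * h z ^ 2 * φ z + cut δ (f z) * g z * k z * φ z
    - 1 / 3 * deriv (ramp δ) (f z) * g z ^ 4 * φ z - 5 / 6 * ramp δ (f z) * g z ^ 3 * φ₁ z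
    - 1 / 2 * cut δ (f z) * g z ^ 2 * φ₂ z with hq
  set Q : ℝ → ℝ := fun z => cut δ (f z) * (g z * (h z * φ z))
    + (-1 / 3 * (ramp δ (f z) * (g z * (g z * (g z * φ z))))
    + -1 / 2 * (cut δ (f z) * (g z * (g z * φ₁ z)))) with hQdef
  have sφ : IsSobolevDerivOn P φ φ₁ := isSobolevDerivOn_of_hasDerivAt (fun z _ => hφ z) c1.continuousOn
  have sφ₁ : IsSobolevDerivOn P φ₁ φ₂ :=
    isSobolevDerivOn_of_hasDerivAt (fun z _ => hφ₁ z) hφ₂.continuousOn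
  have sH := (hP.comp_deriv (hasDerivAt_cut δ) (continuous_ramp δ)).mono hsub
  have sR := (hP.comp_deriv (hasDerivAt_ramp δ) (continuous_deriv_ramp δ)).mono hsub
  have sg := hP.deriv_two
  have sQ : IsSobolevDerivOn P Q q :=
    ((sH.mul (sg.mul (hP.deriv_three.mul sφ))).add
      (((sR.mul (sg.mul (sg.mul (sg.mul sφ)))).const_mul (-1 / 3)).add
        ((sH.mul (sg.mul (sg.mul sφ₁))).const_mul (-1 / 2)))).congr (fun z _ => rfl)
        (fun z _ => by simp only [hq]; ring)
  have sQ' := isSobolevDerivOn_of_pos (hP.cont.mono Ioo_subset_Icc_self) hδ sQ (by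
    intro z _ hz
    simp [hQdef, hq, cut_of_le hδ hz.le, ramp_of_le hδ hz.le, deriv_ramp_of_lt hδ hz])
  obtain ⟨hqi, hq0⟩ := sQ' x y hxy fun z hz => ⟨hx.trans_le hz.1, hz.2.trans_lt hy⟩
  have hQx : Q x = 0 := by
    obtain ⟨e1, e2, -⟩ := hsupp x fun hm => lt_irrefl _ hm.1
    simp [hQdef, e1, e2]
  have hQy : Q y = 0 := by
    obtain ⟨e1, e2, -⟩ := hsupp y fun hm => lt_irrefl _ hm.2
    simp [hQdef, e1, e2]
  have hq_zero : ∀ z, z ∉ Ioo x y → q z = 0 := fun z hz => by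
    obtain ⟨e1, e2, e3⟩ := hsupp z hz
    simp [hq, e1, e2, e3]
  have hsubset : Ioc x y ⊆ Ioo a b := fun z hz => ⟨hx.trans hz.1, hz.2.trans_lt hy⟩
  have hdiff : ∀ z ∈ Ioo a b \ Ioc x y, q z = 0 := fun z hz =>
    hq_zero z fun hm => hz.2 (Ioo_subset_Ioc_self hm)
  have hqI : IntegrableOn q (Ioo a b) :=
    ((intervalIntegrable_iff_integrableOn_Ioc_of_le hxy).1 hqi).of_forall_sdiff_eq_zero
      measurableSet_Ioo hdiff
  have hq_int : ∫ z in Ioo a b, q z = 0 := by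
    rw [setIntegral_eq_of_subset_of_forall_sdiff_eq_zero measurableSet_Ioo hsubset hdiff,
      ← intervalIntegral.integral_of_le hxy, hq0, hQx, hQy, sub_zero]
  have iT := hP.production_integrable c0 c1 hφ₂
  have hEc : ContinuousOn (fun z => g z ^ 2) (Icc a b) := hP.g_cont.pow 2
  have hBc : ContinuousOn (fun z => (1 - ramp δ (f z)) * |g z| ^ 3) (Icc a b) :=
    (continuousOn_const.sub ((continuous_ramp δ).comp_continuousOn hP.cont)).mul (hP.g_cont.abs.pow 3)
  have iE := hP.integrableOn hEc
  have iB := hP.integrableOn hBc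
  have toI : ∀ F : ℝ → ℝ, ∫ z in a..b, F z = ∫ z in Ioo a b, F z := fun F => by
    rw [intervalIntegral.integral_of_le hP.lt.le, integral_Ioc_eq_integral_Ioo]
  have hB := hP.integral_one_sub_ramp_le hδ
  rw [toI, toI] at hB
  simp only [toI]
  have hsum : ∫ z in Ioo a b, -(C * (μ / 2 * P.indicator (fun x => f x ^ 3 * k x ^ 2) z
      + 1 / (2 * μ * δ) * g z ^ 2 + (1 - ramp δ (f z)) * |g z| ^ 3 + δ * g z ^ 2)) =
      -(C * (μ / 2 * (∫ x in Ioo a b, P.indicator (fun x => f x ^ 3 * k x ^ 2) x)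
      + 1 / (2 * μ * δ) * (∫ x in Ioo a b, g x ^ 2)
      + (∫ z in Ioo a b, (1 - ramp δ (f z)) * |g z| ^ 3) + δ * ∫ x in Ioo a b, g x ^ 2)) := by
    have i1 : IntegrableOn (fun z => μ / 2 * P.indicator (fun x => f x ^ 3 * k x ^ 2) z
      + 1 / (2 * μ * δ) * g z ^ 2) (Ioo a b) := (hK.const_mul _).add (iE.const_mul _)
    have i2 : IntegrableOn (fun z => μ / 2 * P.indicator (fun x => f x ^ 3 * k x ^ 2) z
      + 1 / (2 * μ * δ) * g z ^ 2 + (1 - ramp δ (f z)) * |g z| ^ 3) (Ioo a b) := i1.add iB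
    rw [integral_neg, integral_const_mul, integral_add i2 (iE.const_mul _), integral_add i1 iB,
      integral_add (hK.const_mul _) (iE.const_mul _), integral_const_mul, integral_const_mul,
      integral_const_mul]
  have hT : production a b f g h φ φ₁ φ₂ = ∫ z in Ioo a b,
      ((P.indicator (fun x => f x * h x ^ 2) z * φ z
    - 5 / 6 * (g z ^ 3 * φ₁ z) - 1 / 2 * (f z * g z ^ 2 * φ₂ z)) - q z) := by
    rw [integral_sub iT hqI, hq_int, sub_zero]; rfl
  refine le_trans (le_trans (neg_le_neg (mul_le_mul_of_nonneg_left ?_ hC0)) hsum.ge) (hT ▸ ?_)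
  · gcongr
  refine setIntegral_mono_on ?_ (iT.sub hqI) measurableSet_Ioo ?_
  · exact (((((hK.const_mul _).add (iE.const_mul _)).add iB).add (iE.const_mul _)).const_mul C).neg
  intro z hz
  have hzc := Ioo_subset_Icc_self hz
  have hf0 := hP.nonneg z hzc
  rcases eq_or_lt_of_le hf0 with h0 | h0
  · have hg := hP.g_eq_zero hzc h0.symm
    have hnot : z ∉ P := fun hm => hm.2.ne h0
    rw [indicator_of_notMem hnot, indicator_of_notMem hnot]
    simp [hq, hg, cut_of_le hδ (h0 ▸ hδ.le)]
  · have hm : z ∈ P := ⟨hz, h0⟩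
    rw [indicator_of_mem hm, indicator_of_mem hm]
    have H0 := cut_nonneg (s := f z) hδ
    have H1 := cut_le δ hf0
    have H2 := sub_le_cut (s := f z) hδ
    have R0 := ramp_nonneg δ (f z)
    have R1 := ramp_le_one δ (f z)
    have D0 := deriv_ramp_nonneg hδ (f z)
    have p0 := hφ0 z
    have pC := hC z
    have id : f z * h z ^ 2 * φ z - 5 / 6 * (g z ^ 3 * φ₁ z) - 1 / 2 * (f z * g z ^ 2 * φ₂ z) - q z
        = (f z - cut δ (f z)) * h z ^ 2 * φ z + 1 / 3 * deriv (ramp δ) (f z) * g z ^ 4 * φ z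
          - φ z * (cut δ (f z) * g z * k z) - 5 / 6 * ((1 - ramp δ (f z)) * (g z ^ 3 * φ₁ z))
          - 1 / 2 * (f z - cut δ (f z)) * g z ^ 2 * φ₂ z := by
      simp only [hq]; ring
    rw [id]
    have t1 : 0 ≤ (f z - cut δ (f z)) * h z ^ 2 * φ z :=
      mul_nonneg (mul_nonneg (sub_nonneg.2 H1) (sq_nonneg _)) p0
    have t2 : 0 ≤ 1 / 3 * deriv (ramp δ) (f z) * g z ^ 4 * φ z := by positivity
    have t3 : φ z * (cut δ (f z) * g z * k z) ≤
        C * (μ / 2 * (f z ^ 3 * k z ^ 2) + 1 / (2 * μ * δ) * g z ^ 2) := by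
      have hnn : 0 ≤ μ / 2 * (f z ^ 3 * k z ^ 2) + 1 / (2 * μ * δ) * g z ^ 2 := by positivity
      have hin : cut δ (f z) * g z * k z ≤
          μ / 2 * (f z ^ 3 * k z ^ 2) + 1 / (2 * μ * δ) * g z ^ 2 := by
        by_cases hfd : f z ≤ δ
        · rw [cut_of_le hδ hfd]; simpa using hnn
        · have hfd' := not_le.1 hfd
          have s1 : 0 ≤ (μ * f z ^ 3 * k z - cut δ (f z) * g z) ^ 2 / (2 * μ * f z ^ 3) := by
            positivity
          have s2 : (μ * f z ^ 3 * k z - cut δ (f z) * g z) ^ 2 / (2 * μ * f z ^ 3) =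
              μ / 2 * (f z ^ 3 * k z ^ 2) - cut δ (f z) * g z * k z
                + cut δ (f z) ^ 2 * g z ^ 2 / (2 * μ * f z ^ 3) := by
            field_simp
            ring
          have s3 : cut δ (f z) ^ 2 * g z ^ 2 / (2 * μ * f z ^ 3) ≤
              f z ^ 2 * g z ^ 2 / (2 * μ * f z ^ 3) := by gcongr
          have s4 : f z ^ 2 * g z ^ 2 / (2 * μ * f z ^ 3) = 1 / (2 * μ * f z) * g z ^ 2 := by
            field_simp
          have s5 : 1 / (2 * μ * f z) * g z ^ 2 ≤ 1 / (2 * μ * δ) * g z ^ 2 := by gcongr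
          linarith
      calc _ ≤ φ z * (μ / 2 * (f z ^ 3 * k z ^ 2) + 1 / (2 * μ * δ) * g z ^ 2) := by gcongr
        _ ≤ _ := by gcongr
    have t4 : 5 / 6 * ((1 - ramp δ (f z)) * (g z ^ 3 * φ₁ z)) ≤
        C * ((1 - ramp δ (f z)) * |g z| ^ 3) := by
      have s1 : g z ^ 3 * φ₁ z ≤ |g z| ^ 3 * C := by
        refine (le_abs_self _).trans ?_
        rw [abs_mul, abs_pow]
        gcongr
        exact hC₁ z
      have s2 : 0 ≤ C * ((1 - ramp δ (f z)) * |g z| ^ 3) :=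
        mul_nonneg hC0 (mul_nonneg (sub_nonneg.2 R1) (by positivity))
      have s3 : (1 - ramp δ (f z)) * (g z ^ 3 * φ₁ z) ≤ (1 - ramp δ (f z)) * (|g z| ^ 3 * C) :=
        mul_le_mul_of_nonneg_left s1 (sub_nonneg.2 R1)
      have s4 : (1 - ramp δ (f z)) * (|g z| ^ 3 * C) = C * ((1 - ramp δ (f z)) * |g z| ^ 3) := by ring
      linarith
    have t5 : 1 / 2 * (f z - cut δ (f z)) * g z ^ 2 * φ₂ z ≤ C * (δ * g z ^ 2) := by
      have s1 : φ₂ z ≤ C := (le_abs_self _).trans (hC₂ z)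
      have s2 : 0 ≤ 1 / 2 * (f z - cut δ (f z)) * g z ^ 2 :=
        mul_nonneg (mul_nonneg (by norm_num) (sub_nonneg.2 H1)) (sq_nonneg _)
      have s3 : 1 / 2 * (f z - cut δ (f z)) ≤ δ := by linarith
      calc _ ≤ 1 / 2 * (f z - cut δ (f z)) * g z ^ 2 * C := by gcongr
        _ ≤ δ * g z ^ 2 * C := by gcongr
        _ = _ := by ring
    rw [mul_add, mul_add]
    linarith

/-- The cubic slope integral is finite and controlled by the dissipation and the energy. -/
theorem integral_cube_le (hP : IsProfile a b f g h k) {U : ℝ} (hU : 0 < U)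
    (hf : ∀ x ∈ Icc a b, f x ≤ U) :
    ∫ x in Ioo a b, |g x| ^ 3 ≤ √(2 * U) * (dissip a b f h + ∫ x in a..b, g x ^ 2) := by
  have h1 := hP.integral_one_sub_ramp_le hU
  rw [← integral_Ioc_eq_integral_Ioo, ← intervalIntegral.integral_of_le hP.lt.le]
  refine le_of_eq_of_le (intervalIntegral.integral_congr fun x hx => ?_) h1
  rw [uIcc_of_le hP.lt.le] at hx
  simp [ramp_of_le hU (hf x hx)]

end IsProfile

end

section

/-! ### The entropy function -/

section Entropy

variable {n : ℝ}

theorem den_pos {v : ℝ} (n : ℝ) (hv : 0 < v) : 0 < v ^ (n - 1) + v ^ 2 := by positivity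

theorem inv_den_le_rpow {v : ℝ} (n : ℝ) (hv : 0 < v) : 1 / (v ^ (n - 1) + v ^ 2) ≤ v ^ (-2 : ℝ) := by
  rw [Real.rpow_neg hv.le, ← one_div, Real.rpow_two]
  have := Real.rpow_pos_of_pos hv (n - 1)
  gcongr
  linarith

theorem continuousOn_inv_den (n : ℝ) :
    ContinuousOn (fun v : ℝ => 1 / (v ^ (n - 1) + v ^ 2)) (Ioi 0) := by
  refine continuousOn_const.div ?_ fun v hv => (den_pos n hv).ne'
  exact (continuousOn_id.rpow_const fun v hv => Or.inl (ne_of_gt hv)).add (continuousOn_id.pow 2)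

theorem integrableOn_inv_den (n : ℝ) {s : ℝ} (hs : 0 < s) :
    IntegrableOn (fun v : ℝ => 1 / (v ^ (n - 1) + v ^ 2)) (Ioi s) := by
  refine (integrableOn_Ioi_rpow_of_lt (a := -2) (by norm_num) hs).mono' ?_ ?_
  · exact ((continuousOn_inv_den n).mono (Ioi_subset_Ioi hs.le)).aestronglyMeasurable
      measurableSet_Ioi
  · filter_upwards [ae_restrict_mem measurableSet_Ioi] with v hv
    have hv0 : 0 < v := hs.trans hv
    rw [Real.norm_of_nonneg (div_nonneg zero_le_one (den_pos n hv0).le)]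
    exact inv_den_le_rpow n hv0

theorem dB_nonneg (n : ℝ) {s : ℝ} (hs : 0 ≤ s) : 0 ≤ dB n s :=
  setIntegral_nonneg measurableSet_Ioi fun _ hv =>
    div_nonneg zero_le_one (den_pos n (lt_of_le_of_lt hs hv)).le

theorem dB_le_inv (n : ℝ) {s : ℝ} (hs : 0 < s) : dB n s ≤ s⁻¹ := by
  have h1 : dB n s ≤ ∫ v in Ioi s, v ^ (-2 : ℝ) :=
    setIntegral_mono_on (integrableOn_inv_den n hs)
      (integrableOn_Ioi_rpow_of_lt (by norm_num) hs) measurableSet_Ioi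
      fun v hv => inv_den_le_rpow n (hs.trans hv)
  rw [integral_Ioi_rpow_of_lt (by norm_num) hs] at h1
  norm_num at h1
  rwa [Real.rpow_neg_one] at h1

theorem dB_eq_sub (n : ℝ) {c s : ℝ} (hc : 0 < c) (hs : c ≤ s) :
    dB n s = dB n c - ∫ v in c..s, 1 / (v ^ (n - 1) + v ^ 2) := by
  have hi := integrableOn_inv_den n hc
  rw [dB, dB, ← Ioc_union_Ioi_eq_Ioi hs, setIntegral_union (by
    rw [Set.disjoint_left]; exact fun x h1 h2 => not_lt.2 h1.2 h2) measurableSet_Ioi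
    (hi.mono_set fun x hx => hx.1) (hi.mono_set (Ioi_subset_Ioi hs)),
    intervalIntegral.integral_of_le hs]
  ring

theorem continuousOn_dB (n : ℝ) : ContinuousOn (dB n) (Ioi 0) := by
  intro s hs
  have hs : 0 < s := hs
  have h1 : ContinuousOn (fun s => dB n (s / 2) - ∫ v in (s / 2)..s, 1 / (v ^ (n - 1) + v ^ 2)) {s} :=
    continuousOn_singleton _ _
  have hcont : ContinuousOn (fun r => ∫ v in (s / 2)..r, 1 / (v ^ (n - 1) + v ^ 2))
      (Icc (s / 2) (2 * s)) := by
    have := intervalIntegral.continuousOn_primitive_interval (μ := volume)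
      (f := fun v : ℝ => 1 / (v ^ (n - 1) + v ^ 2)) (a := s / 2) (b := 2 * s) (by
        rw [uIcc_of_le (by linarith)]
        exact ((continuousOn_inv_den n).mono fun v hv =>
          (show (0 : ℝ) < v by linarith [hv.1])).integrableOn_Icc)
    rwa [uIcc_of_le (by linarith)] at this
  have h2 : ContinuousAt (fun r => dB n (s / 2) - ∫ v in (s / 2)..r, 1 / (v ^ (n - 1) + v ^ 2)) s :=
    continuousAt_const.sub (hcont.continuousAt (Icc_mem_nhds (by linarith) (by linarith)))
  refine (h2.congr ?_).continuousWithinAt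
  filter_upwards [Ioi_mem_nhds (show s / 2 < s by linarith)] with r hr
  exact (dB_eq_sub n (by linarith) (le_of_lt hr)).symm

theorem exists_dB_le_rpow (hn : 0 < n) (hn3 : n < 3) :
    ∃ C, 0 ≤ C ∧ ∀ s : ℝ, 0 < s → dB n s ≤ C * s ^ (-n / 3) := by
  have hcont : ContinuousOn (fun v : ℝ => v ^ (n / 3) * (1 / (v ^ (n - 1) + v ^ 2))) (Ioi 0) :=
    (continuousOn_id.rpow_const fun v hv => Or.inl (ne_of_gt hv)).mul (continuousOn_inv_den n)
  have h01 : IntegrableOn (fun v : ℝ => v ^ (n / 3) * (1 / (v ^ (n - 1) + v ^ 2))) (Ioc 0 1) := by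
    have hr : IntervalIntegrable (fun v : ℝ => v ^ (1 - 2 * n / 3)) volume 0 1 :=
      intervalIntegral.intervalIntegrable_rpow' (by linarith)
    rw [intervalIntegrable_iff_integrableOn_Ioc_of_le zero_le_one] at hr
    refine hr.mono' ((hcont.mono fun v hv => hv.1).aestronglyMeasurable measurableSet_Ioc) ?_
    filter_upwards [ae_restrict_mem measurableSet_Ioc] with v hv
    have hv0 : 0 < v := hv.1
    have hd := den_pos n hv0
    rw [Real.norm_of_nonneg (by positivity)]
    calc v ^ (n / 3) * (1 / (v ^ (n - 1) + v ^ 2)) ≤ v ^ (n / 3) * (1 / v ^ (n - 1)) := by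
          gcongr
          linarith [sq_nonneg v]
      _ = v ^ (1 - 2 * n / 3) := by
          rw [one_div, ← Real.rpow_neg hv0.le, ← Real.rpow_add hv0]; ring_nf
  have h1 : IntegrableOn (fun v : ℝ => v ^ (n / 3) * (1 / (v ^ (n - 1) + v ^ 2))) (Ioi 1) := by
    refine (integrableOn_Ioi_rpow_of_lt (a := n / 3 - 2) (by linarith) zero_lt_one).mono'
      ((hcont.mono (Ioi_subset_Ioi zero_le_one)).aestronglyMeasurable measurableSet_Ioi) ?_
    filter_upwards [ae_restrict_mem measurableSet_Ioi] with v hv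
    have hv0 : 0 < v := zero_lt_one.trans hv
    have hd := den_pos n hv0
    rw [Real.norm_of_nonneg (by positivity), show n / 3 - 2 = n / 3 + (-2) by ring, Real.rpow_add hv0]
    gcongr
    exact inv_den_le_rpow n hv0
  have hall : IntegrableOn (fun v : ℝ => v ^ (n / 3) * (1 / (v ^ (n - 1) + v ^ 2))) (Ioi 0) := by
    rw [← Ioc_union_Ioi_eq_Ioi zero_le_one]; exact h01.union h1
  refine ⟨∫ v in Ioi (0 : ℝ), v ^ (n / 3) * (1 / (v ^ (n - 1) + v ^ 2)),
    setIntegral_nonneg measurableSet_Ioi fun v hv => ?_, fun s hs => ?_⟩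
  · have hv0 : 0 < v := hv
    have hd := den_pos n hv0
    positivity
  have hsub : IntegrableOn (fun v : ℝ => v ^ (n / 3) * (1 / (v ^ (n - 1) + v ^ 2))) (Ioi s) :=
    hall.mono_set (Ioi_subset_Ioi hs.le)
  calc dB n s ≤ ∫ v in Ioi s, s ^ (-n / 3) * (v ^ (n / 3) * (1 / (v ^ (n - 1) + v ^ 2))) := by
        refine setIntegral_mono_on (integrableOn_inv_den n hs) (hsub.const_mul _)
          measurableSet_Ioi fun v hv => ?_
        have hv0 : 0 < v := hs.trans hv
        have hd := den_pos n hv0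
        rw [← mul_assoc]
        refine le_mul_of_one_le_left (by positivity) ?_
        rw [neg_div, Real.rpow_neg hs.le, ← div_eq_inv_mul, one_le_div (by positivity)]
        exact Real.rpow_le_rpow hs.le (le_of_lt hv) (by linarith)
    _ = s ^ (-n / 3) * ∫ v in Ioi s, v ^ (n / 3) * (1 / (v ^ (n - 1) + v ^ 2)) :=
        integral_const_mul _ _
    _ ≤ s ^ (-n / 3) * ∫ v in Ioi (0 : ℝ), v ^ (n / 3) * (1 / (v ^ (n - 1) + v ^ 2)) := by
        refine mul_le_mul_of_nonneg_left ?_ (by positivity)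
        refine setIntegral_mono_set hall ?_ (Ioi_subset_Ioi hs.le).eventuallyLE
        filter_upwards [ae_restrict_mem measurableSet_Ioi] with v hv
        have hv0 : 0 < v := hv
        have hd := den_pos n hv0
        simp only [Pi.zero_apply]
        positivity
    _ = _ := mul_comm _ _

theorem intervalIntegrable_dB (hn : 0 < n) (hn3 : n < 3) {s t : ℝ} (hs : 0 ≤ s) (hst : s ≤ t) :
    IntervalIntegrable (dB n) volume s t := by
  obtain ⟨C, hC, hb⟩ := exists_dB_le_rpow hn hn3
  have hr : IntervalIntegrable (fun v : ℝ => C * v ^ (-n / 3)) volume s t :=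
    (intervalIntegral.intervalIntegrable_rpow' (by linarith)).const_mul C
  rw [intervalIntegrable_iff_integrableOn_Ioc_of_le hst] at hr ⊢
  refine hr.mono' (((continuousOn_dB n).mono fun v hv => lt_of_le_of_lt hs hv.1).aestronglyMeasurable
    measurableSet_Ioc) ?_
  filter_upwards [ae_restrict_mem measurableSet_Ioc] with v hv
  have hv0 : 0 < v := lt_of_le_of_lt hs hv.1
  rw [Real.norm_of_nonneg (dB_nonneg n hv0.le)]
  exact hb v hv0

theorem B_eq_add (hn : 0 < n) (hn3 : n < 3) {s t : ℝ} (hs : 0 ≤ s) (hst : s ≤ t) :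
    B n t = B n s + ∫ r in s..t, dB n r :=
  (intervalIntegral.integral_add_adjacent_intervals (intervalIntegrable_dB hn hn3 le_rfl hs)
    (intervalIntegrable_dB hn hn3 hs hst)).symm

theorem monotoneOn_B (hn : 0 < n) (hn3 : n < 3) : MonotoneOn (B n) (Ici 0) := by
  intro s hs t _ hst
  rw [B_eq_add hn hn3 hs hst]
  have := intervalIntegral.integral_nonneg (μ := volume) (f := dB n) hst
    fun r hr => dB_nonneg n (le_trans hs hr.1)
  linarith

theorem B_nonneg (n : ℝ) {s : ℝ} (hs : 0 ≤ s) : 0 ≤ B n s :=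
  intervalIntegral.integral_nonneg hs fun _ hr => dB_nonneg n hr.1

theorem continuousOn_B (hn : 0 < n) (hn3 : n < 3) : ContinuousOn (B n) (Ici 0) := by
  intro s hs
  have hs : (0 : ℝ) ≤ s := hs
  have h1 := intervalIntegral.continuousOn_primitive_interval (μ := volume)
    (f := dB n) (a := 0) (b := s + 1) (by
      have := intervalIntegrable_dB hn hn3 le_rfl (show 0 ≤ s + 1 by linarith)
      rw [uIcc_of_le (by linarith), integrableOn_Icc_iff_integrableOn_Ioc]
      exact (intervalIntegrable_iff_integrableOn_Ioc_of_le (by linarith)).1 this)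
  rw [uIcc_of_le (by linarith)] at h1
  refine (h1 s ⟨hs, by linarith⟩).mono_of_mem_nhdsWithin ?_
  rw [← Ici_inter_Iic]
  exact inter_mem self_mem_nhdsWithin (mem_nhdsWithin_of_mem_nhds (Iic_mem_nhds (by linarith)))

theorem exists_B_bounds (hn : 0 < n) (hn3 : n < 3) :
    ∃ K, 0 ≤ K ∧ ∀ s : ℝ, 1 ≤ s → Real.log s - K ≤ B n s ∧ B n s ≤ Real.log s + K := by
  have hB1 := B_nonneg n zero_le_one
  have hc : 0 < 1 / ((3 - n) * (4 - n)) :=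
    one_div_pos.2 (mul_pos (by linarith) (by linarith))
  refine ⟨B n 1 + 1 / ((3 - n) * (4 - n)), by positivity, fun s hs => ?_⟩
  have hs0 : 0 < s := by linarith
  have hdB := intervalIntegrable_dB hn hn3 zero_le_one hs
  have h0 : (0 : ℝ) ∉ uIcc 1 s := by rw [uIcc_of_le hs]; exact fun hm => by linarith [hm.1]
  have hinv : IntervalIntegrable (fun r : ℝ => r⁻¹) volume 1 s :=
    intervalIntegrable_inv_iff.2 (Or.inr h0)
  have hlog : ∫ r in (1 : ℝ)..s, r⁻¹ = Real.log s := by rw [integral_inv h0, div_one]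
  rw [B_eq_add hn hn3 zero_le_one hs]
  constructor
  · have hrp : IntervalIntegrable (fun r : ℝ => r ^ (n - 4)) volume 1 s :=
      intervalIntegral.intervalIntegrable_rpow (Or.inr h0)
    have key : ∀ r : ℝ, 1 ≤ r → r⁻¹ - 1 / (4 - n) * r ^ (n - 4) ≤ dB n r := by
      intro r hr
      have hr0 : 0 < r := by linarith
      have e1 : ∫ v in Ioi r, (v ^ (-2 : ℝ) - v ^ (n - 5)) = r⁻¹ - 1 / (4 - n) * r ^ (n - 4) := by
        rw [integral_sub (integrableOn_Ioi_rpow_of_lt (by norm_num) hr0)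
          (integrableOn_Ioi_rpow_of_lt (by linarith) hr0),
          integral_Ioi_rpow_of_lt (by norm_num) hr0, integral_Ioi_rpow_of_lt (by linarith) hr0]
        rw [show n - 5 + 1 = n - 4 by ring, show (-2 : ℝ) + 1 = -1 by norm_num, Real.rpow_neg_one]
        have : n - 4 ≠ 0 := by linarith
        have : 4 - n ≠ 0 := by linarith
        rw [show n - 4 = -(4 - n) by ring]
        field_simp
      rw [← e1]
      refine setIntegral_mono_on ((integrableOn_Ioi_rpow_of_lt (by norm_num) hr0).sub
        (integrableOn_Ioi_rpow_of_lt (by linarith) hr0)) (integrableOn_inv_den n hr0)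
        measurableSet_Ioi fun v hv => ?_
      have hv0 : 0 < v := hr0.trans hv
      rw [le_div_iff₀ (den_pos n hv0)]
      have p1 : v ^ (-2 : ℝ) * v ^ (n - 1) = v ^ (n - 3) := by
        rw [← Real.rpow_add hv0]; ring_nf
      have p2 : v ^ (-2 : ℝ) * v ^ 2 = 1 := by
        rw [← Real.rpow_two, ← Real.rpow_add hv0]; norm_num
      have p3 : v ^ (n - 5) * v ^ 2 = v ^ (n - 3) := by
        rw [← Real.rpow_two, ← Real.rpow_add hv0]; ring_nf
      have p4 : 0 ≤ v ^ (n - 5) * v ^ (n - 1) := by positivity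
      nlinarith
    have h1 : ∫ r in (1 : ℝ)..s, (r⁻¹ - 1 / (4 - n) * r ^ (n - 4)) ≤ ∫ r in (1 : ℝ)..s, dB n r :=
      intervalIntegral.integral_mono_on hs (hinv.sub (hrp.const_mul _)) hdB fun r hr => key r hr.1
    rw [intervalIntegral.integral_sub hinv (hrp.const_mul _), intervalIntegral.integral_const_mul,
      hlog, integral_rpow (Or.inr ⟨by linarith, h0⟩), show n - 4 + 1 = -(3 - n) by ring,
      Real.one_rpow] at h1
    have h2 : 1 / (4 - n) * ((s ^ (-(3 - n)) - 1) / -(3 - n)) ≤ 1 / ((3 - n) * (4 - n)) := by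
      have : 0 < 3 - n := by linarith
      have : 0 < 4 - n := by linarith
      have hp : 0 ≤ s ^ (-(3 - n)) := by positivity
      have : 1 / (4 - n) * ((s ^ (-(3 - n)) - 1) / -(3 - n)) =
          1 / ((3 - n) * (4 - n)) * (1 - s ^ (-(3 - n))) := by
        field_simp
        ring
      rw [this]
      exact mul_le_of_le_one_right hc.le (by linarith)
    linarith
  · have h1 : ∫ r in (1 : ℝ)..s, dB n r ≤ ∫ r in (1 : ℝ)..s, r⁻¹ :=
      intervalIntegral.integral_mono_on hs hdB hinv fun r hr => dB_le_inv n (by linarith [hr.1])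
    linarith

theorem exists_flux_bound (hn : 0 < n) (hn3 : n < 3) :
    ∃ K, 0 ≤ K ∧ ∀ s : ℝ, 0 < s → s * (s ^ (n - 1) + s ^ 2) * dB n s ^ 2 ≤ K * (1 + s) := by
  obtain ⟨C, hC, hb⟩ := exists_dB_le_rpow hn hn3
  refine ⟨2 + 2 * C ^ 2, by positivity, fun s hs => ?_⟩
  have hd0 := dB_nonneg n hs.le
  have hp := den_pos n hs
  rcases le_total s 1 with h1 | h1
  · have e1 : s ^ (n - 1) + s ^ 2 ≤ 2 * s ^ (n - 1) := by
      have : s ^ (2 : ℝ) ≤ s ^ (n - 1) := Real.rpow_le_rpow_of_exponent_ge hs h1 (by linarith)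
      rw [Real.rpow_two] at this
      linarith
    calc s * (s ^ (n - 1) + s ^ 2) * dB n s ^ 2
        ≤ s * (2 * s ^ (n - 1)) * (C * s ^ (-n / 3)) ^ 2 := by
          gcongr; exact hb s hs
      _ = 2 * C ^ 2 * s ^ (n / 3) := by
          have : s * s ^ (n - 1) * (s ^ (-n / 3)) ^ 2 = s ^ (n / 3) := by
            nth_rewrite 1 [← Real.rpow_one s]
            rw [← Real.rpow_natCast, ← Real.rpow_mul hs.le, ← Real.rpow_add hs, ← Real.rpow_add hs]
            congr 1
            push_cast
            ring
          rw [← this]; ring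
      _ ≤ 2 * C ^ 2 * 1 := by
          gcongr
          exact Real.rpow_le_one hs.le h1 (by linarith)
      _ ≤ _ := by nlinarith [sq_nonneg C]
  · have e1 : s ^ (n - 1) + s ^ 2 ≤ 2 * s ^ 2 := by
      have : s ^ (n - 1) ≤ s ^ (2 : ℝ) := Real.rpow_le_rpow_of_exponent_le h1 (by linarith)
      rw [Real.rpow_two] at this
      linarith
    calc s * (s ^ (n - 1) + s ^ 2) * dB n s ^ 2 ≤ s * (2 * s ^ 2) * (s⁻¹) ^ 2 := by
          gcongr; exact dB_le_inv n hs
      _ = 2 * s := by field_simp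
      _ ≤ _ := by nlinarith [sq_nonneg C]

end Entropy

/-! ### Bounds for the rescaled entropy function and the flux -/

theorem abs_log_pos {ε : ℝ} (h0 : 0 < ε) (h1 : ε < 1) : 0 < |Real.log ε| :=
  abs_pos.2 (Real.log_neg h0 h1).ne

theorem abs_log_eq {ε : ℝ} (h0 : 0 < ε) (h1 : ε < 1) : |Real.log ε| = -Real.log ε :=
  abs_of_neg (Real.log_neg h0 h1)

theorem Beps_nonneg (n : ℝ) {ε s : ℝ} (h0 : 0 < ε) (hs : 0 ≤ s) : 0 ≤ Beps n ε s :=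
  div_nonneg (B_nonneg n (div_nonneg hs h0.le)) (abs_nonneg _)

theorem continuousOn_Beps {n ε : ℝ} (hn : 0 < n) (hn3 : n < 3) (h0 : 0 < ε) :
    ContinuousOn (Beps n ε) (Ici 0) := by
  refine ((continuousOn_B hn hn3).comp (continuousOn_id.div_const ε) fun s hs => ?_).div_const _
  exact div_nonneg (show (0 : ℝ) ≤ s from hs) h0.le

/-- The constant `K` controls the deviation of `B^ε` from `1` on the scale `1 / |ln ε|`. -/
structure IsEntropyConst (n K : ℝ) : Prop where
  nonneg : 0 ≤ K
  bounds : ∀ s : ℝ, 1 ≤ s → Real.log s - K ≤ B n s ∧ B n s ≤ Real.log s + K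
  flux : ∀ s : ℝ, 0 < s → s * (s ^ (n - 1) + s ^ 2) * dB n s ^ 2 ≤ K * (1 + s)

theorem exists_isEntropyConst {n : ℝ} (hn : 0 < n) (hn3 : n < 3) : ∃ K, IsEntropyConst n K := by
  obtain ⟨K₁, h1, hb⟩ := exists_B_bounds hn hn3
  obtain ⟨K₂, h2, hf⟩ := exists_flux_bound hn hn3
  refine ⟨K₁ + K₂, by positivity, fun s hs => ?_, fun s hs => (hf s hs).trans ?_⟩
  · obtain ⟨h3, h4⟩ := hb s hs
    constructor <;> linarith
  · gcongr; linarith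

theorem Beps_le {n ε K : ℝ} (hn : 0 < n) (hn3 : n < 3) (hK : IsEntropyConst n K) (h0 : 0 < ε)
    (h1 : ε < 1) {s U : ℝ} (hs : 0 ≤ s) (hU : 1 ≤ U) (hsU : s ≤ U) :
    Beps n ε s ≤ 1 + (Real.log U + K) / |Real.log ε| := by
  have hl := abs_log_pos h0 h1
  rw [Beps, div_le_iff₀ hl, add_mul, div_mul_cancel₀ _ hl.ne', one_mul]
  have hUε : 1 ≤ U / ε := (one_le_div h0).2 (by linarith)
  have m : B n (s / ε) ≤ B n (U / ε) :=
    monotoneOn_B hn hn3 (div_nonneg hs h0.le) (div_nonneg (by linarith) h0.le) (by gcongr)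
  have := (hK.bounds _ hUε).2
  rw [Real.log_div (by linarith) h0.ne'] at this
  rw [abs_log_eq h0 h1]
  linarith

theorem le_Beps {n ε K : ℝ} (hn : 0 < n) (hn3 : n < 3) (hK : IsEntropyConst n K) (h0 : 0 < ε)
    (h1 : ε < 1) {s δ : ℝ} (hδ : ε ≤ δ) (hs : δ ≤ s) :
    1 - (K - Real.log δ) / |Real.log ε| ≤ Beps n ε s := by
  have hl := abs_log_pos h0 h1
  have hδ0 : 0 < δ := h0.trans_le hδ
  rw [Beps, le_div_iff₀ hl, sub_mul, div_mul_cancel₀ _ hl.ne', one_mul]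
  have m : B n (δ / ε) ≤ B n (s / ε) :=
    monotoneOn_B hn hn3 (div_nonneg hδ0.le h0.le) (div_nonneg (by linarith) h0.le) (by gcongr)
  have := (hK.bounds _ ((one_le_div h0).2 hδ)).1
  rw [Real.log_div hδ0.ne' h0.ne'] at this
  rw [abs_log_eq h0 h1]
  linarith

theorem Beps_le_of_le {n ε K : ℝ} (hn : 0 < n) (hn3 : n < 3) (hK : IsEntropyConst n K) (h0 : 0 < ε)
    {s : ℝ} (hs : 0 ≤ s) (hsε : s ≤ ε) : Beps n ε s ≤ K / |Real.log ε| := by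
  have m : B n (s / ε) ≤ B n 1 :=
    monotoneOn_B hn hn3 (div_nonneg hs h0.le) (zero_le_one' ℝ) ((div_le_one h0).2 hsε)
  have := (hK.bounds 1 le_rfl).2
  rw [Real.log_one] at this
  rw [Beps]
  gcongr
  linarith

theorem cube_le_mobility (n : ℝ) {ε s : ℝ} (h0 : 0 < ε) (hs : 0 ≤ s) : s ^ 3 ≤ mobility n ε s := by
  have : 0 ≤ ε ^ (3 - n) * s ^ n := by positivity
  rw [mobility]; linarith

theorem fluxR_sq_le {n ε K : ℝ} (hK : IsEntropyConst n K) (h0 : 0 < ε) (h1 : ε < 1)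
    {u w : ℝ → ℝ → ℝ} {t x U : ℝ} (hu : 0 < u t x) (hU : u t x ≤ U) :
    fluxR n ε u w t x ^ 2 ≤ K * (1 + U) * (mobility n ε (u t x) * w t x ^ 2) := by
  have hl := abs_log_pos h0 h1
  set s := u t x with hs
  set v := s / ε with hv
  have hv0 : 0 < v := div_pos hu h0
  have hsv : s = ε * v := by rw [hv]; field_simp
  have e1 : ε ^ (3 - n) * s ^ (n - 1) = ε ^ 2 * v ^ (n - 1) := by
    rw [hsv, Real.mul_rpow h0.le hv0.le, ← mul_assoc, ← Real.rpow_add h0, ← Real.rpow_two]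
    ring_nf
  have e2 : mobility n ε s = ε ^ 3 * (v * (v ^ (n - 1) + v ^ 2)) := by
    have : ε ^ (3 - n) * s ^ n = ε ^ 3 * (v * v ^ (n - 1)) := by
      have hvn : v * v ^ (n - 1) = v ^ n := by
        nth_rewrite 1 [← Real.rpow_one v]
        rw [← Real.rpow_add hv0]; ring_nf
      rw [hvn, hsv, Real.mul_rpow h0.le hv0.le, ← mul_assoc, ← Real.rpow_add h0,
        ← Real.rpow_natCast ε 3]
      norm_num
    rw [mobility, this, hsv]; ring
  have e3 : fluxR n ε u w t x = -(ε * dB n v * (v ^ (n - 1) + v ^ 2) * (s * w t x)) := by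
    rw [fluxR, dBeps, ← hs, e1, ← hv, show s ^ 2 = ε ^ 2 * v ^ 2 by rw [hsv]; ring]
    field_simp
  have e4 : fluxR n ε u w t x ^ 2 = (v * (v ^ (n - 1) + v ^ 2) * dB n v ^ 2) * ε *
      (mobility n ε s * w t x ^ 2) := by
    rw [e3, e2, show s * w t x = ε * v * w t x by rw [← hsv]]; ring
  rw [e4]
  have hm : 0 ≤ mobility n ε s * w t x ^ 2 := by
    have : 0 ≤ mobility n ε s := le_trans (by positivity) (cube_le_mobility n h0 hu.le)
    positivity
  refine mul_le_mul_of_nonneg_right ?_ hm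
  calc _ ≤ K * (1 + v) * ε := mul_le_mul_of_nonneg_right (hK.flux v hv0) h0.le
    _ = K * (ε + s) := by rw [hsv]; ring
    _ ≤ K * (1 + U) := by
      have := hK.nonneg
      gcongr

end

section

/-! ### Integrability properties of solutions -/

theorem integrable_of_lintegral_ofReal_le {α : Type*} [MeasurableSpace α] {μ : Measure α}
    {F : α → ℝ} {c : ℝ} (hF : AEStronglyMeasurable F μ) (h0 : 0 ≤ᵐ[μ] F) (hc : 0 ≤ c)
    (h : ∫⁻ x, ENNReal.ofReal (F x) ∂μ ≤ ENNReal.ofReal c) : Integrable F μ ∧ ∫ x, F x ∂μ ≤ c := by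
  have hi : Integrable F μ :=
    (lintegral_ofReal_ne_top_iff_integrable hF h0).1 (h.trans_lt ENNReal.ofReal_lt_top).ne
  refine ⟨hi, ?_⟩
  rw [← ofReal_integral_eq_lintegral_ofReal hi h0] at h
  exact (ENNReal.ofReal_le_ofReal_iff hc).1 h

/-- Twice the initial energy. -/
def energy₀ (a b : ℝ) (duin : ℝ → ℝ) : ℝ := ∫ x in Ioo a b, duin x ^ 2

theorem energy₀_nonneg (a b : ℝ) (duin : ℝ → ℝ) : 0 ≤ energy₀ a b duin :=
  integral_nonneg fun _ => sq_nonneg _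

/-- An upper bound for all solutions with initial datum `uin`. -/
def supBound (a b : ℝ) (duin : ℝ → ℝ) : ℝ :=
  1 + (1 / (b - a) + 1 / 2 * (energy₀ a b duin + (b - a)))

theorem measurableSet_cylinder (a b : ℝ) : MeasurableSet (cylinder a b) :=
  measurableSet_Ioi.prod measurableSet_Ioo

variable {n a b ε : ℝ} {uin duin : ℝ → ℝ} {u ux uxx uxxx : ℝ → ℝ → ℝ}

theorem IsInitialDatum.lintegral_energy (huin : IsInitialDatum a b uin duin) :
    ∫⁻ x in Ioo a b, ENNReal.ofReal (1 / 2 * duin x ^ 2) =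
      ENNReal.ofReal (1 / 2 * energy₀ a b duin) := by
  rw [energy₀, ← integral_const_mul, ofReal_integral_eq_lintegral_ofReal]
  · exact huin.deriv_memLp.integrable_sq.const_mul _
  · exact ae_of_all _ fun x => by positivity

namespace IsSolution

theorem continuousOn_slice (hu : IsSolution n a b ε uin duin u ux uxx uxxx) {t : ℝ} (ht : 0 ≤ t) :
    ContinuousOn (u t) (Icc a b) :=
  hu.continuousOn.comp (Continuous.prodMk_right t).continuousOn fun _ hx => ⟨ht, hx⟩

theorem continuousOn_cylinder (hu : IsSolution n a b ε uin duin u ux uxx uxxx) :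
    ContinuousOn (Function.uncurry u) (cylinder a b) :=
  hu.continuousOn.mono (prod_mono Ioi_subset_Ici_self Ioo_subset_Icc_self)

theorem measurableSet_posSet (hu : IsSolution n a b ε uin duin u ux uxx uxxx) :
    MeasurableSet (posSet a b u) :=
  (hu.continuousOn_cylinder.isOpen_inter_preimage (isOpen_Ioi.prod isOpen_Ioo)
    isOpen_Ioi).measurableSet

theorem ux_sq (hu : IsSolution n a b ε uin duin u ux uxx uxxx) (hab : a < b)
    (huin : IsInitialDatum a b uin duin) {t : ℝ} (ht : 0 < t) :
    IntegrableOn (fun x => ux t x ^ 2) (Ioo a b) ∧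
      ∫ x in Ioo a b, ux t x ^ 2 ≤ energy₀ a b duin := by
  have hm : AEStronglyMeasurable (ux t) (volume.restrict (Ioo a b)) :=
    (((intervalIntegrable_iff_integrableOn_Ioc_of_le hab.le).1
      (hu.deriv_one t ht a b hab.le Subset.rfl).1).mono_set Ioo_subset_Ioc_self).aestronglyMeasurable
  have h := (le_add_of_nonneg_right zero_le).trans (hu.energy t ht)
  rw [huin.lintegral_energy] at h
  obtain ⟨h1, h2⟩ := integrable_of_lintegral_ofReal_le ((hm.pow 2).const_mul (1 / 2))
    (ae_of_all _ fun x => by simp only [Pi.zero_apply, Pi.pow_apply]; positivity)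
    (mul_nonneg (by norm_num) (energy₀_nonneg a b duin)) h
  have h3 := h1.const_mul 2
  simp only [Pi.pow_apply] at h2 h3
  rw [integral_const_mul] at h2
  refine ⟨?_, by linarith⟩
  refine h3.congr (ae_of_all _ fun x => ?_)
  simp

theorem abs_sub_le (hu : IsSolution n a b ε uin duin u ux uxx uxxx) (hab : a < b)
    (huin : IsInitialDatum a b uin duin) {t : ℝ} (ht : 0 < t) {x y μ : ℝ} (hx : a ≤ x)
    (hxy : x ≤ y) (hy : y ≤ b) (hμ : 0 < μ) :
    |u t y - u t x| ≤ 1 / 2 * (μ * energy₀ a b duin + (y - x) / μ) := by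
  have hs : Icc x y ⊆ Icc a b := Icc_subset_Icc hx hy
  obtain ⟨h1, h2⟩ := hu.deriv_one t ht x y hxy hs
  obtain ⟨h3, h4⟩ := hu.ux_sq hab huin ht
  have h3' : IntegrableOn (fun z => ux t z ^ 2) (Ioc a b) := by
    rwa [integrableOn_Ioc_iff_integrableOn_Ioo]
  have i2 : IntervalIntegrable (fun z => ux t z ^ 2) volume x y :=
    (intervalIntegrable_iff_integrableOn_Ioc_of_le hxy).2 (h3'.mono_set (Ioc_subset_Ioc hx hy))
  have hle : ∫ z in x..y, ux t z ^ 2 ≤ energy₀ a b duin := by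
    refine le_trans ?_ h4
    rw [intervalIntegral.integral_of_le hxy, ← integral_Ioc_eq_integral_Ioo]
    exact setIntegral_mono_set h3' (ae_of_all _ fun z => sq_nonneg _)
      (Ioc_subset_Ioc hx hy).eventuallyLE
  rw [← h2]
  refine (intervalIntegral.abs_integral_le_integral_abs hxy).trans ?_
  have hc : IntervalIntegrable (fun _ : ℝ => 1 / μ) volume x y := intervalIntegrable_const
  calc ∫ z in x..y, |ux t z| ≤ ∫ z in x..y, 1 / 2 * (μ * ux t z ^ 2 + 1 / μ) := by
        refine intervalIntegral.integral_mono_on hxy h1.abs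
          (((i2.const_mul μ).add hc).const_mul _) fun z _ => ?_
        have s1 : 0 ≤ (μ * |ux t z| - 1) ^ 2 / (2 * μ) := by positivity
        have s2 : (μ * |ux t z| - 1) ^ 2 / (2 * μ) =
            1 / 2 * (μ * |ux t z| ^ 2 + 1 / μ) - |ux t z| := by
          field_simp
          ring
        rw [s2, sq_abs] at s1
        linarith
    _ = 1 / 2 * (μ * (∫ z in x..y, ux t z ^ 2) + (y - x) / μ) := by
        rw [intervalIntegral.integral_const_mul, intervalIntegral.integral_add (i2.const_mul μ) hc,
          intervalIntegral.integral_const_mul, intervalIntegral.integral_const, smul_eq_mul]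
        ring
    _ ≤ _ := by gcongr

theorem le_supBound (hu : IsSolution n a b ε uin duin u ux uxx uxxx) (hab : a < b)
    (huin : IsInitialDatum a b uin duin) {t : ℝ} (ht : 0 ≤ t) {x : ℝ} (hx : x ∈ Icc a b) :
    u t x ≤ supBound a b duin := by
  have hpos : ∀ t, 0 < t → ∀ x ∈ Icc a b, u t x ≤ supBound a b duin := by
    intro t ht x hx
    have hE := energy₀_nonneg a b duin
    have hba : 0 < b - a := sub_pos.2 hab
    have hcmp : ∀ y ∈ Icc a b, u t x - 1 / 2 * (energy₀ a b duin + (b - a)) ≤ u t y := by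
      intro y hy
      rcases le_total x y with h | h
      · have := hu.abs_sub_le hab huin ht hx.1 h hy.2 one_pos
        rw [abs_le] at this
        have h1 := hx.1; have h2 := hy.2
        simp only [one_mul, div_one] at this
        linarith [this.1]
      · have := hu.abs_sub_le hab huin ht hy.1 h hx.2 one_pos
        rw [abs_le] at this
        have h1 := hx.2; have h2 := hy.1
        simp only [one_mul, div_one] at this
        linarith [this.2]
    have hm := hu.mass t ht
    rw [huin.mass] at hm
    have hint : IntegrableOn (u t) (Ioo a b) :=
      (hu.continuousOn_slice ht.le).integrableOn_Icc.mono_set Ioo_subset_Icc_self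
    have := setIntegral_mono_on (μ := volume) (integrableOn_const (C := u t x - 1 / 2 *
      (energy₀ a b duin + (b - a))) (by simp) (by simp)) hint
      measurableSet_Ioo fun y hy => hcmp y (Ioo_subset_Icc_self hy)
    rw [hm, setIntegral_const, smul_eq_mul, Real.volume_real_Ioo_of_le hab.le] at this
    have h3 : u t x - 1 / 2 * (energy₀ a b duin + (b - a)) ≤ 1 / (b - a) := by
      rw [le_div_iff₀ hba]; linarith
    rw [supBound]
    linarith
  rcases eq_or_lt_of_le ht with h0 | h0
  · subst h0
    have hcont : ContinuousWithinAt (fun t => u t x) (Ici 0) 0 :=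
      hu.continuousOn.comp (s := Ici 0) (f := fun t => (t, x)) (Continuous.prodMk_left x).continuousOn
        (fun t ht => ⟨ht, hx⟩) 0 self_mem_Ici
    have := hcont.mono_left (nhdsWithin_mono 0 Ioi_subset_Ici_self)
    exact le_of_tendsto this (by filter_upwards [self_mem_nhdsWithin] with t ht using hpos t ht x hx)
  · exact hpos t h0 x hx

end IsSolution

theorem one_le_supBound (hab : a < b) (duin : ℝ → ℝ) : 1 ≤ supBound a b duin := by
  have hE := energy₀_nonneg a b duin
  have hba : 0 < b - a := sub_pos.2 hab
  have : 0 ≤ 1 / (b - a) + 1 / 2 * (energy₀ a b duin + (b - a)) := by positivity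
  rw [supBound]; linarith

namespace IsSolution

theorem rho_nonneg (hu : IsSolution n a b ε uin duin u ux uxx uxxx) (h0 : 0 < ε) {t x : ℝ}
    (ht : 0 ≤ t) (hx : x ∈ Icc a b) : 0 ≤ rhoOf n ε u t x :=
  Beps_nonneg n h0 (hu.nonneg t ht x hx)

theorem rho_le (hu : IsSolution n a b ε uin duin u ux uxx uxxx) (hab : a < b)
    (huin : IsInitialDatum a b uin duin) (hn : 0 < n) (hn3 : n < 3) {K : ℝ}
    (hK : IsEntropyConst n K) (h0 : 0 < ε) (h1 : ε < 1) {t x : ℝ} (ht : 0 ≤ t)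
    (hx : x ∈ Icc a b) :
    rhoOf n ε u t x ≤ 1 + (Real.log (supBound a b duin) + K) / |Real.log ε| :=
  Beps_le hn hn3 hK h0 h1 (hu.nonneg t ht x hx) (one_le_supBound hab duin)
    (hu.le_supBound hab huin ht hx)

theorem continuousOn_rho (hu : IsSolution n a b ε uin duin u ux uxx uxxx) (hn : 0 < n)
    (hn3 : n < 3) (h0 : 0 < ε) :
    ContinuousOn (Function.uncurry (rhoOf n ε u)) (Ici 0 ×ˢ Icc a b) :=
  (continuousOn_Beps hn hn3 h0).comp hu.continuousOn fun z hz => hu.nonneg z.1 hz.1 z.2 hz.2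

theorem continuousOn_rho_slice (hu : IsSolution n a b ε uin duin u ux uxx uxxx) (hn : 0 < n)
    (hn3 : n < 3) (h0 : 0 < ε) {t : ℝ} (ht : 0 ≤ t) : ContinuousOn (rhoOf n ε u t) (Icc a b) :=
  (hu.continuousOn_rho hn hn3 h0).comp (s := Icc a b) (f := fun x => (t, x))
    (Continuous.prodMk_right t).continuousOn fun _ hx => ⟨ht, hx⟩

theorem integrableOn_rho_mul (hu : IsSolution n a b ε uin duin u ux uxx uxxx) (hn : 0 < n)
    (hn3 : n < 3) (h0 : 0 < ε) {t : ℝ} (ht : 0 ≤ t) {χ : ℝ → ℝ} (hχ : Continuous χ) :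
    IntegrableOn (fun x => rhoOf n ε u t x * χ x) (Ioo a b) :=
  ((hu.continuousOn_rho_slice hn hn3 h0 ht).mul hχ.continuousOn).integrableOn_Icc.mono_set
    Ioo_subset_Icc_self

theorem integrableOn_rho (hu : IsSolution n a b ε uin duin u ux uxx uxxx) (hn : 0 < n)
    (hn3 : n < 3) (h0 : 0 < ε) {t : ℝ} (ht : 0 ≤ t) :
    IntegrableOn (rhoOf n ε u t) (Ioo a b) :=
  (hu.continuousOn_rho_slice hn hn3 h0 ht).integrableOn_Icc.mono_set Ioo_subset_Icc_self

theorem continuousOn_integral_rho (hu : IsSolution n a b ε uin duin u ux uxx uxxx)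
    (hn : 0 < n) (hn3 : n < 3) (h0 : 0 < ε) {χ : ℝ → ℝ}
    (hχ : Continuous χ) :
    ContinuousOn (fun t => ∫ x in Ioo a b, rhoOf n ε u t x * χ x) (Ici 0) := by
  intro t ht
  have hc : ContinuousOn (fun z : ℝ × ℝ => rhoOf n ε u z.1 z.2 * χ z.2) (Ici 0 ×ˢ Icc a b) :=
    (hu.continuousOn_rho hn hn3 h0).mul (hχ.comp continuous_snd).continuousOn
  obtain ⟨C, hC⟩ := (isCompact_Icc.prod isCompact_Icc).exists_bound_of_continuousOn
    (hc.mono (prod_mono (Icc_subset_Ici_self : Icc (0 : ℝ) (t + 1) ⊆ Ici 0) Subset.rfl))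
  refine continuousWithinAt_of_dominated (bound := fun _ => C) ?_ ?_ ?_ ?_
  · filter_upwards [self_mem_nhdsWithin] with s hs
    exact (hu.integrableOn_rho_mul hn hn3 h0 hs hχ).aestronglyMeasurable
  · filter_upwards [self_mem_nhdsWithin, mem_nhdsWithin_of_mem_nhds
      (Iic_mem_nhds (show t < t + 1 by linarith))] with s hs hs1
    filter_upwards [ae_restrict_mem measurableSet_Ioo] with x hx
    exact hC (s, x) ⟨⟨hs, hs1⟩, Ioo_subset_Icc_self hx⟩
  · exact integrableOn_const (by simp) (by simp)
  · filter_upwards [ae_restrict_mem measurableSet_Ioo] with x hx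
    exact hc.comp (s := Ici 0) (f := fun t => (t, x)) (Continuous.prodMk_left x).continuousOn
      (fun t ht => ⟨ht, Ioo_subset_Icc_self hx⟩) t ht

end IsSolution

end

section

variable {n a b ε : ℝ} {uin duin : ℝ → ℝ} {u ux uxx uxxx : ℝ → ℝ → ℝ}

theorem restrict_prod_Ioc (a b T : ℝ) :
    (volume : Measure (ℝ × ℝ)).restrict (Ioc 0 T ×ˢ Ioo a b) =
      (volume.restrict (Ioc 0 T)).prod (volume.restrict (Ioo a b)) := by
  rw [Measure.volume_eq_prod, Measure.prod_restrict]

theorem Ioc_prod_subset_cylinder (a b T : ℝ) : Ioc 0 T ×ˢ Ioo a b ⊆ cylinder a b :=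
  prod_mono Ioc_subset_Ioi_self Subset.rfl

theorem posSet_subset_cylinder (a b : ℝ) (u : ℝ → ℝ → ℝ) : posSet a b u ⊆ cylinder a b :=
  fun _ hz => hz.1

theorem indicator_posSet_slice (F : ℝ → ℝ → ℝ) {t : ℝ} (ht : 0 < t) (x : ℝ) :
    (posSet a b u).indicator (fun z => F z.1 z.2) (t, x) =
      {x ∈ Ioo a b | 0 < u t x}.indicator (F t) x := by
  by_cases hx : x ∈ Ioo a b ∧ 0 < u t x
  · rw [indicator_of_mem (show (t, x) ∈ posSet a b u from ⟨⟨ht, hx.1⟩, hx.2⟩),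
      indicator_of_mem (show x ∈ {x ∈ Ioo a b | 0 < u t x} from hx)]
  · rw [indicator_of_notMem (fun hm => hx ⟨hm.1.2, hm.2⟩),
      indicator_of_notMem (show x ∉ {x ∈ Ioo a b | 0 < u t x} from hx)]

theorem ae_Ioi_of_forall_Ioc {p : ℝ → Prop}
    (h : ∀ N : ℕ, ∀ᵐ t ∂(volume.restrict (Ioc (0 : ℝ) N)), p t) :
    ∀ᵐ t ∂(volume.restrict (Ioi (0 : ℝ))), p t := by
  rw [ae_restrict_iff' measurableSet_Ioi]
  have := ae_all_iff.2 fun N => (ae_restrict_iff' measurableSet_Ioc).1 (h N)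
  filter_upwards [this] with t ht htpos
  obtain ⟨N, hN⟩ := exists_nat_ge t
  exact ht N ⟨htpos, hN⟩

/-- A solution together with the admissible parameters and the constant of the entropy function. -/
structure Setting (n a b ε K : ℝ) (uin duin : ℝ → ℝ) (u ux uxx uxxx : ℝ → ℝ → ℝ) : Prop where
  lt : a < b
  datum : IsInitialDatum a b uin duin
  n_pos : 0 < n
  n_lt : n < 3
  const : IsEntropyConst n K
  eps_pos : 0 < ε
  eps_lt : ε < 1
  sol : IsSolution n a b ε uin duin u ux uxx uxxx

/-- An upper bound for `ρ^ε`. -/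
def rhoBound (a b ε K : ℝ) (duin : ℝ → ℝ) : ℝ :=
  1 + (Real.log (supBound a b duin) + K) / |Real.log ε|

variable {K : ℝ}

namespace Setting

theorem rhoBound_nonneg (hS : Setting n a b ε K uin duin u ux uxx uxxx) :
    0 ≤ rhoBound a b ε K duin := by
  have := Real.log_nonneg (one_le_supBound hS.lt duin)
  have := hS.const.nonneg
  rw [rhoBound]; positivity

theorem integral_rho_le (hS : Setting n a b ε K uin duin u ux uxx uxxx) {t : ℝ} (ht : 0 ≤ t) :
    ∫ x in Ioo a b, rhoOf n ε u t x ≤ (b - a) * rhoBound a b ε K duin := by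
  have := setIntegral_mono_on (hS.sol.integrableOn_rho hS.n_pos hS.n_lt hS.eps_pos ht)
    (integrableOn_const (C := rhoBound a b ε K duin) (by simp) (by simp)) measurableSet_Ioo
    fun x hx => hS.sol.rho_le hS.lt hS.datum hS.n_pos hS.n_lt hS.const hS.eps_pos hS.eps_lt ht
      (Ioo_subset_Icc_self hx)
  rwa [setIntegral_const, smul_eq_mul, Real.volume_real_Ioo_of_le hS.lt.le] at this

theorem aestronglyMeasurable_posSet (hS : Setting n a b ε K uin duin u ux uxx uxxx) {G : ℝ → ℝ}
    (hG : ContinuousOn G (Ioi 0)) :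
    AEStronglyMeasurable (fun z : ℝ × ℝ => G (u z.1 z.2)) (volume.restrict (posSet a b u)) :=
  ContinuousOn.aestronglyMeasurable
    (hG.comp (hS.sol.continuousOn_cylinder.mono (posSet_subset_cylinder a b u)) fun _ hz => hz.2)
    hS.sol.measurableSet_posSet

theorem aestronglyMeasurable_indicator (hS : Setting n a b ε K uin duin u ux uxx uxxx)
    {F : ℝ × ℝ → ℝ} (hF : AEStronglyMeasurable F (volume.restrict (posSet a b u)))
    (S : Set (ℝ × ℝ)) :
    AEStronglyMeasurable ((posSet a b u).indicator F) (volume.restrict S) :=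
  ((aestronglyMeasurable_indicator_iff hS.sol.measurableSet_posSet).2 hF).restrict

theorem integrableOn_posSet (hS : Setting n a b ε K uin duin u ux uxx uxxx) {F : ℝ × ℝ → ℝ}
    (hF : AEStronglyMeasurable F (volume.restrict (posSet a b u)))
    (h0 : ∀ z ∈ posSet a b u, 0 ≤ F z) {c T T' : ℝ} (hc : 0 ≤ c) (hT : T < T')
    (h : ∫⁻ z in {z ∈ posSet a b u | z.1 < T'}, ENNReal.ofReal (F z) ≤ ENNReal.ofReal c) :
    IntegrableOn ((posSet a b u).indicator F) (Ioc 0 T ×ˢ Ioo a b) ∧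
      ∫ z in Ioc 0 T ×ˢ Ioo a b, (posSet a b u).indicator F z ≤ c := by
  refine integrable_of_lintegral_ofReal_le (hS.aestronglyMeasurable_indicator hF _)
    (ae_of_all _ fun z => indicator_nonneg h0 z) hc ?_
  have e : ∀ z, ENNReal.ofReal ((posSet a b u).indicator F z) =
      (posSet a b u).indicator (fun z => ENNReal.ofReal (F z)) z := fun z => by
    by_cases hz : z ∈ posSet a b u
    · simp [hz]
    · simp [hz]
  simp_rw [e]
  rw [setLIntegral_indicator hS.sol.measurableSet_posSet]
  exact (lintegral_mono_set (show posSet a b u ∩ Ioc 0 T ×ˢ Ioo a b ⊆ {z ∈ posSet a b u | z.1 < T'}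
    from fun z hz => ⟨hz.1, hz.2.1.2.trans_lt hT⟩)).trans h

theorem integrableOn_dissip (hS : Setting n a b ε K uin duin u ux uxx uxxx) (T : ℝ) :
    IntegrableOn ((posSet a b u).indicator fun z => u z.1 z.2 * uxx z.1 z.2 ^ 2)
        (Ioc 0 T ×ˢ Ioo a b) ∧
      ∫ z in Ioc 0 T ×ˢ Ioo a b, (posSet a b u).indicator
        (fun z => u z.1 z.2 * uxx z.1 z.2 ^ 2) z ≤ (b - a) * rhoBound a b ε K duin := by
  have hT' : T < max T 0 + 1 := by linarith [le_max_left T 0]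
  have hT0 : 0 < max T 0 + 1 := by linarith [le_max_right T 0]
  have hba : 0 < b - a := sub_pos.2 hS.lt
  refine hS.integrableOn_posSet ?_ (fun z hz => mul_nonneg hz.2.le (sq_nonneg _))
    (mul_nonneg hba.le hS.rhoBound_nonneg) hT' ?_
  · exact (hS.aestronglyMeasurable_posSet (G := fun s => s) continuousOn_id).mul (hS.sol.uxx_meas.pow 2)
  · exact ((le_add_of_nonneg_right zero_le).trans (hS.sol.entropy _ hT0)).trans
      (ENNReal.ofReal_le_ofReal (hS.integral_rho_le hT0.le))

theorem integrableOn_mobility (hS : Setting n a b ε K uin duin u ux uxx uxxx) (T : ℝ) :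
    IntegrableOn ((posSet a b u).indicator fun z => mobility n ε (u z.1 z.2) * uxxx z.1 z.2 ^ 2)
        (Ioc 0 T ×ˢ Ioo a b) ∧
      ∫ z in Ioc 0 T ×ˢ Ioo a b, (posSet a b u).indicator
        (fun z => mobility n ε (u z.1 z.2) * uxxx z.1 z.2 ^ 2) z ≤
        energy₀ a b duin / (2 * |Real.log ε|) := by
  have hT' : T < max T 0 + 1 := by linarith [le_max_left T 0]
  have hT0 : 0 < max T 0 + 1 := by linarith [le_max_right T 0]
  have hl := abs_log_pos hS.eps_pos hS.eps_lt
  have hE := energy₀_nonneg a b duin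
  have hm0 : ∀ s, 0 < s → 0 ≤ mobility n ε s := fun s hs =>
    le_trans (by positivity) (cube_le_mobility n hS.eps_pos hs.le)
  have hmc : ContinuousOn (mobility n ε) (Ioi 0) :=
    (continuousOn_const.mul (continuousOn_id.rpow_const fun v hv => Or.inl (ne_of_gt hv))).add
      (continuousOn_id.pow 3)
  refine hS.integrableOn_posSet ?_ (fun z hz => mul_nonneg (hm0 _ hz.2) (sq_nonneg _))
    (by positivity) hT' ?_
  · exact (hS.aestronglyMeasurable_posSet hmc).mul (hS.sol.uxxx_meas.pow 2)
  · have h := (le_add_of_nonneg_left zero_le).trans (hS.sol.energy _ hT0)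
    rw [hS.datum.lintegral_energy] at h
    have e : ∀ z : ℝ × ℝ, ENNReal.ofReal (|Real.log ε| * mobility n ε (u z.1 z.2) * uxxx z.1 z.2 ^ 2)
        = ENNReal.ofReal |Real.log ε| *
          ENNReal.ofReal (mobility n ε (u z.1 z.2) * uxxx z.1 z.2 ^ 2) := fun z => by
      rw [mul_assoc, ENNReal.ofReal_mul hl.le]
    simp_rw [e] at h
    rw [lintegral_const_mul' _ _ ENNReal.ofReal_ne_top] at h
    rw [show energy₀ a b duin / (2 * |Real.log ε|) = 1 / 2 * energy₀ a b duin / |Real.log ε| by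
      field_simp, ENNReal.ofReal_div_of_pos hl, ENNReal.le_div_iff_mul_le
      (Or.inl (ENNReal.ofReal_pos.2 hl).ne') (Or.inl ENNReal.ofReal_ne_top), mul_comm]
    exact h

/-- For almost every time the solution is a profile, with finite weighted third derivative. -/
theorem ae_isProfile (hS : Setting n a b ε K uin duin u ux uxx uxxx) :
    ∀ᵐ t ∂(volume.restrict (Ioi (0 : ℝ))), 0 < t ∧
      IsProfile a b (u t) (ux t) (uxx t) (uxxx t) ∧
      IntegrableOn ({x ∈ Ioo a b | 0 < u t x}.indicator fun x => u t x ^ 3 * uxxx t x ^ 2)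
        (Ioo a b) ∧
      IntegrableOn ({x ∈ Ioo a b | 0 < u t x}.indicator
        fun x => mobility n ε (u t x) * uxxx t x ^ 2) (Ioo a b) := by
  have h1 : ∀ᵐ t ∂(volume.restrict (Ioi (0 : ℝ))), IntegrableOn (fun x => (posSet a b u).indicator
      (fun z => u z.1 z.2 * uxx z.1 z.2 ^ 2) (t, x)) (Ioo a b) := by
    refine ae_Ioi_of_forall_Ioc fun N => ?_
    have := (hS.integrableOn_dissip N).1
    rw [IntegrableOn, restrict_prod_Ioc] at this
    exact this.prod_right_ae
  have h2 : ∀ᵐ t ∂(volume.restrict (Ioi (0 : ℝ))), IntegrableOn (fun x => (posSet a b u).indicator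
      (fun z => mobility n ε (u z.1 z.2) * uxxx z.1 z.2 ^ 2) (t, x)) (Ioo a b) := by
    refine ae_Ioi_of_forall_Ioc fun N => ?_
    have := (hS.integrableOn_mobility N).1
    rw [IntegrableOn, restrict_prod_Ioc] at this
    exact this.prod_right_ae
  have h3 : ∀ᵐ t ∂(volume.restrict (Ioi (0 : ℝ))), AEStronglyMeasurable (fun x =>
      (posSet a b u).indicator (fun z => u z.1 z.2 ^ 3 * uxxx z.1 z.2 ^ 2) (t, x))
      (volume.restrict (Ioo a b)) := by
    have hm : AEStronglyMeasurable ((posSet a b u).indicator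
        fun z => u z.1 z.2 ^ 3 * uxxx z.1 z.2 ^ 2) (volume.restrict (cylinder a b)) :=
      hS.aestronglyMeasurable_indicator ((hS.aestronglyMeasurable_posSet (G := fun s => s ^ 3)
        (continuousOn_id.pow 3)).mul (hS.sol.uxxx_meas.pow 2)) _
    rw [cylinder, Measure.volume_eq_prod, ← Measure.prod_restrict] at hm
    exact hm.prodMk_left
  filter_upwards [h1, h2, h3, hS.sol.neumann, hS.sol.deriv_two, hS.sol.deriv_three,
    ae_restrict_mem measurableSet_Ioi] with t g1 g2 g3 g4 g5 g6 ht
  have ht : 0 < t := ht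
  simp_rw [fun x => indicator_posSet_slice (a := a) (b := b) (u := u)
    (fun t x => u t x * uxx t x ^ 2) ht x] at g1
  simp_rw [fun x => indicator_posSet_slice (a := a) (b := b) (u := u)
    (fun t x => mobility n ε (u t x) * uxxx t x ^ 2) ht x] at g2
  simp_rw [fun x => indicator_posSet_slice (a := a) (b := b) (u := u)
    (fun t x => u t x ^ 3 * uxxx t x ^ 2) ht x] at g3
  refine ⟨ht, ⟨hS.lt, hS.sol.nonneg t ht.le, hS.sol.deriv_one t ht, g4.1, g4.2.1, g4.2.2, g5, g6,
    g1⟩, ?_, g2⟩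
  refine g2.mono' g3 (ae_of_all _ fun x => ?_)
  rw [Real.norm_of_nonneg (indicator_nonneg (fun x hx => ?_) x)]
  · refine indicator_le_indicator' fun hx => ?_
    exact mul_le_mul_of_nonneg_right (cube_le_mobility n hS.eps_pos hx.2.le) (sq_nonneg _)
  · have := hx.2
    positivity

end Setting

end

section

variable {n a b ε K : ℝ} {uin duin : ℝ → ℝ} {u ux uxx uxxx : ℝ → ℝ → ℝ}

/-- The density of the right-hand side of the equation for `ρ^ε`, tested against `χ` in space. -/
def rateDensity (n a b ε : ℝ) (u ux uxx uxxx : ℝ → ℝ → ℝ) (χ : ℝ → ℝ) (z : ℝ × ℝ) : ℝ :=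
  (posSet a b u).indicator (fun z => u z.1 z.2 * uxx z.1 z.2 ^ 2) z * χ z.2
    - 5 / 6 * (ux z.1 z.2 ^ 3 * deriv χ z.2)
    - 1 / 2 * (u z.1 z.2 * ux z.1 z.2 ^ 2 * iteratedDeriv 2 χ z.2)
    - (posSet a b u).indicator (fun z => fluxR n ε u uxxx z.1 z.2) z * deriv χ z.2

/-- The time derivative of `∫ ρ^ε χ`. -/
def rate (n a b ε : ℝ) (u ux uxx uxxx : ℝ → ℝ → ℝ) (χ : ℝ → ℝ) (t : ℝ) : ℝ :=
  ∫ x in Ioo a b, rateDensity n a b ε u ux uxx uxxx χ (t, x)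

theorem IntegrableOn.mul_continuous_snd {F : ℝ × ℝ → ℝ} {T : ℝ}
    (hF : IntegrableOn F (Ioc 0 T ×ˢ Ioo a b)) {χ : ℝ → ℝ} (hχ : Continuous χ) :
    IntegrableOn (fun z => F z * χ z.2) (Ioc 0 T ×ˢ Ioo a b) := by
  obtain ⟨C, hC⟩ := isCompact_Icc.exists_bound_of_continuousOn (s := Icc a b) hχ.continuousOn
  refine hF.mul_bdd (c := C) (hχ.comp continuous_snd).aestronglyMeasurable ?_
  filter_upwards [ae_restrict_mem (measurableSet_Ioc.prod measurableSet_Ioo)] with z hz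
  exact hC z.2 (Ioo_subset_Icc_self hz.2)

theorem IntegrableOn.mul_continuous_fst {F : ℝ × ℝ → ℝ} {T : ℝ}
    (hF : IntegrableOn F (Ioc 0 T ×ˢ Ioo a b)) {η : ℝ → ℝ} (hη : Continuous η) :
    IntegrableOn (fun z => F z * η z.1) (Ioc 0 T ×ˢ Ioo a b) := by
  obtain ⟨C, hC⟩ := isCompact_Icc.exists_bound_of_continuousOn (s := Icc 0 T) hη.continuousOn
  refine hF.mul_bdd (c := C) (hη.comp continuous_fst).aestronglyMeasurable ?_
  filter_upwards [ae_restrict_mem (measurableSet_Ioc.prod measurableSet_Ioo)] with z hz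
  exact hC z.1 (Ioc_subset_Icc_self hz.1)

theorem integrableOn_cylinder_of_eq_zero {G : ℝ × ℝ → ℝ} {T : ℝ}
    (hG : IntegrableOn G (Ioc 0 T ×ˢ Ioo a b)) (h0 : ∀ z : ℝ × ℝ, T < z.1 → G z = 0) :
    IntegrableOn G (cylinder a b) :=
  hG.of_forall_sdiff_eq_zero (measurableSet_cylinder a b) fun z hz =>
    h0 z (not_le.1 fun hle => hz.2 ⟨⟨hz.1.1, hle⟩, hz.1.2⟩)

theorem setIntegral_cylinder {G : ℝ × ℝ → ℝ} (hG : IntegrableOn G (cylinder a b)) :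
    ∫ z in cylinder a b, G z = ∫ t in Ioi 0, ∫ x in Ioo a b, G (t, x) := by
  rw [cylinder, Measure.volume_eq_prod] at *
  exact setIntegral_prod G hG

theorem integral_sub_mul_sub_mul_sub {α : Type*} [MeasurableSpace α] {μ : Measure α}
    {F₁ F₂ F₃ F₄ : α → ℝ} {c d : ℝ} (h₁ : Integrable F₁ μ) (h₂ : Integrable F₂ μ)
    (h₃ : Integrable F₃ μ) (h₄ : Integrable F₄ μ) :
    ∫ x, (F₁ x - c * F₂ x - d * F₃ x - F₄ x) ∂μ =
      (∫ x, F₁ x ∂μ) - c * (∫ x, F₂ x ∂μ) - d * (∫ x, F₃ x ∂μ) - ∫ x, F₄ x ∂μ := by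
  have e1 : Integrable (fun x => F₁ x - c * F₂ x) μ := h₁.sub (h₂.const_mul c)
  have e2 : Integrable (fun x => F₁ x - c * F₂ x - d * F₃ x) μ := e1.sub (h₃.const_mul d)
  rw [integral_sub e2 h₄, integral_sub e1 (h₃.const_mul d), integral_sub h₁ (h₂.const_mul c),
    integral_const_mul, integral_const_mul]

namespace Setting

theorem setIntegral_posSet (hS : Setting n a b ε K uin duin u ux uxx uxxx) (F : ℝ × ℝ → ℝ) :
    ∫ z in posSet a b u, F z = ∫ z in cylinder a b, (posSet a b u).indicator F z := by
  rw [setIntegral_indicator hS.sol.measurableSet_posSet,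
    inter_eq_right.2 (posSet_subset_cylinder a b u)]

theorem ux_aestronglyMeasurable (hS : Setting n a b ε K uin duin u ux uxx uxxx) (T : ℝ) :
    AEStronglyMeasurable (Function.uncurry ux) (volume.restrict (Ioc 0 T ×ˢ Ioo a b)) :=
  hS.sol.ux_meas.mono_measure (Measure.restrict_mono_set _ (Ioc_prod_subset_cylinder a b T))

theorem integrableOn_ux_sq (hS : Setting n a b ε K uin duin u ux uxx uxxx) (T : ℝ) :
    IntegrableOn (fun z : ℝ × ℝ => ux z.1 z.2 ^ 2) (Ioc 0 T ×ˢ Ioo a b) := by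
  have hm : AEStronglyMeasurable (fun z : ℝ × ℝ => ux z.1 z.2 ^ 2)
      (volume.restrict (Ioc 0 T ×ˢ Ioo a b)) := (hS.ux_aestronglyMeasurable T).pow 2
  rw [IntegrableOn]
  rw [restrict_prod_Ioc] at hm ⊢
  refine (integrable_prod_iff hm).2 ⟨?_, ?_⟩
  · filter_upwards [ae_restrict_mem measurableSet_Ioc] with t ht
    exact (hS.sol.ux_sq hS.lt hS.datum ht.1).1
  · refine Integrable.mono' (g := fun _ => energy₀ a b duin)
      (integrableOn_const (by simp) (by simp)) hm.norm.integral_prod_right' ?_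
    filter_upwards [ae_restrict_mem measurableSet_Ioc] with t ht
    rw [Real.norm_of_nonneg (integral_nonneg fun x => norm_nonneg _)]
    simp_rw [norm_pow, Real.norm_eq_abs, sq_abs]
    exact (hS.sol.ux_sq hS.lt hS.datum ht.1).2

theorem integrableOn_u_ux_sq (hS : Setting n a b ε K uin duin u ux uxx uxxx) (T : ℝ) :
    IntegrableOn (fun z : ℝ × ℝ => u z.1 z.2 * ux z.1 z.2 ^ 2) (Ioc 0 T ×ˢ Ioo a b) := by
  refine (hS.integrableOn_ux_sq T).bdd_mul (c := supBound a b duin) ?_ ?_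
  · exact (hS.sol.continuousOn_cylinder.mono
      (Ioc_prod_subset_cylinder a b T)).aestronglyMeasurable
        (measurableSet_Ioc.prod measurableSet_Ioo)
  · filter_upwards [ae_restrict_mem (measurableSet_Ioc.prod measurableSet_Ioo)] with z hz
    have hz2 := Ioo_subset_Icc_self hz.2
    rw [Real.norm_of_nonneg (hS.sol.nonneg z.1 hz.1.1.le z.2 hz2)]
    exact hS.sol.le_supBound hS.lt hS.datum hz.1.1.le hz2

theorem integrableOn_dissip_time (hS : Setting n a b ε K uin duin u ux uxx uxxx) (T : ℝ) :
    IntegrableOn (fun t => dissip a b (u t) (uxx t)) (Ioc 0 T) ∧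
      ∫ t in Ioc 0 T, dissip a b (u t) (uxx t) ≤ (b - a) * rhoBound a b ε K duin := by
  obtain ⟨h1, h2⟩ := hS.integrableOn_dissip T
  have e : ∀ t ∈ Ioc 0 T, ∫ x in Ioo a b, (posSet a b u).indicator
      (fun z => u z.1 z.2 * uxx z.1 z.2 ^ 2) (t, x) = dissip a b (u t) (uxx t) := fun t ht => by
    simp_rw [fun x => indicator_posSet_slice (a := a) (b := b) (u := u)
      (fun t x => u t x * uxx t x ^ 2) ht.1 x]
    rfl
  rw [IntegrableOn] at h1
  rw [restrict_prod_Ioc] at h1 h2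
  rw [integral_prod _ h1, setIntegral_congr_fun measurableSet_Ioc e] at h2
  refine ⟨?_, h2⟩
  exact (integrableOn_congr_fun e measurableSet_Ioc).1 h1.integral_prod_left

theorem integrableOn_ux_cube (hS : Setting n a b ε K uin duin u ux uxx uxxx) (T : ℝ) :
    IntegrableOn (fun z : ℝ × ℝ => ux z.1 z.2 ^ 3) (Ioc 0 T ×ˢ Ioo a b) := by
  have hm : AEStronglyMeasurable (fun z : ℝ × ℝ => ux z.1 z.2 ^ 3)
      (volume.restrict (Ioc 0 T ×ˢ Ioo a b)) := (hS.ux_aestronglyMeasurable T).pow 3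
  have hprof := ae_restrict_of_ae_restrict_of_subset
    (Ioc_subset_Ioi_self : Ioc 0 T ⊆ Ioi 0) hS.ae_isProfile
  rw [IntegrableOn]
  rw [restrict_prod_Ioc] at hm ⊢
  refine (integrable_prod_iff hm).2 ⟨?_, ?_⟩
  · filter_upwards [hprof] with t ht
    exact ht.2.1.integrableOn (ht.2.1.g_cont.pow 3)
  · refine Integrable.mono' (g := fun t => √(2 * supBound a b duin) *
      (dissip a b (u t) (uxx t) + energy₀ a b duin)) ?_ hm.norm.integral_prod_right' ?_
    · exact ((hS.integrableOn_dissip_time T).1.add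
        (integrableOn_const (by simp) (by simp))).const_mul _
    · filter_upwards [hprof] with t ht
      rw [Real.norm_of_nonneg (integral_nonneg fun x => norm_nonneg _)]
      simp_rw [norm_pow, Real.norm_eq_abs]
      refine (ht.2.1.integral_cube_le (zero_lt_one.trans_le (one_le_supBound hS.lt duin))
        fun x hx => hS.sol.le_supBound hS.lt hS.datum ht.1.le hx).trans ?_
      gcongr
      rw [intervalIntegral.integral_of_le hS.lt.le, integral_Ioc_eq_integral_Ioo]
      exact (hS.sol.ux_sq hS.lt hS.datum ht.1).2

theorem fluxR_sq_le (hS : Setting n a b ε K uin duin u ux uxx uxxx) {z : ℝ × ℝ}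
    (hz : z ∈ posSet a b u) : fluxR n ε u uxxx z.1 z.2 ^ 2 ≤
      K * (1 + supBound a b duin) * (mobility n ε (u z.1 z.2) * uxxx z.1 z.2 ^ 2) :=
  ThinFilm.fluxR_sq_le hS.const hS.eps_pos hS.eps_lt hz.2
    (hS.sol.le_supBound hS.lt hS.datum (le_of_lt hz.1.1) (Ioo_subset_Icc_self hz.1.2))

theorem integrableOn_flux (hS : Setting n a b ε K uin duin u ux uxx uxxx) (T : ℝ) :
    IntegrableOn ((posSet a b u).indicator fun z => fluxR n ε u uxxx z.1 z.2)
      (Ioc 0 T ×ˢ Ioo a b) := by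
  have hd : ContinuousOn (fun s => -|Real.log ε| * dBeps n ε s *
      (ε ^ (3 - n) * s ^ (n - 1) + s ^ 2) * s) (Ioi 0) := by
    have h1 : ContinuousOn (fun s => dB n (s / ε)) (Ioi 0) :=
      (continuousOn_dB n).comp (continuousOn_id.div_const ε) fun s hs =>
        div_pos (show (0 : ℝ) < s from hs) hS.eps_pos
    have h2 : ContinuousOn (fun s : ℝ => s ^ (n - 1)) (Ioi 0) :=
      continuousOn_id.rpow_const fun v hv => Or.inl (ne_of_gt hv)
    exact ((continuousOn_const.mul (h1.div_const _)).mul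
      ((continuousOn_const.mul h2).add (continuousOn_id.pow 2))).mul continuousOn_id
  have hm : AEStronglyMeasurable (fun z : ℝ × ℝ => fluxR n ε u uxxx z.1 z.2)
      (volume.restrict (posSet a b u)) := by
    refine ((hS.aestronglyMeasurable_posSet hd).mul hS.sol.uxxx_meas).congr
      (ae_of_all _ fun z => ?_)
    simp only [Pi.mul_apply, fluxR, Function.uncurry]
    ring
  have hvol : volume (Ioc 0 T ×ˢ Ioo a b) ≠ ⊤ := by
    rw [Measure.volume_eq_prod, Measure.prod_prod]
    exact ENNReal.mul_ne_top (by simp) (by simp)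
  refine Integrable.mono' (g := fun z => 1 / 2 * (1 + K * (1 + supBound a b duin) *
    (posSet a b u).indicator (fun z => mobility n ε (u z.1 z.2) * uxxx z.1 z.2 ^ 2) z)) ?_
    (hS.aestronglyMeasurable_indicator hm _) (ae_of_all _ fun z => ?_)
  · exact ((integrableOn_const hvol (by simp)).add ((hS.integrableOn_mobility T).1.const_mul _)).const_mul _
  · by_cases hz : z ∈ posSet a b u
    · rw [indicator_of_mem hz, indicator_of_mem hz, Real.norm_eq_abs]
      have h1 := hS.fluxR_sq_le hz
      have h2 := sq_nonneg (|fluxR n ε u uxxx z.1 z.2| - 1)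
      have h3 := sq_abs (fluxR n ε u uxxx z.1 z.2)
      nlinarith
    · rw [indicator_of_notMem hz, indicator_of_notMem hz]
      simp

theorem integrableOn_rateDensity (hS : Setting n a b ε K uin duin u ux uxx uxxx) (T : ℝ)
    {χ : ℝ → ℝ} (hχ : ContDiff ℝ (⊤ : ℕ∞) χ) :
    IntegrableOn (rateDensity n a b ε u ux uxx uxxx χ) (Ioc 0 T ×ˢ Ioo a b) := by
  have c1 : Continuous (deriv χ) := hχ.continuous_deriv (by simp)
  have c2 : Continuous (iteratedDeriv 2 χ) := hχ.continuous_iteratedDeriv 2 (by norm_cast)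
  exact (((IntegrableOn.mul_continuous_snd (hS.integrableOn_dissip T).1 hχ.continuous).sub
    ((IntegrableOn.mul_continuous_snd (hS.integrableOn_ux_cube T) c1).const_mul _)).sub
    ((IntegrableOn.mul_continuous_snd (hS.integrableOn_u_ux_sq T) c2).const_mul _)).sub
    (IntegrableOn.mul_continuous_snd (hS.integrableOn_flux T) c1)

theorem integrableOn_rate (hS : Setting n a b ε K uin duin u ux uxx uxxx) (T : ℝ)
    {χ : ℝ → ℝ} (hχ : ContDiff ℝ (⊤ : ℕ∞) χ) :
    IntegrableOn (rate n a b ε u ux uxx uxxx χ) (Ioc 0 T) := by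
  have := hS.integrableOn_rateDensity T hχ
  rw [IntegrableOn, restrict_prod_Ioc] at this
  exact this.integral_prod_left

theorem integral_rho_mul_deriv (hS : Setting n a b ε K uin duin u ux uxx uxxx)
    {χ η : ℝ → ℝ} (hχ : ContDiff ℝ (⊤ : ℕ∞) χ) (hχc : HasCompactSupport χ)
    (hη : ContDiff ℝ (⊤ : ℕ∞) η) (hηc : HasCompactSupport η) (hη0 : tsupport η ⊆ Ioi 0) :
    ∫ t in Ioi 0, (∫ x in Ioo a b, rhoOf n ε u t x * χ x) * deriv η t =
      -∫ t in Ioi 0, rate n a b ε u ux uxx uxxx χ t * η t := by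
  obtain ⟨T, hT⟩ : ∃ T, ∀ t, T < t → t ∉ tsupport η := by
    obtain ⟨T, hT⟩ := hηc.isCompact.bddAbove
    exact ⟨T, fun t ht hm => not_lt.2 (hT hm) ht⟩
  have hηT : ∀ t, T < t → η t = 0 := fun t ht => image_eq_zero_of_notMem_tsupport (hT t ht)
  have hη'T : ∀ t, T < t → deriv η t = 0 := fun t ht =>
    image_eq_zero_of_notMem_tsupport fun hm => hT t ht (tsupport_deriv_subset hm)
  have hsupp : tsupport (Function.uncurry fun t x => η t * χ x) ⊆ tsupport η ×ˢ tsupport χ := by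
    refine closure_minimal (fun z hz => ?_) ((isClosed_tsupport η).prod (isClosed_tsupport χ))
    have hz : η z.1 * χ z.2 ≠ 0 := hz
    exact ⟨subset_tsupport _ (left_ne_zero_of_mul hz), subset_tsupport _ (right_ne_zero_of_mul hz)⟩
  have htest : IsTestFunction fun t x => η t * χ x := by
    refine ⟨(hη.comp contDiff_fst).mul (hχ.comp contDiff_snd), ?_, ?_⟩
    · exact (hηc.isCompact.prod hχc.isCompact).of_isClosed_subset (isClosed_tsupport _) hsupp
    · exact hsupp.trans (prod_mono hη0 (subset_univ _))
  have heq := hS.sol.rho_equation _ htest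
  have d1 : ∀ t x, deriv (fun s => η s * χ x) t = deriv η t * χ x := fun t x =>
    deriv_mul_const (hη.differentiable (by simp) t) _
  have d2 : ∀ t x, deriv (fun x => η t * χ x) x = η t * deriv χ x := fun t x =>
    deriv_const_mul _ (hχ.differentiable (by simp) x)
  have d3 : ∀ t x, iteratedDeriv 2 (fun x => η t * χ x) x = η t * iteratedDeriv 2 χ x := fun t x =>
    iteratedDeriv_const_mul_field _ _
  simp only [d1, d2, d3] at heq
  have c1 : Continuous (deriv χ) := hχ.continuous_deriv (by simp)
  have c2 : Continuous (iteratedDeriv 2 χ) := hχ.continuous_iteratedDeriv 2 (by norm_cast)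
  have c3 : Continuous (deriv η) := hη.continuous_deriv (by simp)
  rw [hS.setIntegral_posSet, hS.setIntegral_posSet] at heq
  have I : ∀ {F : ℝ × ℝ → ℝ} {ψ : ℝ → ℝ}, Continuous ψ → IntegrableOn F (Ioc 0 T ×ˢ Ioo a b) →
      IntegrableOn (fun z => F z * ψ z.2 * η z.1) (cylinder a b) := fun hψ hF =>
    integrableOn_cylinder_of_eq_zero (IntegrableOn.mul_continuous_fst
      (IntegrableOn.mul_continuous_snd hF hψ) hη.continuous) fun z hz => by rw [hηT _ hz, mul_zero]
  have I1 := I hχ.continuous (hS.integrableOn_dissip T).1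
  have I2 := I c1 (hS.integrableOn_ux_cube T)
  have I3 := I c2 (hS.integrableOn_u_ux_sq T)
  have I4 := I c1 (hS.integrableOn_flux T)
  have Irho : IntegrableOn (fun z : ℝ × ℝ => rhoOf n ε u z.1 z.2 * χ z.2 * deriv η z.1)
      (cylinder a b) := by
    refine integrableOn_cylinder_of_eq_zero (T := T) (IntegrableOn.mul_continuous_fst
      (IntegrableOn.mul_continuous_snd ?_ hχ.continuous) c3) fun z hz => by rw [hη'T _ hz, mul_zero]
    exact ((hS.sol.continuousOn_rho hS.n_pos hS.n_lt hS.eps_pos).mono (prod_mono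
      (Icc_subset_Ici_self : Icc 0 T ⊆ Ici 0) Subset.rfl)).integrableOn_compact
      (isCompact_Icc.prod isCompact_Icc) |>.mono_set
        (prod_mono Ioc_subset_Icc_self Ioo_subset_Icc_self)
  have L : ∫ z in cylinder a b, rhoOf n ε u z.1 z.2 * (deriv η z.1 * χ z.2) =
      ∫ t in Ioi 0, (∫ x in Ioo a b, rhoOf n ε u t x * χ x) * deriv η t := by
    have e : ∀ z : ℝ × ℝ, rhoOf n ε u z.1 z.2 * (deriv η z.1 * χ z.2) =
      rhoOf n ε u z.1 z.2 * χ z.2 * deriv η z.1 := fun z => by ring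
    simp_rw [e]
    rw [setIntegral_cylinder Irho]
    simp_rw [integral_mul_const]
  have R : ∫ t in Ioi 0, rate n a b ε u ux uxx uxxx χ t * η t =
      ∫ z in cylinder a b, rateDensity n a b ε u ux uxx uxxx χ z * η z.1 := by
    rw [setIntegral_cylinder]
    · simp_rw [integral_mul_const]; rfl
    · exact integrableOn_cylinder_of_eq_zero (IntegrableOn.mul_continuous_fst
        (hS.integrableOn_rateDensity T hχ) hη.continuous) fun z hz => by rw [hηT _ hz, mul_zero]
  rw [← L, R]
  have R2 : ∫ z in cylinder a b, rateDensity n a b ε u ux uxx uxxx χ z * η z.1 =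
      (∫ z in cylinder a b, (posSet a b u).indicator (fun z => u z.1 z.2 * uxx z.1 z.2 ^ 2) z
        * χ z.2 * η z.1)
      - 5 / 6 * (∫ z in cylinder a b, ux z.1 z.2 ^ 3 * deriv χ z.2 * η z.1)
      - 1 / 2 * (∫ z in cylinder a b, u z.1 z.2 * ux z.1 z.2 ^ 2 * iteratedDeriv 2 χ z.2 * η z.1)
      - ∫ z in cylinder a b, (posSet a b u).indicator (fun z => fluxR n ε u uxxx z.1 z.2) z
        * deriv χ z.2 * η z.1 := by
    rw [← integral_sub_mul_sub_mul_sub I1 I2 I3 I4]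
    refine integral_congr_ae (ae_of_all _ fun z => ?_)
    simp only [rateDensity]
    ring
  rw [R2]
  have hind : ∀ (F G : ℝ × ℝ → ℝ) (z : ℝ × ℝ), (posSet a b u).indicator (fun z => F z * G z) z =
      (posSet a b u).indicator F z * G z := fun F G z => by
    rw [indicator_mul_left]
  rw [← neg_eq_iff_eq_neg, heq]
  congr 1
  · congr 1
    · congr 1
      · refine integral_congr_ae (ae_of_all _ fun z => ?_)
        simp only [hind (fun z => u z.1 z.2 * uxx z.1 z.2 ^ 2) (fun z => η z.1 * χ z.2)]
        ring
      · congr 1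
        refine integral_congr_ae (ae_of_all _ fun z => ?_)
        simp only
        ring
    · congr 1
      refine integral_congr_ae (ae_of_all _ fun z => ?_)
      simp only
      ring
  · refine integral_congr_ae (ae_of_all _ fun z => ?_)
    simp only [hind (fun z => fluxR n ε u uxxx z.1 z.2) (fun z => η z.1 * deriv χ z.2)]
    ring

end Setting

end

section

/-! ### From the weak formulation in time to an integral identity -/

theorem exists_Icc_of_isCompact_subset_Ioi {S : Set ℝ} (hS : IsCompact S) (h : S ⊆ Ioi 0) :
    ∃ c T, 0 < c ∧ c ≤ T ∧ S ⊆ Icc c T := by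
  rcases S.eq_empty_or_nonempty with rfl | hne
  · exact ⟨1, 1, one_pos, le_rfl, empty_subset _⟩
  · have h1 := hS.sInf_mem hne
    have hsub : S ⊆ Icc (sInf S) (sSup S) := fun x hx =>
      ⟨csInf_le hS.bddBelow hx, le_csSup hS.bddAbove hx⟩
    exact ⟨sInf S, sSup S, h h1, (hsub h1).2, hsub⟩

theorem exists_test_primitive {ψ : ℝ → ℝ} (hψ : ContDiff ℝ (⊤ : ℕ∞) ψ) (hc : HasCompactSupport ψ)
    (h0 : tsupport ψ ⊆ Ioi 0) (hint : ∫ t, ψ t = 0) :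
    ∃ η : ℝ → ℝ, ContDiff ℝ (⊤ : ℕ∞) η ∧ HasCompactSupport η ∧ tsupport η ⊆ Ioi 0 ∧
      deriv η = ψ := by
  obtain ⟨c, T, hc0, hcT, hS⟩ := exists_Icc_of_isCompact_subset_Ioi hc.isCompact h0
  have hz : ∀ t, t ∉ Icc c T → ψ t = 0 := fun t ht =>
    image_eq_zero_of_notMem_tsupport fun hm => ht (hS hm)
  have hd : ∀ t, HasDerivAt (fun t => ∫ s in (0 : ℝ)..t, ψ s) (ψ t) t := fun t =>
    intervalIntegral.integral_hasDerivAt_right (hψ.continuous.intervalIntegrable _ _)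
      hψ.continuous.stronglyMeasurable.stronglyMeasurableAtFilter hψ.continuous.continuousAt
  have hderiv : deriv (fun t => ∫ s in (0 : ℝ)..t, ψ s) = ψ := funext fun t => (hd t).deriv
  have hsupp : tsupport (fun t => ∫ s in (0 : ℝ)..t, ψ s) ⊆ Icc c T := by
    refine closure_minimal (fun t ht => ?_) isClosed_Icc
    by_contra hn
    refine ht ?_
    beta_reduce
    rcases lt_or_ge t c with h | h
    · have : ∫ s in (0 : ℝ)..t, ψ s = ∫ s in (0 : ℝ)..t, (0 : ℝ) := by
        refine intervalIntegral.integral_congr fun s hs => hz s fun hm => ?_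
        have : s ≤ max 0 t := hs.2
        rcases le_max_iff.1 this with h' | h'
        · linarith [hm.1]
        · linarith [hm.1]
      rw [this]; simp
    · have hT : T < t := not_le.1 fun h' => hn ⟨h, h'⟩
      have h0t : 0 ≤ t := by linarith
      rw [intervalIntegral.integral_of_le h0t, ← hint]
      exact setIntegral_eq_integral_of_forall_compl_eq_zero fun s hs => hz s fun hm =>
        hs ⟨by linarith [hm.1], by linarith [hm.2]⟩
  refine ⟨fun t => ∫ s in (0 : ℝ)..t, ψ s, ?_, ?_, ?_, hderiv⟩
  · rw [contDiff_infty_iff_deriv, hderiv]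
    exact ⟨fun t => (hd t).differentiableAt, hψ⟩
  · exact isCompact_Icc.of_isClosed_subset (isClosed_tsupport _) hsupp
  · exact hsupp.trans fun t ht => hc0.trans_le ht.1

theorem exists_normalized_test : ∃ g : ℝ → ℝ, ContDiff ℝ (⊤ : ℕ∞) g ∧ HasCompactSupport g ∧
    tsupport g ⊆ Ioi 0 ∧ ∫ t, g t = 1 := by
  let f : ContDiffBump (2 : ℝ) := ⟨1 / 2, 1, by norm_num, by norm_num⟩
  refine ⟨f.normed volume, f.contDiff_normed, f.hasCompactSupport_normed, ?_, f.integral_normed⟩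
  rw [f.tsupport_normed_eq]
  intro t ht
  rw [Metric.mem_closedBall, Real.dist_eq, abs_le] at ht
  have : f.rOut = 1 := rfl
  have h1 := ht.1
  rw [this] at h1
  show 0 < t
  linarith

/-- The du Bois-Reymond lemma on a half-line. -/
theorem sub_eq_integral_of_weak {m J : ℝ → ℝ} (hm : ContinuousOn m (Ici 0))
    (hJ : ∀ T, IntegrableOn J (Ioc 0 T))
    (h : ∀ η : ℝ → ℝ, ContDiff ℝ (⊤ : ℕ∞) η → HasCompactSupport η → tsupport η ⊆ Ioi 0 →
      ∫ t in Ioi 0, m t * deriv η t = -∫ t in Ioi 0, J t * η t)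
    {s t : ℝ} (hs : 0 ≤ s) (hst : s ≤ t) : m t - m s = ∫ r in s..t, J r := by
  have hJi : ∀ p q : ℝ, 0 ≤ p → p ≤ q → IntervalIntegrable J volume p q := fun p q hp hpq =>
    (intervalIntegrable_iff_integrableOn_Ioc_of_le hpq).2 ((hJ q).mono_set (Ioc_subset_Ioc_left hp))
  set A : ℝ → ℝ := fun t => ∫ r in (0 : ℝ)..t, J r with hA
  have hAd : IsSobolevDerivOn (Ici 0) A J := by
    intro p q hpq hsub
    have hp : 0 ≤ p := hsub (left_mem_Icc.2 hpq)
    refine ⟨hJi p q hp hpq, ?_⟩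
    exact (intervalIntegral.integral_interval_sub_left (hJi 0 q le_rfl (hp.trans hpq))
      (hJi 0 p le_rfl hp)).symm
  have hAc : ContinuousOn A (Ici 0) := by
    intro p hp
    have hp : (0 : ℝ) ≤ p := hp
    have h1 := hAd.continuousOn (x := 0) (y := p + 1) (by linarith) Icc_subset_Ici_self
    refine (h1 p ⟨hp, by linarith⟩).mono_of_mem_nhdsWithin ?_
    rw [← Ici_inter_Iic]
    exact inter_mem self_mem_nhdsWithin (mem_nhdsWithin_of_mem_nhds (Iic_mem_nhds (by linarith)))
  set N : ℝ → ℝ := fun t => m t - A t with hN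
  have hNc : ContinuousOn N (Ici 0) := hm.sub hAc
  have intTest : ∀ {F ψ : ℝ → ℝ}, ContinuousOn F (Ici 0) → Continuous ψ → HasCompactSupport ψ →
      tsupport ψ ⊆ Ioi 0 → IntegrableOn (fun t => F t * ψ t) (Ioi 0) := by
    intro F ψ hF hψ hψc hψ0
    obtain ⟨c, T, hc0, hcT, hS⟩ := exists_Icc_of_isCompact_subset_Ioi hψc.isCompact hψ0
    have h1 : IntegrableOn (fun t => F t * ψ t) (Icc c T) :=
      ((hF.mono fun x hx => hc0.le.trans hx.1).mul hψ.continuousOn).integrableOn_Icc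
    refine h1.of_forall_sdiff_eq_zero measurableSet_Ioi fun t ht => ?_
    rw [image_eq_zero_of_notMem_tsupport fun hm => ht.2 (hS hm), mul_zero]
  have hNη : ∀ η : ℝ → ℝ, ContDiff ℝ (⊤ : ℕ∞) η → HasCompactSupport η → tsupport η ⊆ Ioi 0 →
      ∫ t in Ioi 0, N t * deriv η t = 0 := by
    intro η hη hηc hη0
    have c1 : Continuous (deriv η) := hη.continuous_deriv (by simp)
    have hd0 : tsupport (deriv η) ⊆ Ioi 0 := (tsupport_deriv_subset).trans hη0
    obtain ⟨c, T, hc0, hcT, hS⟩ := exists_Icc_of_isCompact_subset_Ioi hηc.isCompact hη0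
    have hz : ∀ t, t ∉ Icc c T → η t = 0 := fun t ht =>
      image_eq_zero_of_notMem_tsupport fun hm => ht (hS hm)
    have hz' : ∀ t, t ∉ Icc c T → deriv η t = 0 := fun t ht =>
      image_eq_zero_of_notMem_tsupport fun hm => ht (hS (tsupport_deriv_subset hm))
    have hT1 : 0 ≤ T + 1 := by linarith
    have hηd : IsSobolevDerivOn (Ici 0) η (deriv η) := isSobolevDerivOn_of_hasDerivAt
      (fun x _ => (hη.differentiable (by simp) x).hasDerivAt) c1.continuousOn
    obtain ⟨i1, e1⟩ := (hAd.mul hηd) 0 (T + 1) hT1 Icc_subset_Ici_self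
    beta_reduce at e1
    rw [hz (T + 1) (fun hm => by linarith [hm.2]), hz 0 (fun hm => by linarith [hm.1]), mul_zero,
      mul_zero, sub_zero, intervalIntegral.integral_of_le hT1] at e1
    rw [intervalIntegrable_iff_integrableOn_Ioc_of_le hT1] at i1
    have hzero : ∀ t ∈ Ioi (0 : ℝ) \ Ioc 0 (T + 1), J t * η t + A t * deriv η t = 0 := fun t ht => by
      have : t ∉ Icc c T := fun hm => ht.2 ⟨ht.1, by linarith [hm.2]⟩
      rw [hz t this, hz' t this]; simp
    have i2 := i1.of_forall_sdiff_eq_zero measurableSet_Ioi hzero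
    have e2 : ∫ t in Ioi 0, (J t * η t + A t * deriv η t) = 0 := by
      rw [setIntegral_eq_of_subset_of_forall_sdiff_eq_zero measurableSet_Ioi Ioc_subset_Ioi_self hzero,
        e1]
    have iA := intTest hAc c1 hηc.deriv hd0
    have iM := intTest hm c1 hηc.deriv hd0
    have iJ : IntegrableOn (fun t => J t * η t) (Ioi 0) := by
      refine (i2.sub iA).congr (ae_of_all _ fun t => ?_)
      simp
    rw [integral_add iJ iA] at e2
    have := h η hη hηc hη0
    simp_rw [hN, sub_mul]
    rw [integral_sub iM iA]
    linarith
  obtain ⟨g₀, hg₀, hg₀c, hg₀0, hg₀1⟩ := exists_normalized_test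
  set c := ∫ t in Ioi 0, N t * g₀ t with hc
  have hae : ∀ᵐ t, t ∈ Ioi (0 : ℝ) → N t - c = 0 := by
    refine isOpen_Ioi.ae_eq_zero_of_integral_contDiff_smul_eq_zero ?_ fun g hg hgc hg0 => ?_
    · exact ((hNc.mono Ioi_subset_Ici_self).sub continuousOn_const).locallyIntegrableOn
        measurableSet_Ioi
    · set ψ : ℝ → ℝ := fun t => g t - (∫ s, g s) * g₀ t with hψdef
      have ψsm : ContDiff ℝ (⊤ : ℕ∞) ψ := hg.sub (contDiff_const.mul hg₀)
      have hsup : tsupport ψ ⊆ tsupport g ∪ tsupport g₀ := by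
        refine closure_minimal (fun t ht => ?_) ((isClosed_tsupport g).union (isClosed_tsupport g₀))
        by_contra hn
        rw [mem_union, not_or] at hn
        exact ht (by simp [hψdef, image_eq_zero_of_notMem_tsupport hn.1,
          image_eq_zero_of_notMem_tsupport hn.2])
      have ψc : HasCompactSupport ψ :=
        (hgc.isCompact.union hg₀c.isCompact).of_isClosed_subset (isClosed_tsupport _) hsup
      have gi : Integrable g := hg.continuous.integrable_of_hasCompactSupport hgc
      have g₀i : Integrable g₀ := hg₀.continuous.integrable_of_hasCompactSupport hg₀c
      have ψint : ∫ t, ψ t = 0 := by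
        rw [integral_sub gi (g₀i.const_mul _), integral_const_mul, hg₀1]; ring
      obtain ⟨η, h1, h2, h3, h4⟩ := exists_test_primitive ψsm ψc
        (hsup.trans (union_subset hg0 hg₀0)) ψint
      have key := hNη η h1 h2 h3
      rw [h4] at key
      have j1 := intTest hNc hg.continuous hgc hg0
      have j2 := intTest hNc hg₀.continuous hg₀c hg₀0
      have e1 : ∀ t, N t * ψ t = N t * g t - (∫ s, g s) * (N t * g₀ t) := fun t => by
        simp only [hψdef]; ring
      simp_rw [e1] at key
      rw [integral_sub j1 (j2.const_mul _), integral_const_mul, ← hc] at key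
      have e2 : ∫ t, g t = ∫ t in Ioi 0, g t :=
        (setIntegral_eq_integral_of_forall_compl_eq_zero fun t ht =>
          image_eq_zero_of_notMem_tsupport fun hm => ht (hg0 hm)).symm
      have e3 : ∫ t, g t • (N t - c) = ∫ t in Ioi 0, g t • (N t - c) :=
        (setIntegral_eq_integral_of_forall_compl_eq_zero fun t ht => by
          rw [image_eq_zero_of_notMem_tsupport fun hm => ht (hg0 hm), zero_smul]).symm
      rw [e3]
      have e4 : ∀ t, g t • (N t - c) = N t * g t - c * g t := fun t => by
        rw [smul_eq_mul]; ring
      simp_rw [e4]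
      rw [integral_sub j1 (gi.integrableOn.const_mul _), integral_const_mul, ← e2]
      linarith
  have heq : EqOn N (fun _ => c) (Ioi 0) := by
    refine Measure.eqOn_open_of_ae_eq (μ := volume) ?_ isOpen_Ioi (hNc.mono Ioi_subset_Ici_self)
      continuousOn_const
    rw [Filter.EventuallyEq, ae_restrict_iff' measurableSet_Ioi]
    filter_upwards [hae] with t ht h0
    linarith [ht h0]
  have hall : ∀ t, 0 ≤ t → N t = c := by
    intro t ht
    rcases eq_or_lt_of_le ht with h0 | h0
    · subst h0
      have h1 : Tendsto N (𝓝[>] 0) (𝓝 (N 0)) :=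
        (hNc 0 self_mem_Ici).mono_left (nhdsWithin_mono 0 Ioi_subset_Ici_self)
      refine tendsto_nhds_unique h1 (tendsto_const_nhds.congr' ?_)
      filter_upwards [self_mem_nhdsWithin] with r hr using (heq hr).symm
    · exact heq h0
  have h1 := hall s hs
  have h2 := hall t (hs.trans hst)
  have h3 := (hAd s t hst fun r hr => hs.trans hr.1).2
  rw [h3]
  simp only [hN] at h1 h2
  linarith

end

section

variable {n a b ε K : ℝ} {uin duin : ℝ → ℝ} {u ux uxx uxxx : ℝ → ℝ → ℝ}

/-- The weighted third-order dissipation at a fixed time. -/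
def mobDissip (n a b ε : ℝ) (f k : ℝ → ℝ) : ℝ :=
  ∫ x in Ioo a b, {x ∈ Ioo a b | 0 < f x}.indicator (fun x => mobility n ε (f x) * k x ^ 2) x

/-- The error in the monotonicity of `∫ ρ^ε φ`; it tends to zero when first `ε → 0` and then
`δ → 0`. -/
def monoError (a b ε K T δ : ℝ) (duin : ℝ → ℝ) : ℝ :=
  (√|Real.log ε|)⁻¹ * (energy₀ a b duin / 4 + T * energy₀ a b duin / (2 * δ) + 1 / 2 * ((b - a) * T)
      + K * (1 + supBound a b duin) * energy₀ a b duin / 4)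
    + √(2 * δ) * ((b - a) * rhoBound a b ε K duin + T * energy₀ a b duin)
    + δ * (T * energy₀ a b duin)

theorem exists_cutoff (hab : a < b) : ∃ χ : ℝ → ℝ, ContDiff ℝ (⊤ : ℕ∞) χ ∧ HasCompactSupport χ ∧
    ∀ x ∈ Ioo a b, χ x = 1 ∧ deriv χ x = 0 ∧ iteratedDeriv 2 χ x = 0 := by
  let f : ContDiffBump ((a + b) / 2) := ⟨b - a, 2 * (b - a), by linarith, by linarith⟩
  refine ⟨f, f.contDiff, f.hasCompactSupport, fun x hx => ?_⟩
  have h1 : EqOn (f : ℝ → ℝ) (fun _ => 1) (Ioo a b) := fun y hy => by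
    refine f.one_of_mem_closedBall ?_
    show dist y ((a + b) / 2) ≤ b - a
    rw [Real.dist_eq, abs_le]
    constructor <;> linarith [hy.1, hy.2]
  have h2 : EqOn (deriv (f : ℝ → ℝ)) (fun _ => 0) (Ioo a b) := fun y hy => by
    rw [(h1.eventuallyEq_of_mem (isOpen_Ioo.mem_nhds hy)).deriv_eq, deriv_const]
  refine ⟨h1 hx, h2 hx, ?_⟩
  rw [iteratedDeriv_succ, iteratedDeriv_one,
    (h2.eventuallyEq_of_mem (isOpen_Ioo.mem_nhds hx)).deriv_eq, deriv_const]

namespace Setting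

theorem integral_rho_mul_sub (hS : Setting n a b ε K uin duin u ux uxx uxxx)
    {χ : ℝ → ℝ} (hχ : ContDiff ℝ (⊤ : ℕ∞) χ) (hχc : HasCompactSupport χ) {s t : ℝ} (hs : 0 ≤ s)
    (hst : s ≤ t) :
    (∫ x in Ioo a b, rhoOf n ε u t x * χ x) - ∫ x in Ioo a b, rhoOf n ε u s x * χ x =
      ∫ r in s..t, rate n a b ε u ux uxx uxxx χ r :=
  sub_eq_integral_of_weak
    (hS.sol.continuousOn_integral_rho hS.n_pos hS.n_lt hS.eps_pos hχ.continuous)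
    (fun T => hS.integrableOn_rate T hχ)
    (fun _ h1 h2 h3 => hS.integral_rho_mul_deriv hχ hχc h1 h2 h3) hs hst

theorem dissip_intervalIntegrable (hS : Setting n a b ε K uin duin u ux uxx uxxx) {s t : ℝ}
    (hs : 0 ≤ s) (hst : s ≤ t) :
    IntervalIntegrable (fun r => dissip a b (u r) (uxx r)) volume s t :=
  (intervalIntegrable_iff_integrableOn_Ioc_of_le hst).2
    ((hS.integrableOn_dissip_time t).1.mono_set (Ioc_subset_Ioc_left hs))

/-- The total entropy increases at the rate given by the dissipation. -/
theorem integral_rho_sub (hS : Setting n a b ε K uin duin u ux uxx uxxx) {s t : ℝ} (hs : 0 ≤ s)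
    (hst : s ≤ t) :
    (∫ x in Ioo a b, rhoOf n ε u t x) - ∫ x in Ioo a b, rhoOf n ε u s x =
      ∫ r in s..t, dissip a b (u r) (uxx r) := by
  obtain ⟨χ, hχ, hχc, h1⟩ := exists_cutoff hS.lt
  have key := hS.integral_rho_mul_sub hχ hχc hs hst
  have e : ∀ t, ∫ x in Ioo a b, rhoOf n ε u t x * χ x = ∫ x in Ioo a b, rhoOf n ε u t x := fun t =>
    setIntegral_congr_fun measurableSet_Ioo fun x hx => by
      rw [(h1 x hx).1, mul_one]
  rw [e, e] at key
  rw [key, intervalIntegral.integral_of_le hst, intervalIntegral.integral_of_le hst]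
  refine setIntegral_congr_fun measurableSet_Ioc fun r hr => ?_
  have hr0 : 0 < r := lt_of_le_of_lt hs hr.1
  refine setIntegral_congr_fun measurableSet_Ioo fun x hx => ?_
  obtain ⟨g1, g2, g3⟩ := h1 x hx
  simp only [rateDensity, g1, g2, g3, mul_zero, sub_zero, mul_one]
  exact indicator_posSet_slice (fun t x => u t x * uxx t x ^ 2) hr0 x

theorem integral_rho_mono (hS : Setting n a b ε K uin duin u ux uxx uxxx) {s t : ℝ} (hs : 0 ≤ s)
    (hst : s ≤ t) : ∫ x in Ioo a b, rhoOf n ε u s x ≤ ∫ x in Ioo a b, rhoOf n ε u t x := by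
  have h1 := hS.integral_rho_sub hs hst
  have h2 := intervalIntegral.integral_nonneg (μ := volume) hst
    fun r _ => dissip_nonneg a b (u r) (uxx r)
  linarith

theorem integrableOn_mobDissip (hS : Setting n a b ε K uin duin u ux uxx uxxx) (T : ℝ) :
    IntegrableOn (fun t => mobDissip n a b ε (u t) (uxxx t)) (Ioc 0 T) ∧
      ∫ t in Ioc 0 T, mobDissip n a b ε (u t) (uxxx t) ≤
        energy₀ a b duin / (2 * |Real.log ε|) := by
  obtain ⟨h1, h2⟩ := hS.integrableOn_mobility T
  have e : ∀ t ∈ Ioc 0 T, ∫ x in Ioo a b, (posSet a b u).indicator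
      (fun z => mobility n ε (u z.1 z.2) * uxxx z.1 z.2 ^ 2) (t, x) =
        mobDissip n a b ε (u t) (uxxx t) := fun t ht => by
    simp_rw [fun x => indicator_posSet_slice (a := a) (b := b) (u := u)
      (fun t x => mobility n ε (u t x) * uxxx t x ^ 2) ht.1 x]
    rfl
  rw [IntegrableOn] at h1
  rw [restrict_prod_Ioc] at h1 h2
  rw [integral_prod _ h1, setIntegral_congr_fun measurableSet_Ioc e] at h2
  refine ⟨?_, h2⟩
  exact (integrableOn_congr_fun e measurableSet_Ioc).1 h1.integral_prod_left

theorem mobility_term_nonneg (hS : Setting n a b ε K uin duin u ux uxx uxxx) (f k : ℝ → ℝ) (x : ℝ) :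
    0 ≤ {x ∈ Ioo a b | 0 < f x}.indicator (fun x => mobility n ε (f x) * k x ^ 2) x :=
  indicator_nonneg (fun _ hx => mul_nonneg
    ((pow_nonneg hx.2.le 3).trans (cube_le_mobility n hS.eps_pos hx.2.le)) (sq_nonneg _)) x

theorem ae_neg_le_rate (hS : Setting n a b ε K uin duin u ux uxx uxxx)
    {φ : ℝ → ℝ} (hφ : ContDiff ℝ (⊤ : ℕ∞) φ) {x y : ℝ} (hx : a < x) (hxy : x ≤ y) (hy : y < b)
    (hsupp : tsupport φ ⊆ Ioo x y) {C : ℝ} (hφ0 : ∀ z, 0 ≤ φ z) (hC : ∀ z, φ z ≤ C)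
    (hC₁ : ∀ z, |deriv φ z| ≤ C) (hC₂ : ∀ z, |iteratedDeriv 2 φ z| ≤ C) {δ θ : ℝ} (hδ : 0 < δ)
    (hθ : 0 < θ) :
    ∀ᵐ t ∂(volume.restrict (Ioi (0 : ℝ))),
      -(C * ((1 / (2 * θ) + K * (1 + supBound a b duin) / (2 * θ)) *
            mobDissip n a b ε (u t) (uxxx t)
          + √(2 * δ) * dissip a b (u t) (uxx t)
          + (θ / (2 * δ) * energy₀ a b duin + √(2 * δ) * energy₀ a b duin
            + δ * energy₀ a b duin + 1 / 2 * ((b - a) * θ)))) ≤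
        rate n a b ε u ux uxx uxxx φ t := by
  have hflux : ∀ᵐ t ∂(volume.restrict (Ioi (0 : ℝ))), IntegrableOn (fun x =>
      (posSet a b u).indicator (fun z => fluxR n ε u uxxx z.1 z.2) (t, x)) (Ioo a b) := by
    refine ae_Ioi_of_forall_Ioc fun N => ?_
    have := hS.integrableOn_flux N
    rw [IntegrableOn, restrict_prod_Ioc] at this
    exact this.prod_right_ae
  have c1 : Continuous (deriv φ) := hφ.continuous_deriv (by simp)
  have c2 : Continuous (iteratedDeriv 2 φ) := hφ.continuous_iteratedDeriv 2 (by norm_cast)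
  have hC0 : 0 ≤ C := (hφ0 0).trans (hC 0)
  have hsupp1 : tsupport (deriv φ) ⊆ tsupport φ := tsupport_deriv_subset
  have hsupp2 : tsupport (iteratedDeriv 2 φ) ⊆ tsupport φ := by
    rw [iteratedDeriv_succ, iteratedDeriv_one]
    exact (tsupport_deriv_subset).trans hsupp1
  have hd1 : ∀ z, HasDerivAt φ (deriv φ z) z := fun z => (hφ.differentiable (by simp) z).hasDerivAt
  have hd2 : ∀ z, HasDerivAt (deriv φ) (iteratedDeriv 2 φ z) z := fun z => by
    rw [iteratedDeriv_succ, iteratedDeriv_one]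
    exact ((contDiff_infty_iff_deriv.1 hφ).2.differentiable (by simp) z).hasDerivAt
  filter_upwards [hS.ae_isProfile, hflux] with t ⟨ht, hP, hK3, hmob⟩ hfl
  have hprod := hP.neg_le_production hK3 hd1 hd2 c2 hx hxy hy (fun z hz =>
    ⟨image_eq_zero_of_notMem_tsupport fun hm => hz (hsupp hm),
      image_eq_zero_of_notMem_tsupport fun hm => hz (hsupp (hsupp1 hm)),
      image_eq_zero_of_notMem_tsupport fun hm => hz (hsupp (hsupp2 hm))⟩) hφ0 hC hC₁ hC₂ hδ
      (inv_pos.2 hθ)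
  have hE : ∫ x in a..b, ux t x ^ 2 ≤ energy₀ a b duin := by
    rw [intervalIntegral.integral_of_le hS.lt.le, integral_Ioc_eq_integral_Ioo]
    exact (hS.sol.ux_sq hS.lt hS.datum ht).2
  have hE0 : 0 ≤ ∫ x in a..b, ux t x ^ 2 :=
    intervalIntegral.integral_nonneg hS.lt.le fun _ _ => sq_nonneg _
  have hK3le : ∫ x in Ioo a b, {x ∈ Ioo a b | 0 < u t x}.indicator
      (fun x => u t x ^ 3 * uxxx t x ^ 2) x ≤ mobDissip n a b ε (u t) (uxxx t) := by
    refine integral_mono hK3 hmob fun x => ?_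
    refine indicator_le_indicator' fun hx => ?_
    exact mul_le_mul_of_nonneg_right (cube_le_mobility n hS.eps_pos hx.2.le) (sq_nonneg _)
  have hflC : IntegrableOn (fun x => (posSet a b u).indicator
      (fun z => fluxR n ε u uxxx z.1 z.2) (t, x) * deriv φ x) (Ioo a b) :=
    hfl.mul_bdd (c := C) c1.aestronglyMeasurable (ae_of_all _ fun z => hC₁ z)
  have hrate : rate n a b ε u ux uxx uxxx φ t =
      production a b (u t) (ux t) (uxx t) φ (deriv φ) (iteratedDeriv 2 φ) -
        ∫ x in Ioo a b, (posSet a b u).indicator (fun z => fluxR n ε u uxxx z.1 z.2) (t, x)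
          * deriv φ x := by
    rw [production, ← integral_sub (hP.production_integrable hφ.continuous c1 c2) hflC]
    refine integral_congr_ae (ae_of_all _ fun x => ?_)
    simp only [rateDensity]
    rw [indicator_posSet_slice (fun t x => u t x * uxx t x ^ 2) ht x]
  have hfluxle : ∫ x in Ioo a b, (posSet a b u).indicator
      (fun z => fluxR n ε u uxxx z.1 z.2) (t, x) * deriv φ x ≤
      C * (1 / 2 * ((b - a) * θ) + K * (1 + supBound a b duin) / (2 * θ) *
        mobDissip n a b ε (u t) (uxxx t)) := by
    have hci : IntegrableOn (fun _ : ℝ => 1 / 2 * θ) (Ioo a b) :=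
      continuous_const.integrableOn_Icc.mono_set Ioo_subset_Icc_self
    have e : ∫ x in Ioo a b, C * (1 / 2 * θ + K * (1 + supBound a b duin) / (2 * θ) *
        {x ∈ Ioo a b | 0 < u t x}.indicator (fun x => mobility n ε (u t x) * uxxx t x ^ 2) x) =
      C * (1 / 2 * ((b - a) * θ) + K * (1 + supBound a b duin) / (2 * θ) *
        mobDissip n a b ε (u t) (uxxx t)) := by
      have h1 : ∫ x in Ioo a b, K * (1 + supBound a b duin) / (2 * θ) *
          {x ∈ Ioo a b | 0 < u t x}.indicator
            (fun x => mobility n ε (u t x) * uxxx t x ^ 2) x =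
          K * (1 + supBound a b duin) / (2 * θ) * mobDissip n a b ε (u t) (uxxx t) :=
        integral_const_mul _ _
      have h2 : ∫ _x in Ioo a b, 1 / 2 * θ = 1 / 2 * ((b - a) * θ) := by
        rw [setIntegral_const, smul_eq_mul, Real.volume_real_Ioo_of_le hS.lt.le]
        ring
      rw [integral_const_mul, integral_add hci (hmob.const_mul _), h1, h2]
    rw [← e]
    refine integral_mono hflC ((hci.add (hmob.const_mul _)).const_mul C) fun x => ?_
    have hm0 := hS.mobility_term_nonneg (u t) (uxxx t) x
    have hKU : 0 ≤ K * (1 + supBound a b duin) :=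
      mul_nonneg hS.const.nonneg (by linarith [one_le_supBound hS.lt duin])
    beta_reduce
    refine (le_abs_self _).trans ?_
    rw [abs_mul, mul_comm C]
    refine mul_le_mul ?_ (hC₁ x) (abs_nonneg _) (by positivity)
    by_cases hz : (t, x) ∈ posSet a b u
    · rw [indicator_of_mem hz, indicator_of_mem
        (show x ∈ {x ∈ Ioo a b | 0 < u t x} from ⟨hz.1.2, hz.2⟩)]
      have h1 := hS.fluxR_sq_le hz
      set R := fluxR n ε u uxxx t x
      have h2 : 0 ≤ (|R| - θ) ^ 2 / (2 * θ) := by positivity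
      have h3 : (|R| - θ) ^ 2 / (2 * θ) = R ^ 2 / (2 * θ) + 1 / 2 * θ - |R| := by
        rw [← sq_abs R]
        field_simp
        ring
      have h4 : R ^ 2 / (2 * θ) ≤ K * (1 + supBound a b duin) *
        (mobility n ε (u t x) * uxxx t x ^ 2) / (2 * θ) := by gcongr
      have h5 : K * (1 + supBound a b duin) * (mobility n ε (u t x) * uxxx t x ^ 2) / (2 * θ) =
        K * (1 + supBound a b duin) / (2 * θ) * (mobility n ε (u t x) * uxxx t x ^ 2) := by ring
      linarith
    · rw [indicator_of_notMem hz, abs_zero]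
      positivity
  rw [hrate]
  have hmain : C * (θ⁻¹ / 2 * (∫ x in Ioo a b, {x ∈ Ioo a b | 0 < u t x}.indicator
          (fun x => u t x ^ 3 * uxxx t x ^ 2) x) + 1 / (2 * θ⁻¹ * δ) * (∫ x in a..b, ux t x ^ 2)
        + √(2 * δ) * (dissip a b (u t) (uxx t) + ∫ x in a..b, ux t x ^ 2)
        + δ * ∫ x in a..b, ux t x ^ 2) ≤
      C * (1 / (2 * θ) * mobDissip n a b ε (u t) (uxxx t) + θ / (2 * δ) * energy₀ a b duin
        + √(2 * δ) * (dissip a b (u t) (uxx t) + energy₀ a b duin) + δ * energy₀ a b duin) := by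
    have e1 : θ⁻¹ / 2 = 1 / (2 * θ) := by field_simp
    have e2 : 1 / (2 * θ⁻¹ * δ) = θ / (2 * δ) := by field_simp
    rw [e1, e2]
    gcongr
  calc _ = -(C * (1 / (2 * θ) * mobDissip n a b ε (u t) (uxxx t) + θ / (2 * δ) * energy₀ a b duin
        + √(2 * δ) * (dissip a b (u t) (uxx t) + energy₀ a b duin) + δ * energy₀ a b duin))
        - C * (1 / 2 * ((b - a) * θ) + K * (1 + supBound a b duin) / (2 * θ) *
        mobDissip n a b ε (u t) (uxxx t)) := by ring
    _ ≤ _ := by linarith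

/-- The quantity `∫ ρ^ε φ` is nondecreasing in time up to a small error, for every nonnegative
test function `φ` supported in `(a, b)`. -/
theorem integral_rho_mul_le (hS : Setting n a b ε K uin duin u ux uxx uxxx)
    {φ : ℝ → ℝ} (hφ : ContDiff ℝ (⊤ : ℕ∞) φ) {x y : ℝ} (hx : a < x) (hxy : x ≤ y) (hy : y < b)
    (hsupp : tsupport φ ⊆ Ioo x y) {C : ℝ} (hφ0 : ∀ z, 0 ≤ φ z) (hC : ∀ z, φ z ≤ C)
    (hC₁ : ∀ z, |deriv φ z| ≤ C) (hC₂ : ∀ z, |iteratedDeriv 2 φ z| ≤ C) {δ T : ℝ} (hδ : 0 < δ)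
    {s t : ℝ} (hs : 0 ≤ s) (hst : s ≤ t) (htT : t ≤ T) :
    ∫ x in Ioo a b, rhoOf n ε u s x * φ x ≤
      (∫ x in Ioo a b, rhoOf n ε u t x * φ x) + C * monoError a b ε K T δ duin := by
  have hφc : HasCompactSupport φ :=
    isCompact_Icc.of_isClosed_subset (isClosed_tsupport φ) (hsupp.trans Ioo_subset_Icc_self)
  have key := hS.integral_rho_mul_sub hφ hφc hs hst
  have hl := abs_log_pos hS.eps_pos hS.eps_lt
  set θ := (√|Real.log ε|)⁻¹ with hθdef
  have hθ : 0 < θ := inv_pos.2 (Real.sqrt_pos.2 hl)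
  have hθ2 : θ ^ 2 = |Real.log ε|⁻¹ := by rw [hθdef, inv_pow, Real.sq_sqrt hl.le]
  have hC0 : 0 ≤ C := (hφ0 0).trans (hC 0)
  have hT0 : 0 ≤ T := hs.trans (hst.trans htT)
  have hE := energy₀_nonneg a b duin
  have hKU : 0 ≤ K * (1 + supBound a b duin) :=
    mul_nonneg hS.const.nonneg (by linarith [one_le_supBound hS.lt duin])
  have hba : 0 < b - a := sub_pos.2 hS.lt
  set A := 1 / (2 * θ) + K * (1 + supBound a b duin) / (2 * θ) with hA
  have hA0 : 0 ≤ A := by positivity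
  set c := θ / (2 * δ) * energy₀ a b duin + √(2 * δ) * energy₀ a b duin
            + δ * energy₀ a b duin + 1 / 2 * ((b - a) * θ) with hc
  have hc0 : 0 ≤ c := by positivity
  obtain ⟨m1, m2⟩ := hS.integrableOn_mobDissip T
  obtain ⟨d1, d2⟩ := hS.integrableOn_dissip_time T
  have i1 : IntegrableOn (fun t => A * mobDissip n a b ε (u t) (uxxx t)
      + √(2 * δ) * dissip a b (u t) (uxx t)) (Ioc 0 T) := (m1.const_mul A).add (d1.const_mul _)
  have i2 : IntegrableOn (fun _ : ℝ => c) (Ioc 0 T) := integrableOn_const (by simp) (by simp)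
  have i3 : IntegrableOn (fun t => C * (A * mobDissip n a b ε (u t) (uxxx t)
      + √(2 * δ) * dissip a b (u t) (uxx t) + c)) (Ioc 0 T) := (i1.add i2).const_mul C
  have hsub : Ioc s t ⊆ Ioc 0 T := Ioc_subset_Ioc hs htT
  have hm0 : ∀ t, 0 ≤ mobDissip n a b ε (u t) (uxxx t) := fun t =>
    integral_nonneg fun x => hS.mobility_term_nonneg (u t) (uxxx t) x
  have hd0 : ∀ t, 0 ≤ dissip a b (u t) (uxx t) := fun t => dissip_nonneg a b (u t) (uxx t)
  have h1 : ∫ r in Ioc s t, C * (A * mobDissip n a b ε (u r) (uxxx r)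
      + √(2 * δ) * dissip a b (u r) (uxx r) + c) ≤ ∫ r in Ioc 0 T,
        C * (A * mobDissip n a b ε (u r) (uxxx r) + √(2 * δ) * dissip a b (u r) (uxx r) + c) := by
    refine setIntegral_mono_set i3 (ae_of_all _ fun r => ?_) hsub.eventuallyLE
    have := hm0 r
    have := hd0 r
    simp only [Pi.zero_apply]
    positivity
  have h2 : ∫ r in Ioc 0 T, C * (A * mobDissip n a b ε (u r) (uxxx r)
      + √(2 * δ) * dissip a b (u r) (uxx r) + c) ≤ C * monoError a b ε K T δ duin := by
    rw [integral_const_mul, integral_add i1 i2, integral_add (m1.const_mul A) (d1.const_mul _),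
      integral_const_mul, integral_const_mul, setIntegral_const, smul_eq_mul,
      Real.volume_real_Ioc_of_le hT0, sub_zero]
    refine mul_le_mul_of_nonneg_left ?_ hC0
    have hm2 : A * ∫ t in Ioc 0 T, mobDissip n a b ε (u t) (uxxx t) ≤
        A * (θ ^ 2 * energy₀ a b duin / 2) := by
      refine mul_le_mul_of_nonneg_left (m2.trans (le_of_eq ?_)) hA0
      rw [hθ2]; field_simp
    have hA2 : A * (θ ^ 2 * energy₀ a b duin / 2) =
        θ * (energy₀ a b duin / 4 + K * (1 + supBound a b duin) * energy₀ a b duin / 4) := by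
      rw [hA]; field_simp; ring
    have hd2 : √(2 * δ) * ∫ t in Ioc 0 T, dissip a b (u t) (uxx t) ≤
        √(2 * δ) * ((b - a) * rhoBound a b ε K duin) := by gcongr
    have e : monoError a b ε K T δ duin =
        θ * (energy₀ a b duin / 4 + K * (1 + supBound a b duin) * energy₀ a b duin / 4)
        + √(2 * δ) * ((b - a) * rhoBound a b ε K duin) + T * c := by
      rw [monoError, hc, ← hθdef]
      field_simp
      ring
    rw [e]
    linarith
  have h3 : -∫ r in Ioc s t, C * (A * mobDissip n a b ε (u r) (uxxx r)
      + √(2 * δ) * dissip a b (u r) (uxx r) + c) ≤ ∫ r in s..t, rate n a b ε u ux uxx uxxx φ r := by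
    rw [← integral_neg, intervalIntegral.integral_of_le hst]
    refine integral_mono_ae (i3.mono_set hsub).neg ((hS.integrableOn_rate T hφ).mono_set hsub) ?_
    exact ae_restrict_of_ae_restrict_of_subset (fun r hr => lt_of_le_of_lt hs hr.1)
      (hS.ae_neg_le_rate hφ hx hxy hy hsupp hφ0 hC hC₁ hC₂ hδ hθ)
  linarith

end Setting

end

section

variable {n a b ε K : ℝ} {uin duin : ℝ → ℝ} {u ux uxx uxxx : ℝ → ℝ → ℝ}

/-- A lower bound for `B^ε(s)` when `s ≥ δ`. -/
def rhoLower (ε K δ : ℝ) : ℝ := 1 - (K - Real.log δ) / |Real.log ε|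

theorem pow_seven_sub_le {f g : ℝ → ℝ} {s t c : ℝ} (hst : s ≤ t)
    (hf : IsSobolevDerivOn (Icc s t) f g)
    (hc : ∀ᵐ τ ∂(volume.restrict (Ioc s t)), c ≤ f τ ^ 6 * g τ) :
    7 * c * (t - s) ≤ f t ^ 7 - f s ^ 7 := by
  have h2 := hf.mul hf
  have h4 := h2.mul h2
  have h7 := (h4.mul h2).mul hf
  obtain ⟨hi, he⟩ := h7 s t hst Subset.rfl
  beta_reduce at hi he
  have e : ∀ x, (f x * f x * (f x * f x)) * (f x * f x) * f x = f x ^ 7 := fun x => by ring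
  rw [e, e] at he
  rw [← he, intervalIntegral.integral_of_le hst]
  have hcst : ∫ _τ in Ioc s t, 7 * c = 7 * c * (t - s) := by
    rw [setIntegral_const, smul_eq_mul, Real.volume_real_Ioc_of_le hst, mul_comm]
  rw [← hcst]
  refine integral_mono_ae (continuous_const.integrableOn_Icc.mono_set Ioc_subset_Icc_self)
    ((intervalIntegrable_iff_integrableOn_Ioc_of_le hst).1 hi) ?_
  filter_upwards [hc] with τ hτ
  nlinarith [hτ]

namespace Setting

theorem measurableSet_superlevel (hS : Setting n a b ε K uin duin u ux uxx uxxx) {t : ℝ}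
    (ht : 0 ≤ t) (δ : ℝ) : MeasurableSet {x ∈ Ioo a b | δ < u t x} :=
  (((hS.sol.continuousOn_slice ht).mono Ioo_subset_Icc_self).isOpen_inter_preimage isOpen_Ioo
    isOpen_Ioi).measurableSet

theorem rhoLower_mul_volume_le (hS : Setting n a b ε K uin duin u ux uxx uxxx) {t δ : ℝ}
    (ht : 0 ≤ t) (hδ : ε ≤ δ) :
    rhoLower ε K δ * volume.real {x ∈ Ioo a b | δ < u t x} ≤ ∫ x in Ioo a b, rhoOf n ε u t x := by
  set S := {x ∈ Ioo a b | δ < u t x}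
  have hSm : MeasurableSet S := hS.measurableSet_superlevel ht δ
  have hi := hS.sol.integrableOn_rho hS.n_pos hS.n_lt hS.eps_pos ht
  have hsub : S ⊆ Ioo a b := fun _ hx => hx.1
  have hfin : volume S ≠ ⊤ := measure_ne_top_of_subset hsub (by simp)
  calc rhoLower ε K δ * volume.real S = ∫ _x in S, rhoLower ε K δ := by
        rw [setIntegral_const, smul_eq_mul, mul_comm]
    _ ≤ ∫ x in S, rhoOf n ε u t x :=
        setIntegral_mono_on (integrableOn_const hfin (by simp)) (hi.mono_set hsub) hSm
          fun x hx => le_Beps hS.n_pos hS.n_lt hS.const hS.eps_pos hS.eps_lt hδ hx.2.le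
    _ ≤ _ := setIntegral_mono_set hi
        ((ae_restrict_mem measurableSet_Ioo).mono fun x hx =>
          hS.sol.rho_nonneg hS.eps_pos ht (Ioo_subset_Icc_self hx)) hsub.eventuallyLE

theorem one_sub_le_integral_cut (hS : Setting n a b ε K uin duin u ux uxx uxxx) {t δ : ℝ}
    (ht : 0 < t) (hδ : 0 < δ) : 1 - 2 * δ * (b - a) ≤ ∫ x in a..b, cut δ (u t x) := by
  have hc := hS.sol.continuousOn_slice ht.le
  have hu : IntervalIntegrable (u t) volume a b :=
    (hc.mono (uIcc_of_le hS.lt.le).le).intervalIntegrable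
  have hm : ∫ x in a..b, u t x = 1 := by
    rw [intervalIntegral.integral_of_le hS.lt.le, integral_Ioc_eq_integral_Ioo,
      hS.sol.mass t ht, hS.datum.mass]
  have e : ∫ x in a..b, (u t x - 2 * δ) = 1 - 2 * δ * (b - a) := by
    rw [intervalIntegral.integral_sub hu intervalIntegrable_const, hm,
      intervalIntegral.integral_const, smul_eq_mul, mul_comm (b - a)]
  rw [← e]
  refine intervalIntegral.integral_mono_on hS.lt.le (hu.sub intervalIntegrable_const) ?_
    fun x _ => sub_le_cut hδ
  exact (((continuous_cut δ).comp_continuousOn hc).mono (uIcc_of_le hS.lt.le).le).intervalIntegrable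

theorem isSobolevDerivOn_integral_rho (hS : Setting n a b ε K uin duin u ux uxx uxxx) (t : ℝ) :
    IsSobolevDerivOn (Icc 0 t) (fun τ => ∫ x in Ioo a b, rhoOf n ε u τ x)
      (fun τ => dissip a b (u τ) (uxx τ)) := fun x y hxy hsub => by
  have hx : 0 ≤ x := (hsub (left_mem_Icc.2 hxy)).1
  exact ⟨hS.dissip_intervalIntegrable hx hxy, (hS.integral_rho_sub hx hxy).symm⟩

/-- Growth of the total entropy, given a lower bound `c` for the dissipation in terms of the
measure of the superlevel set. -/
theorem growth (hS : Setting n a b ε K uin duin u ux uxx uxxx) {t δ c : ℝ} (ht : 0 ≤ t)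
    (hδ : ε ≤ δ) (hβ : 0 ≤ rhoLower ε K δ) (hδ1 : 2 * δ * (b - a) ≤ 1) (hc : 0 ≤ c)
    (h : ∀ τ ∈ Ioc 0 t, IsProfile a b (u τ) (ux τ) (uxx τ) (uxxx τ) →
      c * (∫ x in a..b, cut δ (u τ x)) ^ 3 ≤
        dissip a b (u τ) (uxx τ) * volume.real {x ∈ Ioo a b | δ < u τ x} ^ 6) :
    7 * (c * (1 - 2 * δ * (b - a)) ^ 3 * rhoLower ε K δ ^ 6) * t ≤
      (∫ x in Ioo a b, rhoOf n ε u t x) ^ 7 - (∫ x in Ioo a b, rhoOf n ε u 0 x) ^ 7 := by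
  have key := pow_seven_sub_le (c := c * (1 - 2 * δ * (b - a)) ^ 3 * rhoLower ε K δ ^ 6) ht
    (hS.isSobolevDerivOn_integral_rho t) ?_
  · rwa [sub_zero] at key
  have hP : ∀ᵐ τ ∂(volume.restrict (Ioc 0 t)), _ :=
    ae_restrict_of_ae_restrict_of_subset (fun τ hτ => hτ.1) hS.ae_isProfile
  filter_upwards [hP, ae_restrict_mem measurableSet_Ioc] with τ ⟨h0, hprof, _⟩ hτ
  have h1 := h τ hτ hprof
  have h2 := hS.one_sub_le_integral_cut h0 (hS.eps_pos.trans_le hδ)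
  have h3 := hS.rhoLower_mul_volume_le h0.le hδ
  have hd := dissip_nonneg a b (u τ) (uxx τ)
  calc c * (1 - 2 * δ * (b - a)) ^ 3 * rhoLower ε K δ ^ 6
      ≤ c * (∫ x in a..b, cut δ (u τ x)) ^ 3 * rhoLower ε K δ ^ 6 := by
        have : 0 ≤ 1 - 2 * δ * (b - a) := by linarith
        gcongr
    _ ≤ dissip a b (u τ) (uxx τ) * volume.real {x ∈ Ioo a b | δ < u τ x} ^ 6
        * rhoLower ε K δ ^ 6 := by gcongr
    _ = (rhoLower ε K δ * volume.real {x ∈ Ioo a b | δ < u τ x}) ^ 6 *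
        dissip a b (u τ) (uxx τ) := by ring
    _ ≤ _ := by gcongr

theorem growth_of_lt (hS : Setting n a b ε K uin duin u ux uxx uxxx) {t δ : ℝ} (ht : 0 ≤ t)
    (hδ : ε ≤ δ) (hβ : 0 ≤ rhoLower ε K δ) (hδ1 : 2 * δ * (b - a) ≤ 1)
    (hM : ∫ x in Ioo a b, rhoOf n ε u t x < rhoLower ε K δ * (b - a)) :
    7 * (9 * (1 - 2 * δ * (b - a)) ^ 3 * rhoLower ε K δ ^ 6) * t ≤
      (∫ x in Ioo a b, rhoOf n ε u t x) ^ 7 - (∫ x in Ioo a b, rhoOf n ε u 0 x) ^ 7 := by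
  refine hS.growth ht hδ hβ hδ1 (by norm_num) fun τ hτ hP => ?_
  obtain ⟨x, hx, hux⟩ : ∃ x ∈ Ioo a b, u τ x ≤ δ := by
    by_contra! hcon
    have h1 := hS.rhoLower_mul_volume_le hτ.1.le hδ
    have h2 : {x ∈ Ioo a b | δ < u τ x} = Ioo a b :=
      subset_antisymm (fun x hx => hx.1) fun x hx => ⟨hx, hcon x hx⟩
    rw [h2, Real.volume_real_Ioo_of_le hS.lt.le] at h1
    exact absurd (h1.trans (hS.integral_rho_mono hτ.1.le hτ.2)) (not_le.2 hM)
  exact hP.cube_le_of_exists (hS.eps_pos.trans_le hδ) (Ioo_subset_Icc_self hx) hux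

theorem growth_of_endpoints (hS : Setting n a b ε K uin duin u ux uxx uxxx) {t δ : ℝ} (ht : 0 ≤ t)
    (hδ : ε ≤ δ) (hβ : 0 ≤ rhoLower ε K δ) (hδ1 : 2 * δ * (b - a) ≤ 1)
    (hM : ∀ τ ∈ Ioc 0 t, u τ a ≤ δ ∧ u τ b ≤ δ) :
    7 * (144 * (1 - 2 * δ * (b - a)) ^ 3 * rhoLower ε K δ ^ 6) * t ≤
      (∫ x in Ioo a b, rhoOf n ε u t x) ^ 7 - (∫ x in Ioo a b, rhoOf n ε u 0 x) ^ 7 :=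
  hS.growth ht hδ hβ hδ1 (by norm_num) fun τ hτ hP =>
    hP.cube_le_of_endpoints (hS.eps_pos.trans_le hδ) (hM τ hτ).1 (hM τ hτ).2

end Setting

end

section

/-- Smooth approximations of the indicator function of the interval `(p, q)`. -/
def bump (p q : ℝ) (m : ℕ) (x : ℝ) : ℝ :=
  Real.smoothTransition (m * (x - p)) * Real.smoothTransition (m * (q - x))

theorem contDiff_bump (p q : ℝ) (m : ℕ) : ContDiff ℝ (⊤ : ℕ∞) (bump p q m) :=
  (Real.smoothTransition.contDiff.comp (contDiff_const.mul (contDiff_id.sub contDiff_const))).mul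
    (Real.smoothTransition.contDiff.comp (contDiff_const.mul (contDiff_const.sub contDiff_id)))

theorem bump_nonneg (p q : ℝ) (m : ℕ) (x : ℝ) : 0 ≤ bump p q m x :=
  mul_nonneg (Real.smoothTransition.nonneg _) (Real.smoothTransition.nonneg _)

theorem bump_le_one (p q : ℝ) (m : ℕ) (x : ℝ) : bump p q m x ≤ 1 :=
  mul_le_one₀ (Real.smoothTransition.le_one _) (Real.smoothTransition.nonneg _)
    (Real.smoothTransition.le_one _)

theorem bump_eq_zero {p q : ℝ} (m : ℕ) {x : ℝ} (hx : x ∉ Ioo p q) : bump p q m x = 0 := by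
  have hm : (0 : ℝ) ≤ m := Nat.cast_nonneg m
  rw [bump]
  by_cases h : x ≤ p
  · rw [Real.smoothTransition.zero_of_nonpos (mul_nonpos_of_nonneg_of_nonpos hm (by linarith)),
      zero_mul]
  · have h' : q ≤ x := by
      by_contra hc
      exact hx ⟨not_le.1 h, not_le.1 hc⟩
    rw [Real.smoothTransition.zero_of_nonpos (x := m * (q - x))
      (mul_nonpos_of_nonneg_of_nonpos hm (by linarith)), mul_zero]

theorem tsupport_bump_subset (p q : ℝ) (m : ℕ) : tsupport (bump p q m) ⊆ Icc p q :=
  closure_minimal (fun x hx => by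
    by_contra hc
    exact hx (bump_eq_zero m fun h => hc (Ioo_subset_Icc_self h))) isClosed_Icc

theorem hasCompactSupport_bump (p q : ℝ) (m : ℕ) : HasCompactSupport (bump p q m) :=
  isCompact_Icc.of_isClosed_subset (isClosed_tsupport _) (tsupport_bump_subset p q m)

theorem exists_derivBound_bump (p q : ℝ) (m : ℕ) : ∃ C : ℝ, 1 ≤ C ∧
    ∀ x, |deriv (bump p q m) x| ≤ C ∧ |iteratedDeriv 2 (bump p q m) x| ≤ C := by
  have h := contDiff_bump p q m
  have hc := hasCompactSupport_bump p q m
  obtain ⟨C₁, h₁⟩ := hc.deriv.exists_bound_of_continuous (h.continuous_deriv (by simp))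
  have hc2 : HasCompactSupport (iteratedDeriv 2 (bump p q m)) := by
    rw [iteratedDeriv_succ, iteratedDeriv_one]
    exact hc.deriv.deriv
  obtain ⟨C₂, h₂⟩ := hc2.exists_bound_of_continuous (h.continuous_iteratedDeriv 2 (by norm_cast))
  exact ⟨max 1 (max C₁ C₂), le_max_left _ _, fun x =>
    ⟨(h₁ x).trans ((le_max_left _ _).trans (le_max_right _ _)),
      (h₂ x).trans ((le_max_right _ _).trans (le_max_right _ _))⟩⟩

/-- The indicator function of `(c, d)` is a pointwise limit of bumps with rational parameters. -/
theorem exists_tendsto_bump (c d : ℝ) : ∃ p q : ℕ → ℚ,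
    (∀ m, c < p m ∧ (q m : ℝ) < d) ∧
      ∀ x, Tendsto (fun m => bump (p m) (q m) m x) atTop
        (𝓝 ((Ioo c d).indicator (fun _ => (1 : ℝ)) x)) := by
  have hpos : ∀ m : ℕ, (0 : ℝ) < 1 / ((m : ℝ) + 1) := fun m => Nat.one_div_pos_of_nat
  choose p hp1 hp2 using fun m : ℕ => exists_rat_btwn (lt_add_of_pos_right c (hpos m))
  choose q hq1 hq2 using fun m : ℕ => exists_rat_btwn (sub_lt_self d (hpos m))
  refine ⟨p, q, fun m => ⟨hp1 m, hq2 m⟩, fun x => ?_⟩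
  have h0 := tendsto_one_div_add_atTop_nhds_zero_nat (𝕜 := ℝ)
  have hpc : Tendsto (fun m => (p m : ℝ)) atTop (𝓝 c) :=
    tendsto_of_tendsto_of_tendsto_of_le_of_le tendsto_const_nhds (by simpa using h0.const_add c)
      (fun m => (hp1 m).le) fun m => (hp2 m).le
  have hqd : Tendsto (fun m => (q m : ℝ)) atTop (𝓝 d) :=
    tendsto_of_tendsto_of_tendsto_of_le_of_le (by simpa using h0.const_sub d) tendsto_const_nhds
      (fun m => (hq1 m).le) fun m => (hq2 m).le
  by_cases hx : x ∈ Ioo c d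
  · rw [indicator_of_mem hx]
    have h1 : Tendsto (fun m : ℕ => (m : ℝ) * (x - p m)) atTop atTop :=
      tendsto_natCast_atTop_atTop.atTop_mul_pos (sub_pos.2 hx.1) (hpc.const_sub x)
    have h2 : Tendsto (fun m : ℕ => (m : ℝ) * (q m - x)) atTop atTop :=
      tendsto_natCast_atTop_atTop.atTop_mul_pos (sub_pos.2 hx.2) (hqd.sub_const x)
    refine tendsto_const_nhds.congr' ?_
    filter_upwards [h1.eventually_ge_atTop 1, h2.eventually_ge_atTop 1] with m hm1 hm2
    rw [bump, Real.smoothTransition.one_of_one_le hm1, Real.smoothTransition.one_of_one_le hm2,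
      mul_one]
  · rw [indicator_of_notMem hx]
    refine tendsto_const_nhds.congr fun m => (bump_eq_zero m fun h => hx ?_).symm
    exact ⟨(hp1 m).trans h.1, h.2.trans (hq2 m)⟩

theorem tendsto_integral_mul_bump {a b c d : ℝ} (hac : a ≤ c) (hdb : d ≤ b) {p q : ℕ → ℝ}
    (h : ∀ x, Tendsto (fun m => bump (p m) (q m) m x) atTop
        (𝓝 ((Ioo c d).indicator (fun _ => (1 : ℝ)) x))) {f : ℝ → ℝ}
    (hf : IntegrableOn f (Ioo a b)) :
    Tendsto (fun m => ∫ x in Ioo a b, f x * bump (p m) (q m) m x) atTop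
      (𝓝 (∫ x in Ioo c d, f x)) := by
  have e : ∫ x in Ioo c d, f x =
      ∫ x in Ioo a b, f x * (Ioo c d).indicator (fun _ => (1 : ℝ)) x := by
    rw [← inter_eq_self_of_subset_right (Ioo_subset_Ioo hac hdb),
      ← setIntegral_indicator measurableSet_Ioo,
      inter_eq_self_of_subset_right (Ioo_subset_Ioo hac hdb)]
    refine integral_congr_ae (ae_of_all _ fun x => ?_)
    by_cases hx : x ∈ Ioo c d <;> simp [hx]
  rw [e]
  refine tendsto_integral_of_dominated_convergence (fun x => |f x|) (fun m => ?_) hf.abs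
    (fun m => ae_of_all _ fun x => ?_) (ae_of_all _ fun x => (h x).const_mul _)
  · exact hf.aestronglyMeasurable.mul (contDiff_bump _ _ m).continuous.aestronglyMeasurable
  · rw [Real.norm_eq_abs, abs_mul, abs_of_nonneg (bump_nonneg _ _ _ _)]
    exact mul_le_of_le_one_right (abs_nonneg _) (bump_le_one _ _ _ _)

/-- `f` is the limit of `R k`, tested against bumps. -/
structure IsBumpLimit (a b : ℝ) (R : ℕ → ℝ → ℝ) (f : ℝ → ℝ) : Prop where
  integrable : IntegrableOn f (Ioo a b)
  tendsto : ∀ (p q : ℚ) (m : ℕ), a < p → (q : ℝ) < b →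
    Tendsto (fun k => ∫ x in Ioo a b, R k x * bump p q m x) atTop
      (𝓝 (∫ x in Ioo a b, f x * bump p q m x))

theorem IsBumpLimit.tendsto_integral_Ioo {a b : ℝ} {R : ℕ → ℝ → ℝ} {f : ℝ → ℝ}
    (h : IsBumpLimit a b R f) (hR : ∀ k, IntegrableOn (R k) (Ioo a b)) {C : ℝ}
    (hC : ∀ᶠ k in atTop, ∀ x ∈ Ioo a b, |R k x| ≤ C) {c d : ℝ} (hac : a ≤ c) (hcd : c ≤ d)
    (hdb : d ≤ b) :
    Tendsto (fun k => ∫ x in Ioo c d, R k x) atTop (𝓝 (∫ x in Ioo c d, f x)) := by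
  rcases hcd.eq_or_lt with rfl | hcd
  · simp
  obtain ⟨p, q, hpq, hb⟩ := exists_tendsto_bump c d
  set χ : ℝ → ℝ := (Ioo c d).indicator (fun _ => (1 : ℝ)) with hχ
  have hχm : AEStronglyMeasurable χ (volume.restrict (Ioo a b)) :=
    (measurable_const.indicator measurableSet_Ioo).aestronglyMeasurable
  have hχ1 : ∀ x, ‖χ x‖ ≤ 1 := fun x => by
    by_cases hx : x ∈ Ioo c d <;> simp [hχ, hx]
  have e : ∀ g : ℝ → ℝ, ∫ x in Ioo c d, g x = ∫ x in Ioo a b, g x * χ x := fun g => by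
    rw [← inter_eq_self_of_subset_right (Ioo_subset_Ioo hac hdb),
      ← setIntegral_indicator measurableSet_Ioo]
    refine integral_congr_ae (ae_of_all _ fun x => ?_)
    by_cases hx : x ∈ Ioo c d <;> simp [hχ, hx]
  have hint : IntegrableOn (fun x => |C| + |f x|) (Ioo a b) :=
    (integrableOn_const (by simp) (by simp)).add h.integrable.abs
  have hlim : Tendsto (fun m => ∫ x in Ioo a b, (|C| + |f x|) * |χ x - bump (p m) (q m) m x|)
      atTop (𝓝 0) := by
    have e0 : (0 : ℝ) = ∫ x in Ioo a b, (|C| + |f x|) * 0 := by simp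
    rw [e0]
    refine tendsto_integral_of_dominated_convergence (fun x => (|C| + |f x|) * 2) (fun m => ?_)
      (hint.mul_const 2) (fun m => ae_of_all _ fun x => ?_) (ae_of_all _ fun x => ?_)
    · exact hint.aestronglyMeasurable.mul
        (hχm.sub (contDiff_bump _ _ m).continuous.aestronglyMeasurable).norm
    · rw [norm_mul, Real.norm_eq_abs, Real.norm_eq_abs, abs_abs, abs_of_nonneg (by positivity)]
      gcongr
      refine (abs_sub _ _).trans ?_
      rw [abs_of_nonneg (bump_nonneg _ _ _ _)]
      linarith [hχ1 x, Real.norm_eq_abs (χ x), bump_le_one (p m) (q m) m x]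
    · have := ((hb x).const_sub (χ x)).abs
      rw [sub_self, abs_zero] at this
      exact this.const_mul _
  rw [Metric.tendsto_atTop]
  intro η hη
  obtain ⟨m, hm⟩ := (hlim.eventually (gt_mem_nhds (half_pos hη))).exists
  have hφc := (contDiff_bump (p m) (q m) m).continuous
  have h2 := (h.tendsto (p m) (q m) m (hac.trans_lt (hpq m).1) ((hpq m).2.trans_le hdb))
  rw [Metric.tendsto_atTop] at h2
  obtain ⟨N₁, hN₁⟩ := h2 _ (half_pos hη)
  obtain ⟨N₂, hN₂⟩ := eventually_atTop.1 hC
  refine ⟨max N₁ N₂, fun k hk => ?_⟩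
  have k1 := hN₁ k ((le_max_left _ _).trans hk)
  have k2 := hN₂ k ((le_max_right _ _).trans hk)
  have mb : ∀ g : ℝ → ℝ, IntegrableOn g (Ioo a b) →
      IntegrableOn (fun x => g x * bump (p m) (q m) m x) (Ioo a b) := fun g hg =>
    hg.mul_bdd (c := 1) hφc.aestronglyMeasurable (ae_of_all _ fun x => by
      rw [Real.norm_eq_abs, abs_of_nonneg (bump_nonneg _ _ _ _)]; exact bump_le_one _ _ _ _)
  have mχ : ∀ g : ℝ → ℝ, IntegrableOn g (Ioo a b) →
      IntegrableOn (fun x => g x * χ x) (Ioo a b) := fun g hg =>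
    hg.mul_bdd (c := 1) hχm (ae_of_all _ hχ1)
  rw [Real.dist_eq] at k1 ⊢
  rw [e, e]
  have hsplit : (∫ x in Ioo a b, R k x * χ x) - ∫ x in Ioo a b, f x * χ x =
      ((∫ x in Ioo a b, R k x * bump (p m) (q m) m x)
        - ∫ x in Ioo a b, f x * bump (p m) (q m) m x) +
      ∫ x in Ioo a b, (R k x - f x) * (χ x - bump (p m) (q m) m x) := by
    have i1 := mχ _ (hR k)
    have i2 := mχ _ h.integrable
    have i3 := mb _ (hR k)
    have i4 := mb _ h.integrable
    have i5 : IntegrableOn (fun x => R k x * bump (p m) (q m) m x - f x * bump (p m) (q m) m x)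
        (Ioo a b) := i3.sub i4
    have i6 : IntegrableOn (fun x => (R k x - f x) * (χ x - bump (p m) (q m) m x)) (Ioo a b) := by
      refine ((i1.sub i2).sub i5).congr (ae_of_all _ fun x => ?_)
      simp only [Pi.sub_apply]
      ring
    rw [← integral_sub i1 i2, ← integral_sub i3 i4, ← integral_add i5 i6]
    refine integral_congr_ae (ae_of_all _ fun x => ?_)
    ring
  rw [hsplit]
  have hrest : |∫ x in Ioo a b, (R k x - f x) * (χ x - bump (p m) (q m) m x)| ≤
      ∫ x in Ioo a b, (|C| + |f x|) * |χ x - bump (p m) (q m) m x| := by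
    refine norm_integral_le_of_norm_le (f := fun x => (R k x - f x) * (χ x - bump (p m) (q m) m x))
      ?_ ?_
    · refine ((mχ _ hint).sub (mb _ hint)).norm.congr (ae_of_all _ fun x => ?_)
      simp only [Pi.sub_apply]
      rw [← mul_sub, norm_mul, Real.norm_eq_abs, Real.norm_eq_abs,
        abs_of_nonneg (by positivity : 0 ≤ |C| + |f x|)]
    · filter_upwards [ae_restrict_mem measurableSet_Ioo] with x hx
      rw [Real.norm_eq_abs, abs_mul]
      gcongr
      exact (abs_sub _ _).trans (by linarith [k2 x hx, le_abs_self C])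
  calc _ ≤ _ := abs_add_le _ _
    _ < η / 2 + η / 2 := by linarith
    _ = η := by ring

theorem ae_nonneg_of_forall_interval {a b : ℝ} {f : ℝ → ℝ} (hf : IntegrableOn f (Ioo a b))
    (h : ∀ c d, a ≤ c → c ≤ d → d ≤ b → 0 ≤ ∫ x in Ioo c d, f x) :
    ∀ᵐ x ∂(volume.restrict (Ioo a b)), 0 ≤ f x := by
  rcases le_or_gt b a with hab | hab
  · simp [Ioo_eq_empty (not_lt.2 hab)]
  have hfi : IntegrableOn f (Icc a b) := (integrableOn_Icc_iff_integrableOn_Ioo (by simp) (by simp)).2 hf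
  have hsob : IsSobolevDerivOn (Icc a b) (fun x => ∫ y in a..x, f y) f := fun x y hxy hsub => by
    have hx := hsub (left_mem_Icc.2 hxy)
    have hy := hsub (right_mem_Icc.2 hxy)
    have ii : ∀ {u v : ℝ}, u ∈ Icc a b → v ∈ Icc a b → IntervalIntegrable f volume u v :=
      fun hu hv => (hfi.mono_set (uIcc_subset_Icc hu hv)).intervalIntegrable
    have ha : a ∈ Icc a b := left_mem_Icc.2 hab.le
    exact ⟨ii hx hy, (intervalIntegral.integral_interval_sub_left (ii ha hy) (ii ha hx)).symm⟩
  have hmono : MonotoneOn (fun x => ∫ y in a..x, f y) (Icc a b) := fun x hx y hy hxy => by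
    have h1 := (hsob x y hxy (Icc_subset_Icc hx.1 hy.2)).2
    have h2 := h x y hx.1 hxy hy.2
    rw [intervalIntegral.integral_of_le hxy, integral_Ioc_eq_integral_Ioo] at h1
    beta_reduce at h1 ⊢
    linarith
  rw [ae_restrict_iff' measurableSet_Ioo]
  filter_upwards [hsob.ae_hasDerivAt hab.le Subset.rfl] with x hx hxI
  have h1 := hasDerivAt_iff_tendsto_slope.1 (hx hxI)
  refine ge_of_tendsto h1 ?_
  filter_upwards [self_mem_nhdsWithin, mem_nhdsWithin_of_mem_nhds (Icc_mem_nhds hxI.1 hxI.2)]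
    with y hy hyI
  exact hmono.slope_nonneg (Ioo_subset_Icc_self hxI) hyI

end

section

/-- A sequence of solutions with `ε → 0`. -/
structure SettingSeq (n a b K : ℝ) (uin duin : ℝ → ℝ) (ε : ℕ → ℝ) (u ux uxx uxxx : ℕ → ℝ → ℝ → ℝ) :
    Prop where
  setting : ∀ k, Setting n a b (ε k) K uin duin (u k) (ux k) (uxx k) (uxxx k)
  tendsto : Tendsto ε atTop (𝓝 0)

namespace SettingSeq

variable {n a b K : ℝ} {uin duin : ℝ → ℝ} {ε : ℕ → ℝ} {u ux uxx uxxx : ℕ → ℝ → ℝ → ℝ}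

theorem comp (hS : SettingSeq n a b K uin duin ε u ux uxx uxxx) {σ : ℕ → ℕ}
    (hσ : Tendsto σ atTop atTop) :
    SettingSeq n a b K uin duin (ε ∘ σ) (u ∘ σ) (ux ∘ σ) (uxx ∘ σ) (uxxx ∘ σ) :=
  ⟨fun k => hS.setting (σ k), hS.tendsto.comp hσ⟩

theorem lt (hS : SettingSeq n a b K uin duin ε u ux uxx uxxx) : a < b := (hS.setting 0).lt

theorem tendsto_abs_log (hS : SettingSeq n a b K uin duin ε u ux uxx uxxx) :
    Tendsto (fun k => |Real.log (ε k)|) atTop atTop :=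
  tendsto_abs_atBot_atTop.comp (Real.tendsto_log_nhdsGT_zero.comp
    (tendsto_nhdsWithin_iff.2 ⟨hS.tendsto, Eventually.of_forall fun k => (hS.setting k).eps_pos⟩))

theorem tendsto_div_log (hS : SettingSeq n a b K uin duin ε u ux uxx uxxx) (c : ℝ) :
    Tendsto (fun k => c / |Real.log (ε k)|) atTop (𝓝 0) :=
  hS.tendsto_abs_log.const_div_atTop c

theorem tendsto_rhoBound (hS : SettingSeq n a b K uin duin ε u ux uxx uxxx) :
    Tendsto (fun k => rhoBound a b (ε k) K duin) atTop (𝓝 1) := by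
  simpa [rhoBound] using (hS.tendsto_div_log (Real.log (supBound a b duin) + K)).const_add 1

theorem tendsto_rhoLower (hS : SettingSeq n a b K uin duin ε u ux uxx uxxx) (δ : ℝ) :
    Tendsto (fun k => rhoLower (ε k) K δ) atTop (𝓝 1) := by
  simpa [rhoLower] using (hS.tendsto_div_log (K - Real.log δ)).const_sub 1

theorem exists_monoError_le (hS : SettingSeq n a b K uin duin ε u ux uxx uxxx) (T : ℝ) {η : ℝ}
    (hη : 0 < η) : ∃ δ > 0, ∀ᶠ k in atTop, monoError a b (ε k) K T δ duin ≤ η := by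
  have h1 : Tendsto (fun δ : ℝ => √(2 * δ) * ((b - a) * 1 + T * energy₀ a b duin)
      + δ * (T * energy₀ a b duin)) (𝓝[>] 0) (𝓝 0) := by
    have : Continuous (fun δ : ℝ => √(2 * δ) * ((b - a) * 1 + T * energy₀ a b duin)
      + δ * (T * energy₀ a b duin)) := by fun_prop
    have h := this.tendsto 0
    simp only [mul_zero, Real.sqrt_zero, zero_mul, add_zero] at h
    exact h.mono_left nhdsWithin_le_nhds
  obtain ⟨δ, hδη, hδ⟩ := ((h1.eventually (gt_mem_nhds hη)).and self_mem_nhdsWithin).exists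
  refine ⟨δ, hδ, ?_⟩
  have h2 : Tendsto (fun k => (√|Real.log (ε k)|)⁻¹) atTop (𝓝 0) :=
    tendsto_inv_atTop_zero.comp (Real.tendsto_sqrt_atTop.comp hS.tendsto_abs_log)
  have h3 := ((h2.mul_const (energy₀ a b duin / 4 + T * energy₀ a b duin / (2 * δ)
      + 1 / 2 * ((b - a) * T) + K * (1 + supBound a b duin) * energy₀ a b duin / 4)).add
    (((hS.tendsto_rhoBound.const_mul (b - a)).add_const (T * energy₀ a b duin)).const_mul
      (√(2 * δ)))).add_const (δ * (T * energy₀ a b duin))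
  rw [zero_mul, zero_add] at h3
  exact (h3.eventually (gt_mem_nhds hδη)).mono fun k hk => hk.le

theorem eventually_abs_rho_le (hS : SettingSeq n a b K uin duin ε u ux uxx uxxx) {t : ℝ}
    (ht : 0 ≤ t) : ∀ᶠ k in atTop, ∀ x ∈ Ioo a b, |rhoOf n (ε k) (u k) t x| ≤ 2 := by
  filter_upwards [hS.tendsto_rhoBound.eventually (gt_mem_nhds (by norm_num : (1 : ℝ) < 2))]
    with k hk x hx
  have h := hS.setting k
  rw [abs_of_nonneg (h.sol.rho_nonneg h.eps_pos ht (Ioo_subset_Icc_self hx))]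
  exact (h.sol.rho_le h.lt h.datum h.n_pos h.n_lt h.const h.eps_pos h.eps_lt ht
    (Ioo_subset_Icc_self hx)).trans hk.le

section limit

variable {f g : ℝ → ℝ} {s t : ℝ}

theorem tendsto_integral_Ioo (hS : SettingSeq n a b K uin duin ε u ux uxx uxxx) (ht : 0 ≤ t)
    (hf : IsBumpLimit a b (fun k => rhoOf n (ε k) (u k) t) f) {c d : ℝ} (hac : a ≤ c)
    (hcd : c ≤ d) (hdb : d ≤ b) :
    Tendsto (fun k => ∫ x in Ioo c d, rhoOf n (ε k) (u k) t x) atTop (𝓝 (∫ x in Ioo c d, f x)) :=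
  hf.tendsto_integral_Ioo (fun k => (hS.setting k).sol.integrableOn_rho (hS.setting k).n_pos
    (hS.setting k).n_lt (hS.setting k).eps_pos ht) (hS.eventually_abs_rho_le ht) hac hcd hdb

theorem ae_nonneg (hS : SettingSeq n a b K uin duin ε u ux uxx uxxx) (ht : 0 ≤ t)
    (hf : IsBumpLimit a b (fun k => rhoOf n (ε k) (u k) t) f) :
    ∀ᵐ x ∂(volume.restrict (Ioo a b)), 0 ≤ f x :=
  ae_nonneg_of_forall_interval hf.integrable fun _ _ hac hcd hdb =>
    ge_of_tendsto' (hS.tendsto_integral_Ioo ht hf hac hcd hdb) fun k =>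
      setIntegral_nonneg measurableSet_Ioo fun _ hx => (hS.setting k).sol.rho_nonneg
        (hS.setting k).eps_pos ht (Icc_subset_Icc hac hdb (Ioo_subset_Icc_self hx))

theorem ae_le_one (hS : SettingSeq n a b K uin duin ε u ux uxx uxxx) (ht : 0 ≤ t)
    (hf : IsBumpLimit a b (fun k => rhoOf n (ε k) (u k) t) f) :
    ∀ᵐ x ∂(volume.restrict (Ioo a b)), f x ≤ 1 := by
  have hc1 : IntegrableOn (fun _ : ℝ => (1 : ℝ)) (Ioo a b) := integrableOn_const (by simp) (by simp)
  have key := ae_nonneg_of_forall_interval (hc1.sub hf.integrable) fun c d hac hcd hdb => by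
    have hsub : Ioo c d ⊆ Ioo a b := Ioo_subset_Ioo hac hdb
    have h1 := hS.tendsto_integral_Ioo ht hf hac hcd hdb
    have h2 := le_of_tendsto_of_tendsto' h1 (hS.tendsto_rhoBound.const_mul (d - c)) fun k => by
      have h := hS.setting k
      calc ∫ x in Ioo c d, rhoOf n (ε k) (u k) t x
          ≤ ∫ _x in Ioo c d, rhoBound a b (ε k) K duin :=
            setIntegral_mono_on
              ((h.sol.integrableOn_rho h.n_pos h.n_lt h.eps_pos ht).mono_set hsub)
              (integrableOn_const (by simp) (by simp)) measurableSet_Ioo fun x hx =>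
                h.sol.rho_le h.lt h.datum h.n_pos h.n_lt h.const h.eps_pos h.eps_lt ht
                  (Ioo_subset_Icc_self (hsub hx))
        _ = _ := by rw [setIntegral_const, smul_eq_mul, Real.volume_real_Ioo_of_le hcd]
    have h3 := integral_sub (hc1.mono_set hsub) (hf.integrable.mono_set hsub)
    simp only [Pi.sub_apply]
    rw [h3, setIntegral_const, smul_eq_mul, Real.volume_real_Ioo_of_le hcd]
    linarith
  filter_upwards [key] with x hx
  simpa using hx

theorem integral_mul_bump_le (hS : SettingSeq n a b K uin duin ε u ux uxx uxxx) (hs : 0 ≤ s)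
    (hst : s ≤ t) (hf : IsBumpLimit a b (fun k => rhoOf n (ε k) (u k) s) f)
    (hg : IsBumpLimit a b (fun k => rhoOf n (ε k) (u k) t) g) {p q : ℚ} (m : ℕ) (hp : a < p)
    (hq : (q : ℝ) < b) :
    ∫ x in Ioo a b, f x * bump p q m x ≤ ∫ x in Ioo a b, g x * bump p q m x := by
  rcases lt_or_ge (q : ℝ) p with hqp | hpq
  · have : ∀ x, bump p q m x = 0 := fun x => bump_eq_zero m fun h =>
      absurd (h.1.trans h.2) (not_lt.2 hqp.le)
    simp [this]
  obtain ⟨C, hC1, hC⟩ := exists_derivBound_bump p q m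
  obtain ⟨x, hx1, hx2⟩ := exists_between hp
  obtain ⟨y, hy1, hy2⟩ := exists_between hq
  refine le_of_forall_pos_le_add fun η hη => ?_
  obtain ⟨δ, hδ, hev⟩ := hS.exists_monoError_le t (div_pos hη (zero_lt_one.trans_le hC1))
  refine le_of_tendsto_of_tendsto (hf.tendsto p q m hp hq)
    ((hg.tendsto p q m hp hq).add_const η) ?_
  filter_upwards [hev] with k hk
  have h := (hS.setting k).integral_rho_mul_le (contDiff_bump p q m) hx1
    (hx2.le.trans (hpq.trans hy1.le)) hy2
    ((tsupport_bump_subset p q m).trans (Icc_subset_Ioo hx2 hy1)) (bump_nonneg _ _ _)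
    (fun z => (bump_le_one _ _ _ z).trans hC1) (fun z => (hC z).1) (fun z => (hC z).2) hδ hs hst
    le_rfl
  have h2 : C * monoError a b (ε k) K t δ duin ≤ η := by
    have := mul_le_mul_of_nonneg_left hk (zero_le_one.trans hC1)
    rwa [mul_div_cancel₀ _ (by positivity)] at this
  linarith

/-- The limits are nondecreasing in time. -/
theorem ae_le_of_le (hS : SettingSeq n a b K uin duin ε u ux uxx uxxx) (hs : 0 ≤ s)
    (hst : s ≤ t) (hf : IsBumpLimit a b (fun k => rhoOf n (ε k) (u k) s) f)
    (hg : IsBumpLimit a b (fun k => rhoOf n (ε k) (u k) t) g) :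
    f ≤ᵐ[volume.restrict (Ioo a b)] g := by
  have key := ae_nonneg_of_forall_interval (hg.integrable.sub hf.integrable)
    fun c d hac hcd hdb => by
      have hsub : Ioo c d ⊆ Ioo a b := Ioo_subset_Ioo hac hdb
      obtain ⟨p, q, hpq, hb⟩ := exists_tendsto_bump c d
      have h1 := le_of_tendsto_of_tendsto' (tendsto_integral_mul_bump hac hdb hb hf.integrable)
        (tendsto_integral_mul_bump hac hdb hb hg.integrable) fun m =>
          hS.integral_mul_bump_le hs hst hf hg m (hac.trans_lt (hpq m).1)
            ((hpq m).2.trans_le hdb)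
      have h3 := integral_sub (hg.integrable.mono_set hsub) (hf.integrable.mono_set hsub)
      simp only [Pi.sub_apply]
      rw [h3]
      linarith
  filter_upwards [key] with x hx
  simpa using hx

theorem isBumpLimit_zero (hS : SettingSeq n a b K uin duin ε u ux uxx uxxx) :
    IsBumpLimit a b (fun k => rhoOf n (ε k) (u k) 0)
      ({x | 0 < uin x}.indicator fun _ => (1 : ℝ)) := by
  have huc : ContinuousOn uin (Icc a b) :=
    ((hS.setting 0).sol.continuousOn_slice le_rfl).congr fun x hx =>
      ((hS.setting 0).sol.initial x hx).symm
  have hpt : ∀ x ∈ Ioo a b, Tendsto (fun k => rhoOf n (ε k) (u k) 0 x) atTop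
      (𝓝 ({x | 0 < uin x}.indicator (fun _ => (1 : ℝ)) x)) := fun x hx => by
    have hx' := Ioo_subset_Icc_self hx
    have e : ∀ k, rhoOf n (ε k) (u k) 0 x = Beps n (ε k) (uin x) := fun k => by
      rw [rhoOf, (hS.setting k).sol.initial x hx']
    rcases ((hS.setting 0).datum.nonneg x hx').eq_or_lt with h0 | h0
    · rw [indicator_of_notMem (by simp [← h0])]
      refine tendsto_of_tendsto_of_tendsto_of_le_of_le tendsto_const_nhds (hS.tendsto_div_log K)
        (fun k => ?_) fun k => ?_
      · exact (hS.setting k).sol.rho_nonneg (hS.setting k).eps_pos le_rfl hx'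
      · have h := hS.setting k
        beta_reduce
        rw [e, ← h0]
        exact Beps_le_of_le h.n_pos h.n_lt h.const h.eps_pos le_rfl h.eps_pos.le
    · rw [indicator_of_mem (by exact h0)]
      refine tendsto_of_tendsto_of_tendsto_of_le_of_le' (hS.tendsto_rhoLower (uin x))
        hS.tendsto_rhoBound ?_ (Eventually.of_forall fun k => ?_)
      · filter_upwards [hS.tendsto.eventually (gt_mem_nhds h0)] with k hk
        have h := hS.setting k
        rw [e]
        exact le_Beps h.n_pos h.n_lt h.const h.eps_pos h.eps_lt hk.le le_rfl
      · have h := hS.setting k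
        exact h.sol.rho_le h.lt h.datum h.n_pos h.n_lt h.const h.eps_pos h.eps_lt le_rfl hx'
  have hm : ∀ k, AEStronglyMeasurable (rhoOf n (ε k) (u k) 0) (volume.restrict (Ioo a b)) :=
    fun k => ((hS.setting k).sol.integrableOn_rho (hS.setting k).n_pos
      (hS.setting k).n_lt (hS.setting k).eps_pos le_rfl).aestronglyMeasurable
  have hχ : AEStronglyMeasurable ({x | 0 < uin x}.indicator fun _ => (1 : ℝ))
      (volume.restrict (Ioo a b)) :=
    aestronglyMeasurable_of_tendsto_ae atTop hm
      ((ae_restrict_mem measurableSet_Ioo).mono hpt)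
  refine ⟨?_, fun p q m _ _ => ?_⟩
  · have hc1 : IntegrableOn (fun _ : ℝ => (1 : ℝ)) (Ioo a b) :=
      integrableOn_const (by simp) (by simp)
    refine hc1.mono' hχ (ae_of_all _ fun x => ?_)
    by_cases hx : x ∈ {x | 0 < uin x} <;> simp [indicator, hx]
  · refine tendsto_integral_filter_of_dominated_convergence (fun _ => 2)
      (Eventually.of_forall fun k => (hm k).mul
        (contDiff_bump _ _ m).continuous.aestronglyMeasurable) ?_
      (integrableOn_const (by simp) (by simp)) ?_
    · filter_upwards [hS.eventually_abs_rho_le le_rfl] with k hk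
      filter_upwards [ae_restrict_mem measurableSet_Ioo] with x hx
      rw [Real.norm_eq_abs, abs_mul, abs_of_nonneg (bump_nonneg _ _ _ _)]
      nlinarith [hk x hx, abs_nonneg (rhoOf n (ε k) (u k) 0 x), bump_nonneg p q m x,
        bump_le_one p q m x]
    · exact (ae_restrict_mem measurableSet_Ioo).mono fun x hx => (hpt x hx).mul_const _

theorem integral_indicator_initial (hS : SettingSeq n a b K uin duin ε u ux uxx uxxx) :
    ∫ x in Ioo a b, {x | 0 < uin x}.indicator (fun _ => (1 : ℝ)) x =
      volume.real {x ∈ Ioo a b | 0 < uin x} := by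
  have hu : ContinuousOn uin (Ioo a b) :=
    (((hS.setting 0).sol.continuousOn_slice le_rfl).congr fun x hx =>
      ((hS.setting 0).sol.initial x hx).symm).mono Ioo_subset_Icc_self
  have hm : MeasurableSet {x ∈ Ioo a b | 0 < uin x} :=
    (hu.isOpen_inter_preimage isOpen_Ioo isOpen_Ioi).measurableSet
  have e : ∫ x in Ioo a b, {x | 0 < uin x}.indicator (fun _ => (1 : ℝ)) x =
      ∫ x in Ioo a b, {x ∈ Ioo a b | 0 < uin x}.indicator (fun _ => (1 : ℝ)) x :=
    setIntegral_congr_fun measurableSet_Ioo fun x hx => by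
      simp [indicator, hx.1, hx.2]
  rw [e, setIntegral_indicator hm, setIntegral_const, smul_eq_mul, mul_one,
    inter_eq_self_of_subset_right fun x hx => hx.1]

theorem tendsto_integral_initial (hS : SettingSeq n a b K uin duin ε u ux uxx uxxx) :
    Tendsto (fun k => ∫ x in Ioo a b, rhoOf n (ε k) (u k) 0 x) atTop
      (𝓝 (volume.real {x ∈ Ioo a b | 0 < uin x})) := by
  rw [← hS.integral_indicator_initial]
  exact hS.tendsto_integral_Ioo le_rfl hS.isBumpLimit_zero le_rfl hS.lt.le le_rfl

/-- Passage to the limit in the growth estimate. -/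
theorem growth_limit (hS : SettingSeq n a b K uin duin ε u ux uxx uxxx) (ht : 0 ≤ t)
    (hf : IsBumpLimit a b (fun k => rhoOf n (ε k) (u k) t) f) {c : ℝ}
    (h : ∀ δ, 0 < δ → 2 * δ * (b - a) ≤ 1 → ∀ᶠ k in atTop, ε k ≤ δ → 0 ≤ rhoLower (ε k) K δ →
      7 * (c * (1 - 2 * δ * (b - a)) ^ 3 * rhoLower (ε k) K δ ^ 6) * t ≤
        (∫ x in Ioo a b, rhoOf n (ε k) (u k) t x) ^ 7 -
          (∫ x in Ioo a b, rhoOf n (ε k) (u k) 0 x) ^ 7) :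
    7 * c * t + volume.real {x ∈ Ioo a b | 0 < uin x} ^ 7 ≤ (∫ x in Ioo a b, f x) ^ 7 := by
  have h1 : ∀ δ, 0 < δ → 2 * δ * (b - a) ≤ 1 → 7 * (c * (1 - 2 * δ * (b - a)) ^ 3) * t ≤
      (∫ x in Ioo a b, f x) ^ 7 - volume.real {x ∈ Ioo a b | 0 < uin x} ^ 7 := fun δ hδ hδ1 => by
    have l1 := (((hS.tendsto_rhoLower δ).pow 6).const_mul
      (c * (1 - 2 * δ * (b - a)) ^ 3)).const_mul 7 |>.mul_const t
    have l2 := ((hS.tendsto_integral_Ioo ht hf le_rfl hS.lt.le le_rfl).pow 7).sub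
      (hS.tendsto_integral_initial.pow 7)
    rw [one_pow, mul_one] at l1
    refine le_of_tendsto_of_tendsto l1 l2 ?_
    filter_upwards [h δ hδ hδ1, hS.tendsto.eventually (gt_mem_nhds hδ),
      (hS.tendsto_rhoLower δ).eventually (lt_mem_nhds zero_lt_one)] with k hk h2 h3
    exact hk h2.le h3.le
  have hlim : Tendsto (fun δ : ℝ => 7 * (c * (1 - 2 * δ * (b - a)) ^ 3) * t) (𝓝[>] 0)
      (𝓝 (7 * c * t)) := by
    have hc : Continuous fun δ : ℝ => 7 * (c * (1 - 2 * δ * (b - a)) ^ 3) * t := by fun_prop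
    have := hc.tendsto 0
    simp only [mul_zero, zero_mul, sub_zero, one_pow, mul_one] at this
    exact this.mono_left nhdsWithin_le_nhds
  have hsm : Tendsto (fun δ : ℝ => 2 * δ * (b - a)) (𝓝[>] 0) (𝓝 0) := by
    have hc : Continuous fun δ : ℝ => 2 * δ * (b - a) := by fun_prop
    have := hc.tendsto 0
    simp only [mul_zero, zero_mul] at this
    exact this.mono_left nhdsWithin_le_nhds
  have h2 := le_of_tendsto hlim (b := (∫ x in Ioo a b, f x) ^ 7 -
      volume.real {x ∈ Ioo a b | 0 < uin x} ^ 7) (by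
    filter_upwards [self_mem_nhdsWithin, hsm.eventually (gt_mem_nhds zero_lt_one)] with δ hδ hδ1
    exact h1 δ hδ hδ1.le)
  linarith

theorem growth_of_lt (hS : SettingSeq n a b K uin duin ε u ux uxx uxxx) (ht : 0 ≤ t)
    (hf : IsBumpLimit a b (fun k => rhoOf n (ε k) (u k) t) f)
    (hM : ∫ x in Ioo a b, f x < b - a) :
    63 * t + volume.real {x ∈ Ioo a b | 0 < uin x} ^ 7 ≤ (∫ x in Ioo a b, f x) ^ 7 := by
  have := hS.growth_limit (c := 9) ht hf fun δ _ hδ1 => by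
    have l2 := (hS.tendsto_rhoLower δ).mul_const (b - a)
    rw [one_mul] at l2
    filter_upwards [(hS.tendsto_integral_Ioo ht hf le_rfl hS.lt.le le_rfl).eventually_lt l2 hM]
      with k hk h1 h2
    exact (hS.setting k).growth_of_lt ht h1 h2 hδ1 hk
  linarith

theorem eventually_le_of_forall_interval (hS : SettingSeq n a b K uin duin ε u ux uxx uxxx)
    (hf : IsBumpLimit a b (fun k => rhoOf n (ε k) (u k) t) f) {z : ℝ} (hz : z ∈ Icc a b)
    (h : ∀ η > 0, ∃ c d, a ≤ c ∧ c < d ∧ d ≤ b ∧ (∀ x ∈ Ioo c d, |x - z| ≤ η) ∧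
      ∫ x in Ioo c d, f x < d - c) {δ : ℝ} (hδ : 0 < δ) :
    ∀ᶠ k in atTop, ∀ τ ∈ Ioc 0 t, u k τ z ≤ δ := by
  set E := energy₀ a b duin
  have hE : 0 ≤ E := energy₀_nonneg a b duin
  set μ := δ / (2 * (E + 1)) with hμ
  have hμ0 : 0 < μ := by positivity
  have hμE : μ * E ≤ δ / 2 := by
    rw [hμ, div_mul_eq_mul_div, div_le_div_iff₀ (by positivity) (by norm_num)]
    nlinarith
  obtain ⟨c, d, hac, hcd, hdb, hnear, hlt⟩ := h (μ * δ / 2) (by positivity)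
  obtain ⟨p, q, hpq, hb⟩ := exists_tendsto_bump c d
  have hc1 : IntegrableOn (fun _ : ℝ => (1 : ℝ)) (Ioo a b) := integrableOn_const (by simp) (by simp)
  have l1 := tendsto_integral_mul_bump hac hdb hb hf.integrable
  have l2 := tendsto_integral_mul_bump hac hdb hb hc1
  have hcst : ∫ _x in Ioo c d, (1 : ℝ) = d - c := by
    rw [setIntegral_const, smul_eq_mul, mul_one, Real.volume_real_Ioo_of_le hcd.le]
  rw [hcst] at l2
  obtain ⟨m, hm⟩ := (l1.eventually_lt l2 hlt).exists
  simp only [one_mul] at hm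
  set φ := bump (p m) (q m) m with hφ
  have hp : a < p m := hac.trans_lt (hpq m).1
  have hq : (q m : ℝ) < b := (hpq m).2.trans_le hdb
  have hpq' : (p m : ℝ) ≤ q m := by
    by_contra hcon
    have : ∀ x, φ x = 0 := fun x => bump_eq_zero m fun h =>
      hcon (h.1.trans h.2).le
    simp [this] at hm
  obtain ⟨C, hC1, hC⟩ := exists_derivBound_bump (p m) (q m) m
  obtain ⟨x, hx1, hx2⟩ := exists_between hp
  obtain ⟨y, hy1, hy2⟩ := exists_between hq
  set γ := (∫ x in Ioo a b, φ x) - ∫ x in Ioo a b, f x * φ x with hγ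
  have hγ0 : 0 < γ := sub_pos.2 hm
  obtain ⟨δ', hδ', hev⟩ := hS.exists_monoError_le t
    (div_pos (half_pos hγ0) (zero_lt_one.trans_le hC1))
  have l3 := ((hS.tendsto_rhoLower (δ / 2)).mul_const (∫ x in Ioo a b, φ x)).sub
    (hf.tendsto (p m) (q m) m hp hq)
  rw [one_mul] at l3
  filter_upwards [hev, l3.eventually (lt_mem_nhds (half_lt_self hγ0)),
    hS.tendsto.eventually (gt_mem_nhds (half_pos hδ))] with k hk1 hk2 hk3 τ hτ
  have hs := hS.setting k
  by_contra! hcon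
  have h1 := hs.integral_rho_mul_le (contDiff_bump (p m) (q m) m) hx1
    (hx2.le.trans (hpq'.trans hy1.le)) hy2
    ((tsupport_bump_subset _ _ m).trans (Icc_subset_Ioo hx2 hy1)) (bump_nonneg _ _ _)
    (fun z => (bump_le_one _ _ _ z).trans hC1) (fun z => (hC z).1) (fun z => (hC z).2) hδ'
    hτ.1.le hτ.2 le_rfl
  have h2 : C * monoError a b (ε k) K t δ' duin ≤ γ / 2 := by
    have := mul_le_mul_of_nonneg_left hk1 (zero_le_one.trans hC1)
    rwa [mul_div_cancel₀ _ (by positivity)] at this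
  have hlow : ∀ x ∈ Ioo c d, δ / 2 ≤ u k τ x := fun x hx => by
    have hn := hnear x hx
    have hd : |u k τ x - u k τ z| ≤ 1 / 2 * (μ * E + |x - z| / μ) := by
      rcases le_total x z with hxz | hzx
      · rw [abs_sub_comm, abs_sub_comm x z, abs_of_nonneg (sub_nonneg.2 hxz)]
        exact hs.sol.abs_sub_le hs.lt hs.datum hτ.1 (hac.trans hx.1.le) hxz hz.2 hμ0
      · rw [abs_of_nonneg (sub_nonneg.2 hzx)]
        exact hs.sol.abs_sub_le hs.lt hs.datum hτ.1 hz.1 hzx (hx.2.le.trans hdb) hμ0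
    have h3 : |x - z| / μ ≤ δ / 2 := by
      rw [div_le_iff₀ hμ0]; linarith
    have := (abs_le.1 hd).1
    linarith
  have h4 : rhoLower (ε k) K (δ / 2) * ∫ x in Ioo a b, φ x ≤
      ∫ x in Ioo a b, rhoOf n (ε k) (u k) τ x * φ x := by
    rw [← integral_const_mul]
    refine setIntegral_mono_on ?_ (hs.sol.integrableOn_rho_mul hs.n_pos hs.n_lt hs.eps_pos hτ.1.le
      (contDiff_bump _ _ m).continuous) measurableSet_Ioo fun x _ => ?_
    · exact ((((contDiff_bump (p m) (q m) m).continuous.integrableOn_Icc).mono_set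
        Ioo_subset_Icc_self).const_mul _)
    · by_cases hx : x ∈ Ioo c d
      · exact mul_le_mul_of_nonneg_right (le_Beps hs.n_pos hs.n_lt hs.const hs.eps_pos hs.eps_lt
          hk3.le (hlow x hx)) (bump_nonneg _ _ _ _)
      · have : φ x = 0 := bump_eq_zero m fun h =>
          hx ⟨(hpq m).1.trans h.1, h.2.trans (hpq m).2⟩
        rw [this, mul_zero, mul_zero]
  linarith

theorem growth_of_endpoints (hS : SettingSeq n a b K uin duin ε u ux uxx uxxx) (ht : 0 ≤ t)
    (hf : IsBumpLimit a b (fun k => rhoOf n (ε k) (u k) t) f)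
    (h : ∀ z, z = a ∨ z = b → ∀ η > 0, ∃ c d, a ≤ c ∧ c < d ∧ d ≤ b ∧
      (∀ x ∈ Ioo c d, |x - z| ≤ η) ∧ ∫ x in Ioo c d, f x < d - c) :
    1008 * t + volume.real {x ∈ Ioo a b | 0 < uin x} ^ 7 ≤ (∫ x in Ioo a b, f x) ^ 7 := by
  have := hS.growth_limit (c := 144) ht hf fun δ hδ hδ1 => by
    filter_upwards [
      hS.eventually_le_of_forall_interval hf (left_mem_Icc.2 hS.lt.le) (h a (Or.inl rfl)) hδ,
      hS.eventually_le_of_forall_interval hf (right_mem_Icc.2 hS.lt.le) (h b (Or.inr rfl)) hδ]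
      with k h1 h2 h3 h4
    exact (hS.setting k).growth_of_endpoints ht h3 h4 hδ1 fun τ hτ => ⟨h1 τ hτ, h2 τ hτ⟩
  linarith

end limit

end SettingSeq

end

section

theorem exists_subseq_ae_tendsto_zero {α : Type*} [MeasurableSpace α] {μ : Measure α}
    {F : ℕ → α → ENNReal} (hF : ∀ k, AEMeasurable (F k) μ)
    (h : Tendsto (fun k => ∫⁻ x, F k x ∂μ) atTop (𝓝 0)) :
    ∃ σ : ℕ → ℕ, StrictMono σ ∧ ∀ᵐ x ∂μ, Tendsto (fun k => F (σ k) x) atTop (𝓝 0) := by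
  have hpos : ∀ k : ℕ, (0 : ENNReal) < (2⁻¹ : ENNReal) ^ k := fun k =>
    ENNReal.pow_pos (by simp) k
  obtain ⟨σ, hσ, hle⟩ := extraction_forall_of_eventually' (fun k => by
    obtain ⟨N, hN⟩ := eventually_atTop.1 (h.eventually (gt_mem_nhds (hpos k)))
    exact ⟨N, fun m hm => (hN m hm).le⟩ :
    ∀ k : ℕ, ∃ N, ∀ m ≥ N, ∫⁻ x, F m x ∂μ ≤ (2⁻¹ : ENNReal) ^ k)
  refine ⟨σ, hσ, ?_⟩
  have hsum : ∫⁻ x, ∑' k, F (σ k) x ∂μ ≠ ⊤ := by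
    rw [lintegral_tsum fun k => hF (σ k)]
    refine ne_top_of_le_ne_top ?_ (ENNReal.tsum_le_tsum hle)
    rw [ENNReal.tsum_geometric]
    simp
  filter_upwards [ae_lt_top' (AEMeasurable.tsum fun k => hF (σ k)) hsum] with x hx
  exact ENNReal.tendsto_atTop_zero_of_tsum_ne_top hx.ne

theorem ofReal_abs_integral_div_le {a b : ℝ} {g φ : ℝ → ℝ} (hφ : ContDiff ℝ (⊤ : ℕ∞) φ)
    (hc : HasCompactSupport φ) (hs : tsupport φ ⊆ Ioo a b) {C : ℝ} (hC0 : 0 < C)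
    (hC : ∀ x, |φ x| ≤ C ∧ |deriv φ x| ≤ C) :
    ENNReal.ofReal (|∫ x in Ioo a b, g x * φ x| / C) ≤ negSobolevNorm a b g := by
  have e : |∫ x in Ioo a b, g x * φ x| / C = |∫ x in Ioo a b, g x * (C⁻¹ * φ x)| := by
    have : ∀ x, g x * (C⁻¹ * φ x) = C⁻¹ * (g x * φ x) := fun x => by ring
    simp_rw [this]
    rw [integral_const_mul, abs_mul, abs_of_pos (inv_pos.2 hC0), div_eq_inv_mul]
  rw [e]
  refine le_iSup₂_of_le (fun x => C⁻¹ * φ x) ⟨contDiff_const.mul hφ, hc.mul_left,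
    (closure_mono fun x hx => ?_).trans hs, fun x => ⟨?_, ?_⟩⟩ le_rfl
  · exact right_ne_zero_of_mul hx
  · rw [abs_mul, abs_of_pos (inv_pos.2 hC0), inv_mul_le_iff₀ hC0, mul_one]
    exact (hC x).1
  · rw [deriv_const_mul _ (hφ.differentiable (by simp) x), abs_mul, abs_of_pos (inv_pos.2 hC0),
      inv_mul_le_iff₀ hC0, mul_one]
    exact (hC x).2

/-- Convergence in `L^p(0, T; W^{-1,1})` implies convergence at almost every time along a
subsequence, when tested against countably many functions. -/
theorem TendstoLpNegSobolev.exists_subseq {ι : Type*} [Countable ι] {p T a b : ℝ}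
    {R : ℕ → ℝ → ℝ → ℝ} {ρ : ℝ → ℝ → ℝ} (h : TendstoLpNegSobolev p T a b R ρ) (hp : 1 ≤ p)
    (hR : ∀ k, IntegrableOn (Function.uncurry (R k)) (Ioo 0 T ×ˢ Ioo a b))
    (hρ : IntegrableOn (Function.uncurry ρ) (Ioo 0 T ×ˢ Ioo a b)) {φ : ι → ℝ → ℝ}
    (hφ : ∀ i, ContDiff ℝ (⊤ : ℕ∞) (φ i)) (hs : ∀ i, tsupport (φ i) ⊆ Ioo a b)
    (hc : ∀ i, HasCompactSupport (φ i)) {C : ι → ℝ} (hC0 : ∀ i, 0 < C i)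
    (hC : ∀ i x, |φ i x| ≤ C i ∧ |deriv (φ i) x| ≤ C i) :
    ∃ σ : ℕ → ℕ, StrictMono σ ∧ ∀ᵐ t ∂(volume.restrict (Ioo 0 T)), ∀ i,
      Tendsto (fun k => ∫ x in Ioo a b, (R (σ k) t x - ρ t x) * φ i x) atTop (𝓝 0) := by
  have hp0 : 0 < p := zero_lt_one.trans_le hp
  set N : ℕ → ℝ → ENNReal := fun k t =>
    ⨆ i, ENNReal.ofReal (|∫ x in Ioo a b, (R k t x - ρ t x) * φ i x| / C i) with hN
  have hm : ∀ k, AEMeasurable (fun t => N k t ^ p) (volume.restrict (Ioo 0 T)) := fun k => by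
    refine (AEMeasurable.iSup fun i => ?_).pow_const p
    have hi : Integrable (fun z : ℝ × ℝ => (R k z.1 z.2 - ρ z.1 z.2) * φ i z.2)
        ((volume.restrict (Ioo 0 T)).prod (volume.restrict (Ioo a b))) := by
      have h1 : Integrable (fun z : ℝ × ℝ => R k z.1 z.2 - ρ z.1 z.2)
          ((volume.restrict (Ioo 0 T)).prod (volume.restrict (Ioo a b))) := by
        rw [Measure.prod_restrict]
        exact (hR k).sub hρ
      exact h1.mul_bdd (c := C i) ((hφ i).continuous.comp continuous_snd).aestronglyMeasurable
        (ae_of_all _ fun z => (hC i z.2).1)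
    have h2 := hi.integral_prod_left.aestronglyMeasurable.aemeasurable
    exact ((continuous_abs.measurable.comp_aemeasurable h2).div_const _).ennreal_ofReal
  have hle : ∀ k t, N k t ≤ negSobolevNorm a b (fun x => R k t x - ρ t x) := fun k t =>
    iSup_le fun i => ofReal_abs_integral_div_le (hφ i) (hc i) (hs i) (hC0 i) (hC i)
  have hlim : Tendsto (fun k => ∫⁻ t in Ioo 0 T, N k t ^ p) atTop (𝓝 0) :=
    tendsto_of_tendsto_of_tendsto_of_le_of_le tendsto_const_nhds h (fun k => by simp)
      fun k => lintegral_mono fun t => ENNReal.rpow_le_rpow (hle k t) hp0.le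
  obtain ⟨σ, hσ, hae⟩ := exists_subseq_ae_tendsto_zero hm hlim
  refine ⟨σ, hσ, ?_⟩
  filter_upwards [hae] with t ht i
  have h1 : Tendsto (fun k => N (σ k) t) atTop (𝓝 0) := by
    have := ht.ennrpow_const (1 / p)
    rw [ENNReal.zero_rpow_of_pos (by positivity)] at this
    refine this.congr fun k => ?_
    rw [← ENNReal.rpow_mul, mul_one_div_cancel hp0.ne', ENNReal.rpow_one]
  have h2 : Tendsto (fun k => ENNReal.ofReal
      (|∫ x in Ioo a b, (R (σ k) t x - ρ t x) * φ i x| / C i)) atTop (𝓝 0) :=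
    tendsto_of_tendsto_of_tendsto_of_le_of_le tendsto_const_nhds h1 (fun k => by simp)
      fun k => le_iSup (fun i => ENNReal.ofReal
        (|∫ x in Ioo a b, (R (σ k) t x - ρ t x) * φ i x| / C i)) i
  have h3 := (ENNReal.tendsto_toReal ENNReal.zero_ne_top).comp h2
  rw [ENNReal.toReal_zero] at h3
  have h4 := h3.mul_const (C i)
  rw [zero_mul] at h4
  refine (tendsto_zero_iff_abs_tendsto_zero _).2 (h4.congr fun k => ?_)
  simp only [Function.comp]
  rw [ENNReal.toReal_ofReal (div_nonneg (abs_nonneg _) (hC0 i).le), div_mul_cancel₀ _ (hC0 i).ne']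

theorem SettingSeq.exists_subseq_isBumpLimit {n a b K p T : ℝ} {uin duin : ℝ → ℝ} {ε : ℕ → ℝ}
    {u ux uxx uxxx : ℕ → ℝ → ℝ → ℝ} (hS : SettingSeq n a b K uin duin ε u ux uxx uxxx)
    {ρ : ℝ → ℝ → ℝ} (hρ : IntegrableOn (Function.uncurry ρ) (Ioo 0 T ×ˢ Ioo a b)) (hp : 1 ≤ p)
    (hconv : TendstoLpNegSobolev p T a b (fun k => rhoOf n (ε k) (u k)) ρ) :
    ∃ σ : ℕ → ℕ, StrictMono σ ∧ ∀ᵐ t ∂(volume.restrict (Ioo 0 T)),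
      IsBumpLimit a b (fun k => rhoOf n (ε (σ k)) (u (σ k)) t) (ρ t) := by
  choose C hC1 hC using fun i : {q : ℚ × ℚ × ℕ // a < q.1 ∧ (q.2.1 : ℝ) < b} =>
    exists_derivBound_bump i.1.1 i.1.2.1 i.1.2.2
  have hR : ∀ k, IntegrableOn (Function.uncurry (rhoOf n (ε k) (u k))) (Ioo 0 T ×ˢ Ioo a b) :=
    fun k => (((hS.setting k).sol.continuousOn_rho (hS.setting k).n_pos (hS.setting k).n_lt
      (hS.setting k).eps_pos).mono (prod_mono (Icc_subset_Ici_self : Icc 0 T ⊆ Ici 0)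
        Subset.rfl)).integrableOn_compact (isCompact_Icc.prod isCompact_Icc) |>.mono_set
      (prod_mono Ioo_subset_Icc_self Ioo_subset_Icc_self)
  obtain ⟨σ, hσ, hae⟩ := hconv.exists_subseq hp hR hρ
    (φ := fun i : {q : ℚ × ℚ × ℕ // a < q.1 ∧ (q.2.1 : ℝ) < b} => bump i.1.1 i.1.2.1 i.1.2.2)
    (fun i => contDiff_bump _ _ _)
    (fun i => (tsupport_bump_subset _ _ _).trans fun x hx =>
      ⟨i.2.1.trans_le hx.1, hx.2.trans_lt i.2.2⟩) (fun i => hasCompactSupport_bump _ _ _)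
    (fun i => zero_lt_one.trans_le (hC1 i))
    (fun i x => ⟨by
      rw [abs_of_nonneg (bump_nonneg _ _ _ _)]
      exact (bump_le_one _ _ _ _).trans (hC1 i), (hC i x).1⟩)
  refine ⟨σ, hσ, ?_⟩
  have hslice : ∀ᵐ t ∂(volume.restrict (Ioo 0 T)), IntegrableOn (ρ t) (Ioo a b) := by
    rw [IntegrableOn, Measure.volume_eq_prod, ← Measure.prod_restrict] at hρ
    exact hρ.prod_right_ae
  filter_upwards [hae, hslice, ae_restrict_mem measurableSet_Ioo] with t ht hi htI
  refine ⟨hi, fun q r m hq hr => ?_⟩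
  have h1 := ht ⟨(q, r, m), hq, hr⟩
  simp only at h1
  have h2 := h1.add_const (∫ x in Ioo a b, ρ t x * bump q r m x)
  rw [zero_add] at h2
  refine h2.congr fun k => ?_
  have hs := hS.setting (σ k)
  have i1 := hs.sol.integrableOn_rho_mul hs.n_pos hs.n_lt hs.eps_pos htI.1.le
    (contDiff_bump q r m).continuous
  have i2 : IntegrableOn (fun x => ρ t x * bump q r m x) (Ioo a b) :=
    hi.mul_bdd (c := 1) (contDiff_bump _ _ _).continuous.aestronglyMeasurable
      (ae_of_all _ fun x => by
        rw [Real.norm_eq_abs, abs_of_nonneg (bump_nonneg _ _ _ _)]; exact bump_le_one _ _ _ _)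
  simp_rw [sub_mul]
  rw [integral_sub i1 i2, sub_add_cancel]

end

section

/-- Truncation to the interval `[0, 1]`. -/
def clip (y : ℝ) : ℝ := max 0 (min y 1)

theorem clip_nonneg (y : ℝ) : 0 ≤ clip y := le_max_left _ _

theorem clip_le_one (y : ℝ) : clip y ≤ 1 := max_le zero_le_one (min_le_right _ _)

theorem clip_of_mem {y : ℝ} (h0 : 0 ≤ y) (h1 : y ≤ 1) : clip y = y := by
  rw [clip, min_eq_left h1, max_eq_right h0]

theorem continuous_clip : Continuous clip := continuous_const.max (continuous_id.min continuous_const)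

/-- The supremum of the truncated values of `ρ` at the times `c i < t`. -/
def leftSup {ι : Type*} (ρ : ℝ → ℝ → ℝ) (c : ι → ℝ) (t x : ℝ) : ℝ :=
  ⨆ i, if c i < t then clip (ρ (c i) x) else 0

section leftSup

variable {ι : Type*} {ρ : ℝ → ℝ → ℝ} {c : ι → ℝ} {s t x : ℝ}

theorem leftSup_bddAbove (ρ : ℝ → ℝ → ℝ) (c : ι → ℝ) (t x : ℝ) :
    BddAbove (range fun i => if c i < t then clip (ρ (c i) x) else 0) := by
  refine ⟨1, ?_⟩
  rintro _ ⟨i, rfl⟩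
  beta_reduce
  split_ifs
  exacts [clip_le_one _, zero_le_one]

theorem leftSup_nonneg (ρ : ℝ → ℝ → ℝ) (c : ι → ℝ) (t x : ℝ) : 0 ≤ leftSup ρ c t x :=
  Real.iSup_nonneg fun i => by split_ifs; exacts [clip_nonneg _, le_rfl]

theorem leftSup_le {M : ℝ} (hM : 0 ≤ M) (h : ∀ i, c i < t → clip (ρ (c i) x) ≤ M) :
    leftSup ρ c t x ≤ M :=
  Real.iSup_le (fun i => by split_ifs with hi; exacts [h i hi, hM]) hM

theorem leftSup_le_one (ρ : ℝ → ℝ → ℝ) (c : ι → ℝ) (t x : ℝ) : leftSup ρ c t x ≤ 1 :=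
  leftSup_le zero_le_one fun _ _ => clip_le_one _

theorem clip_le_leftSup (i : ι) (hi : c i < t) : clip (ρ (c i) x) ≤ leftSup ρ c t x := by
  have := le_ciSup (leftSup_bddAbove ρ c t x) i
  beta_reduce at this
  rwa [if_pos hi] at this

theorem leftSup_mono (hst : s ≤ t) : leftSup ρ c s x ≤ leftSup ρ c t x :=
  leftSup_le (leftSup_nonneg _ _ _ _) fun i hi => clip_le_leftSup i (hi.trans_le hst)

theorem tendsto_leftSup (ρ : ℝ → ℝ → ℝ) (c : ι → ℝ) (t x : ℝ) :
    Tendsto (fun s => leftSup ρ c s x) (𝓝[<] t) (𝓝 (leftSup ρ c t x)) := by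
  refine tendsto_order.2 ⟨fun M hM => ?_, fun M hM => ?_⟩
  · by_cases hM0 : M < 0
    · exact Eventually.of_forall fun s => hM0.trans_le (leftSup_nonneg _ _ _ _)
    · have : ∃ i, c i < t ∧ M < clip (ρ (c i) x) := by
        by_contra! hcon
        exact absurd hM (not_lt.2 (leftSup_le (not_lt.1 hM0) hcon))
      obtain ⟨i, hi, hMi⟩ := this
      filter_upwards [Ioo_mem_nhdsLT hi] with s hs
      exact hMi.trans_le (clip_le_leftSup i hs.1)
  · filter_upwards [self_mem_nhdsWithin] with s hs
    exact (leftSup_mono (le_of_lt hs)).trans_lt hM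

theorem aemeasurable_leftSup [Countable ι] {μ : Measure ℝ} (h : ∀ i, AEMeasurable (ρ (c i)) μ)
    (t : ℝ) : AEMeasurable (leftSup ρ c t) μ :=
  AEMeasurable.iSup fun i => by
    split_ifs
    exacts [continuous_clip.measurable.comp_aemeasurable (h i), aemeasurable_const]

end leftSup

theorem exists_countable_dense_times {T : ℝ} {G : Set ℝ} (hT : 0 < T)
    (hG : ∀ᵐ t ∂(volume.restrict (Ioo 0 T)), t ∈ G) :
    ∃ c : ℚ × ℚ → ℝ, (∀ i, c i ∈ G ∧ c i ∈ Ioo 0 T) ∧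
      ∀ s t, 0 ≤ s → s < t → t ≤ T → ∃ i, s < c i ∧ c i < t := by
  have key : ∀ s t, 0 ≤ s → s < t → t ≤ T → ∃ g ∈ G, g ∈ Ioo s t := fun s t hs hst ht => by
    have h1 : ∀ᵐ τ ∂(volume.restrict (Ioo s t)), τ ∈ G :=
      ae_restrict_of_ae_restrict_of_subset (Ioo_subset_Ioo hs ht) hG
    have h2 : ∃ᵐ τ ∂(volume.restrict (Ioo s t)), τ ∈ Ioo s t := by
      have : NeBot (ae (volume.restrict (Ioo s t))) := by
        rw [ae_neBot, Ne, Measure.restrict_eq_zero, Real.volume_Ioo, ENNReal.ofReal_eq_zero]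
        linarith
      exact (ae_restrict_mem measurableSet_Ioo).frequently
    obtain ⟨g, hg1, hg2⟩ := (h2.and_eventually h1).exists
    exact ⟨g, hg2, hg1⟩
  obtain ⟨g₀, hg₀, hg₀'⟩ := key 0 T le_rfl hT le_rfl
  have : ∀ i : ℚ × ℚ, ∃ g, (g ∈ G ∧ g ∈ Ioo 0 T) ∧
      ((0 ≤ (i.1 : ℝ) ∧ i.1 < i.2 ∧ (i.2 : ℝ) ≤ T) → g ∈ Ioo (i.1 : ℝ) i.2) := fun i => by
    by_cases h : 0 ≤ (i.1 : ℝ) ∧ i.1 < i.2 ∧ (i.2 : ℝ) ≤ T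
    · obtain ⟨g, hg, hg'⟩ := key i.1 i.2 h.1 (by exact_mod_cast h.2.1) h.2.2
      exact ⟨g, ⟨hg, h.1.trans_lt hg'.1, hg'.2.trans_le h.2.2⟩, fun _ => hg'⟩
    · exact ⟨g₀, ⟨hg₀, hg₀'⟩, fun h' => absurd h' h⟩
  choose c hc1 hc2 using this
  refine ⟨c, hc1, fun s t hs hst ht => ?_⟩
  obtain ⟨p, hp1, hp2⟩ := exists_rat_btwn hst
  obtain ⟨q, hq1, hq2⟩ := exists_rat_btwn hp2
  have := hc2 (p, q) ⟨hs.trans hp1.le, by exact_mod_cast hq1, hq2.le.trans ht⟩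
  exact ⟨(p, q), hp1.trans this.1, this.2.trans hq2⟩

/-- A function which is nondecreasing in time along a set of full measure has a left-continuous
nondecreasing version defined for every time. -/
theorem exists_leftContinuous_version {a b T : ℝ} (hT : 0 < T) {ρ : ℝ → ℝ → ℝ} {f₀ : ℝ → ℝ}
    {G : Set ℝ} (hG : ∀ᵐ t ∂(volume.restrict (Ioo 0 T)), t ∈ G)
    (hf₀ : IntegrableOn f₀ (Ioo a b))
    (hint : ∀ t ∈ G, IntegrableOn (ρ t) (Ioo a b))
    (h0 : ∀ t ∈ G, ∀ᵐ x ∂(volume.restrict (Ioo a b)), 0 ≤ ρ t x)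
    (h1 : ∀ t ∈ G, ∀ᵐ x ∂(volume.restrict (Ioo a b)), ρ t x ≤ 1)
    (hinit : ∀ t ∈ G, f₀ ≤ᵐ[volume.restrict (Ioo a b)] ρ t)
    (hmono : ∀ s ∈ G, ∀ t ∈ G, s ≤ t → ρ s ≤ᵐ[volume.restrict (Ioo a b)] ρ t) :
    ∃ r : ℝ → ℝ → ℝ, (∀ t, IntegrableOn (r t) (Ioo a b)) ∧
      (∀ᵐ t ∂(volume.restrict (Ioo 0 T)), r t =ᵐ[volume.restrict (Ioo a b)] ρ t) ∧
      (∀ s t, s ≤ t → r s ≤ᵐ[volume.restrict (Ioo a b)] r t) ∧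
      (∀ t ∈ Ioc 0 T,
        Tendsto (fun s => ∫ x in Ioo a b, |r s x - r t x|) (𝓝[<] t) (𝓝 0)) ∧
      r 0 = f₀ ∧ (∀ t, 0 < t → ∀ x, r t x ≤ 1) ∧
      ∀ s ∈ G, 0 < s → ∀ t ≤ T, s < t → ρ s ≤ᵐ[volume.restrict (Ioo a b)] r t := by
  obtain ⟨c, hc, hdense⟩ := exists_countable_dense_times hT hG
  set r : ℝ → ℝ → ℝ := fun t => if t ≤ 0 then f₀ else leftSup ρ c t with hr
  have rneg : ∀ t, t ≤ 0 → r t = f₀ := fun t ht => if_pos ht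
  have rpos : ∀ t, 0 < t → r t = leftSup ρ c t := fun t ht => if_neg (not_le.2 ht)
  have hc1 : IntegrableOn (fun _ : ℝ => (1 : ℝ)) (Ioo a b) := integrableOn_const (by simp) (by simp)
  have hm : ∀ t, AEStronglyMeasurable (leftSup ρ c t) (volume.restrict (Ioo a b)) := fun t =>
    (aemeasurable_leftSup (fun i => (hint _ (hc i).1).aestronglyMeasurable.aemeasurable)
      t).aestronglyMeasurable
  have rint : ∀ t, IntegrableOn (r t) (Ioo a b) := fun t => by
    rcases le_or_gt t 0 with ht | ht
    · rw [rneg t ht]; exact hf₀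
    · rw [rpos t ht]
      refine hc1.mono' (hm t) (ae_of_all _ fun x => ?_)
      rw [Real.norm_eq_abs, abs_of_nonneg (leftSup_nonneg _ _ _ _)]
      exact leftSup_le_one _ _ _ _
  have hclip : ∀ i, ∀ᵐ x ∂(volume.restrict (Ioo a b)), clip (ρ (c i) x) = ρ (c i) x := fun i => by
    filter_upwards [h0 _ (hc i).1, h1 _ (hc i).1] with x hx0 hx1
    exact clip_of_mem hx0 hx1
  have rle : ∀ i t, c i < t → ρ (c i) ≤ᵐ[volume.restrict (Ioo a b)] r t := fun i t hi => by
    rw [rpos t ((hc i).2.1.trans hi)]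
    filter_upwards [hclip i] with x hx
    rw [← hx]
    exact clip_le_leftSup i hi
  have rmono : ∀ s t, s ≤ t → r s ≤ᵐ[volume.restrict (Ioo a b)] r t := fun s t hst => by
    rcases le_or_gt t 0 with ht | ht
    · rw [rneg t ht, rneg s (hst.trans ht)]
    · rcases le_or_gt s 0 with hs | hs
      · obtain ⟨i, -, hi⟩ := hdense 0 (min t T) le_rfl (lt_min ht hT) (min_le_right _ _)
        rw [rneg s hs]
        exact (hinit _ (hc i).1).trans (rle i t (hi.trans_le (min_le_left _ _)))
      · rw [rpos s hs, rpos t ht]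
        exact ae_of_all _ fun x => leftSup_mono hst
  have rge : ∀ s ∈ G, 0 < s → ∀ t ≤ T, s < t → ρ s ≤ᵐ[volume.restrict (Ioo a b)] r t :=
    fun s hs hs0 t ht hst => by
      obtain ⟨i, hi1, hi2⟩ := hdense s t hs0.le hst ht
      exact (hmono s hs _ (hc i).1 hi1.le).trans (rle i t hi2)
  refine ⟨r, rint, ?_, rmono, fun t ht => ?_, rneg 0 le_rfl, fun t ht x => ?_, rge⟩
  · have hNmono : Monotone fun t => ∫ x in Ioo a b, r t x := fun s t hst =>
      integral_mono_ae (rint s) (rint t) (rmono s t hst)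
    have hcont : ∀ᵐ t ∂(volume.restrict (Ioo 0 T)),
        ContinuousAt (fun t => ∫ x in Ioo a b, r t x) t :=
      ae_restrict_of_ae (by
        rw [ae_iff]
        exact hNmono.countable_not_continuousAt.measure_zero _)
    filter_upwards [hG, hcont, ae_restrict_mem measurableSet_Ioo] with t ht hct htI
    have hle : r t ≤ᵐ[volume.restrict (Ioo a b)] ρ t := by
      have hall : ∀ᵐ x ∂(volume.restrict (Ioo a b)), ∀ i, c i < t →
          clip (ρ (c i) x) ≤ ρ t x := by
        refine ae_all_iff.2 fun i => ?_
        by_cases hi : c i < t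
        · filter_upwards [hmono _ (hc i).1 t ht hi.le, hclip i] with x hx1 hx2 _
          rwa [hx2]
        · exact ae_of_all _ fun x h => absurd h hi
      rw [rpos t htI.1]
      filter_upwards [hall, h0 t ht] with x hx hx0
      exact leftSup_le hx0 hx
    have hge : ∫ x in Ioo a b, ρ t x ≤ ∫ x in Ioo a b, r t x := by
      refine ge_of_tendsto (hct.tendsto.mono_left (nhdsWithin_le_nhds (s := Ioi t))) ?_
      filter_upwards [Ioo_mem_nhdsGT htI.2] with s hs
      exact integral_mono_ae (hint t ht) (rint s) (rge t ht htI.1 s hs.2.le hs.1)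
    have hsub : 0 ≤ᵐ[volume.restrict (Ioo a b)] fun x => ρ t x - r t x := by
      filter_upwards [hle] with x hx
      exact sub_nonneg.2 hx
    have hzero : ∫ x in Ioo a b, (ρ t x - r t x) = 0 := by
      refine le_antisymm ?_ (integral_nonneg_of_ae hsub)
      rw [integral_sub (hint t ht) (rint t)]
      linarith
    filter_upwards [(integral_eq_zero_iff_of_nonneg_ae hsub
      ((hint t ht).sub (rint t))).1 hzero] with x hx
    simp only [Pi.zero_apply] at hx
    linarith
  · have e0 : (0 : ℝ) = ∫ x in Ioo a b, (fun _ => (0 : ℝ)) x := by simp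
    rw [e0]
    refine tendsto_integral_filter_of_dominated_convergence (fun _ => 1) ?_ ?_ hc1 ?_
    · exact Eventually.of_forall fun s => ((rint s).sub (rint t)).abs.aestronglyMeasurable
    · filter_upwards [Ioo_mem_nhdsLT ht.1] with s hs
      refine ae_of_all _ fun x => ?_
      rw [rpos s hs.1, rpos t ht.1, Real.norm_eq_abs, abs_abs, abs_le]
      constructor <;> linarith [leftSup_nonneg ρ c s x, leftSup_nonneg ρ c t x,
        leftSup_le_one ρ c s x, leftSup_le_one ρ c t x]
    · refine ae_of_all _ fun x => ?_
      have h2 := ((tendsto_leftSup ρ c t x).sub_const (leftSup ρ c t x)).abs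
      rw [sub_self, abs_zero] at h2
      refine h2.congr' ?_
      filter_upwards [Ioo_mem_nhdsLT ht.1] with s hs
      rw [rpos s hs.1, rpos t ht.1]
  · rw [rpos t ht]
    exact leftSup_le_one _ _ _ _

end

section

theorem frequently_nhdsLT_of_ae {T t : ℝ} {P : ℝ → Prop} (ht : t ∈ Ioc 0 T)
    (h : ∀ᵐ s ∂(volume.restrict (Ioo 0 T)), P s) : ∃ᶠ s in 𝓝[<] t, (0 < s ∧ s < t) ∧ P s := by
  intro hcon
  obtain ⟨s₀, hs₀, hsub⟩ := (mem_nhdsLT_iff_exists_Ioo_subset' ht.1).1 hcon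
  have hlt : max 0 s₀ < t := max_lt ht.1 hs₀
  have h1 : ∀ᵐ s ∂(volume.restrict (Ioo (max 0 s₀) t)), P s :=
    ae_restrict_of_ae_restrict_of_subset (Ioo_subset_Ioo (le_max_left _ _) ht.2) h
  have : NeBot (ae (volume.restrict (Ioo (max 0 s₀) t))) := by
    rw [ae_neBot, Ne, Measure.restrict_eq_zero, Real.volume_Ioo, ENNReal.ofReal_eq_zero]
    linarith
  obtain ⟨s, hs1, hs2⟩ := (h1.and (ae_restrict_mem measurableSet_Ioo)).exists
  exact hsub ⟨(le_max_right _ _).trans_lt hs2.1, hs2.2⟩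
    ⟨⟨(le_max_left _ _).trans_lt hs2.1, hs2.2⟩, hs1⟩

theorem tendsto_integral_of_tendsto_integral_abs_sub {a b : ℝ} {r : ℝ → ℝ → ℝ}
    (hr : ∀ t, IntegrableOn (r t) (Ioo a b)) {t : ℝ} {l : Filter ℝ}
    (h : Tendsto (fun s => ∫ x in Ioo a b, |r s x - r t x|) l (𝓝 0)) :
    Tendsto (fun s => ∫ x in Ioo a b, r s x) l (𝓝 (∫ x in Ioo a b, r t x)) := by
  refine tendsto_iff_norm_sub_tendsto_zero.2 (squeeze_zero (fun s => norm_nonneg _) (fun s => ?_) h)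
  rw [← integral_sub (hr s) (hr t)]
  exact norm_integral_le_integral_norm _

theorem rpow_one_div_seven_le {X M : ℝ} (hX : 0 ≤ X) (hM : 0 ≤ M) (h : X ≤ M ^ 7) :
    X ^ (1 / 7 : ℝ) ≤ M := by
  have h1 := Real.rpow_le_rpow hX h (by norm_num : (0 : ℝ) ≤ 1 / 7)
  have h2 : (M ^ 7) ^ (1 / 7 : ℝ) = M := by
    have := Real.pow_rpow_inv_natCast hM (by norm_num : (7 : ℕ) ≠ 0)
    rwa [← one_div, Nat.cast_ofNat] at this
  rwa [h2] at h1

/-- If the boundary of `Σ` does not meet the end points of the interval, then `∫ f` is smaller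
than the length on suitable intervals close to the end points. -/
theorem exists_interval_of_frontier_subset {a b : ℝ} (hab : a < b) {f : ℝ → ℝ}
    (hf : IntegrableOn f (Ioo a b)) (h1 : ∀ᵐ x ∂(volume.restrict (Ioo a b)), f x ≤ 1)
    (hfr : frontier (SigmaSet a b f) ⊆ Ioo a b) {z : ℝ} (hz : z = a ∨ z = b) {η : ℝ} (hη : 0 < η) :
    ∃ c d, a ≤ c ∧ c < d ∧ d ≤ b ∧ (∀ x ∈ Ioo c d, |x - z| ≤ η) ∧
      ∫ x in Ioo c d, f x < d - c := by
  have hzI : z ∉ Ioo a b := by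
    rintro ⟨h1, h2⟩
    rcases hz with rfl | rfl
    exacts [lt_irrefl _ h1, lt_irrefl _ h2]
  have hsub : SigmaSet a b f ⊆ Ioo a b := fun x hx => hx.1
  have hcl : z ∉ closure (SigmaSet a b f) := fun hc =>
    hzI (hfr ⟨hc, fun hi => hzI (hsub (interior_subset hi))⟩)
  rw [Metric.mem_closure_iff] at hcl
  push Not at hcl
  obtain ⟨r₀, hr₀, hfar⟩ := hcl
  set s := min (min η r₀) (b - a) / 4 with hs
  have hba : 0 < b - a := sub_pos.2 hab
  have hs0 : 0 < s := div_pos (lt_min (lt_min hη hr₀) hba) (by norm_num)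
  have hs1 : 4 * s ≤ η := by
    rw [hs, mul_div_cancel₀ _ (by norm_num)]; exact (min_le_left _ _).trans (min_le_left _ _)
  have hs2 : 4 * s ≤ r₀ := by
    rw [hs, mul_div_cancel₀ _ (by norm_num)]; exact (min_le_left _ _).trans (min_le_right _ _)
  have hs3 : 4 * s ≤ b - a := by
    rw [hs, mul_div_cancel₀ _ (by norm_num)]; exact min_le_right _ _
  obtain ⟨x, hx1, hx2, hx3⟩ : ∃ x, a ≤ x - s ∧ x + s ≤ b ∧ |x - z| = s := by
    rcases hz with rfl | rfl
    · exact ⟨z + s, by linarith, by linarith, by rw [add_sub_cancel_left, abs_of_pos hs0]⟩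
    · exact ⟨z - s, by linarith, by linarith, by
        rw [sub_sub_cancel_left, abs_neg, abs_of_pos hs0]⟩
  have hsubI : Ioo (x - s) (x + s) ⊆ Ioo a b := Ioo_subset_Ioo hx1 hx2
  refine ⟨x - s, x + s, hx1, by linarith, hx2, fun y hy => ?_, ?_⟩
  · have h3 : |y - x| ≤ s := abs_le.2 ⟨by linarith [hy.1], by linarith [hy.2]⟩
    have h4 := abs_sub_le y x z
    linarith
  · have hxS : x ∉ SigmaSet a b f := fun hx => by
      have := hfar x hx
      rw [dist_comm, Real.dist_eq, hx3] at this
      linarith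
    have hne : ∫ y in Ioo (x - s) (x + s), (1 - f y) ≠ 0 := fun h0 =>
      hxS ⟨hsubI ⟨by linarith, by linarith⟩, s, hs0, by
        rwa [Real.ball_eq_Ioo, inter_eq_self_of_subset_left hsubI]⟩
    have hc1 : IntegrableOn (fun _ : ℝ => (1 : ℝ)) (Ioo (x - s) (x + s)) :=
      integrableOn_const (by simp) (by simp)
    have hnn : 0 ≤ ∫ y in Ioo (x - s) (x + s), (1 - f y) :=
      integral_nonneg_of_ae ((ae_restrict_of_ae_restrict_of_subset hsubI h1).mono fun y hy =>
        sub_nonneg.2 hy)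
    have hpos := lt_of_le_of_ne hnn hne.symm
    rw [integral_sub hc1 (hf.mono_set hsubI), setIntegral_const, smul_eq_mul, mul_one,
      Real.volume_real_Ioo_of_le (by linarith)] at hpos
    linarith

theorem Setting.integral_rho_le_volume {n a b ε K : ℝ} {uin duin : ℝ → ℝ}
    {u ux uxx uxxx : ℝ → ℝ → ℝ} (hS : Setting n a b ε K uin duin u ux uxx uxxx) {t : ℝ}
    (ht : 0 ≤ t) :
    ∫ x in Ioo a b, rhoOf n ε u t x ≤ volume.real {x ∈ Ioo a b | ε ≤ u t x} +
      ((rhoBound a b ε K duin - 1) * (b - a) + K / |Real.log ε| * (b - a)) := by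
  have hu : ContinuousOn (u t) (Ioo a b) := (hS.sol.continuousOn_slice ht).mono Ioo_subset_Icc_self
  set S := {x ∈ Ioo a b | ε ≤ u t x} with hSdef
  have hSm : MeasurableSet S := by
    have : S = Ioo a b \ (Ioo a b ∩ u t ⁻¹' Iio ε) := by
      ext x; simp [hSdef]
    rw [this]
    exact measurableSet_Ioo.diff (hu.isOpen_inter_preimage isOpen_Ioo isOpen_Iio).measurableSet
  have hl := abs_log_pos hS.eps_pos hS.eps_lt
  have hK := hS.const.nonneg
  have hB : 1 ≤ rhoBound a b ε K duin := by
    have := Real.log_nonneg (one_le_supBound hS.lt duin)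
    rw [rhoBound]
    have : 0 ≤ (Real.log (supBound a b duin) + K) / |Real.log ε| := by positivity
    linarith
  have hSsub : S ⊆ Ioo a b := fun _ hx => hx.1
  have hc : ∀ c : ℝ, IntegrableOn (fun _ : ℝ => c) (Ioo a b) := fun c =>
    integrableOn_const (by simp) (by simp)
  have hi1 : IntegrableOn (S.indicator fun _ => rhoBound a b ε K duin) (Ioo a b) :=
    (hc _).indicator hSm
  have h1 : ∫ x in Ioo a b, rhoOf n ε u t x ≤
      ∫ x in Ioo a b, (S.indicator (fun _ => rhoBound a b ε K duin) x + K / |Real.log ε|) := by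
    refine setIntegral_mono_on (hS.sol.integrableOn_rho hS.n_pos hS.n_lt hS.eps_pos ht)
      (hi1.add (hc _)) measurableSet_Ioo fun x hx => ?_
    have hx' := Ioo_subset_Icc_self hx
    by_cases hxS : x ∈ S
    · rw [indicator_of_mem hxS]
      have h2 := hS.sol.rho_le hS.lt hS.datum hS.n_pos hS.n_lt hS.const hS.eps_pos hS.eps_lt ht hx'
      have h3 : 0 ≤ K / |Real.log ε| := by positivity
      rw [rhoBound]
      linarith
    · rw [indicator_of_notMem hxS, zero_add]
      refine Beps_le_of_le hS.n_pos hS.n_lt hS.const hS.eps_pos (hS.sol.nonneg t ht x hx') ?_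
      by_contra hcon
      exact hxS ⟨hx, (not_le.1 hcon).le⟩
  have h2 : ∫ x in Ioo a b, (S.indicator (fun _ => rhoBound a b ε K duin) x + K / |Real.log ε|) =
      rhoBound a b ε K duin * volume.real S + K / |Real.log ε| * (b - a) := by
    rw [integral_add hi1 (hc _), setIntegral_indicator hSm,
      inter_eq_self_of_subset_right hSsub, setIntegral_const, setIntegral_const, smul_eq_mul,
      smul_eq_mul, Real.volume_real_Ioo_of_le hS.lt.le]
    ring
  have h3 : volume.real S ≤ b - a := by
    rw [← Real.volume_real_Ioo_of_le hS.lt.le]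
    exact measureReal_mono hSsub (by simp)
  nlinarith

namespace SettingSeq

variable {n a b K : ℝ} {uin duin : ℝ → ℝ} {ε : ℕ → ℝ} {u ux uxx uxxx : ℕ → ℝ → ℝ → ℝ}

theorem ofReal_le_liminf_volume (hS : SettingSeq n a b K uin duin ε u ux uxx uxxx) {t N : ℝ}
    (ht : 0 ≤ t) (h : ∀ y < N, ∀ᶠ k in atTop, y < ∫ x in Ioo a b, rhoOf n (ε k) (u k) t x) :
    ENNReal.ofReal N ≤
      liminf (fun k => volume {x ∈ Ioo a b | ε k ≤ u k t x}) atTop := by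
  refine le_of_forall_lt fun c hc => ?_
  obtain ⟨c', hcc', hc'⟩ := exists_between hc
  refine hcc'.trans_le (le_liminf_of_le (by isBoundedDefault) ?_)
  have hfin : c' ≠ ⊤ := ne_top_of_lt hc'
  have hlt : c'.toReal < N := (ENNReal.lt_ofReal_iff_toReal_lt hfin).1 hc'
  obtain ⟨y, hy1, hy2⟩ := exists_between hlt
  have herr : Tendsto (fun k => (rhoBound a b (ε k) K duin - 1) * (b - a)
      + K / |Real.log (ε k)| * (b - a)) atTop (𝓝 0) := by
    simpa using ((hS.tendsto_rhoBound.sub_const 1).mul_const (b - a)).add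
      ((hS.tendsto_div_log K).mul_const (b - a))
  filter_upwards [h y hy2, herr.eventually (gt_mem_nhds (sub_pos.2 hy1))] with k hk1 hk2
  have h1 := (hS.setting k).integral_rho_le_volume ht
  refine (ENNReal.le_ofReal_iff_toReal_le hfin measureReal_nonneg).2 ?_ |>.trans
    ENNReal.ofReal_toReal_le
  linarith

end SettingSeq

end

section

namespace SettingSeq

variable {n a b K p T : ℝ} {uin duin : ℝ → ℝ} {ε : ℕ → ℝ} {u ux uxx uxxx : ℕ → ℝ → ℝ → ℝ}
  {ρ r : ℝ → ℝ → ℝ}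

theorem eventually_lt_integral_rho (hS : SettingSeq n a b K uin duin ε u ux uxx uxxx)
    (hρ : IntegrableOn (Function.uncurry ρ) (Ioo 0 T ×ˢ Ioo a b)) (hp : 1 ≤ p)
    (hconv : TendstoLpNegSobolev p T a b (fun k => rhoOf n (ε k) (u k)) ρ)
    (hr : ∀ᵐ t ∂(volume.restrict (Ioo 0 T)), r t =ᵐ[volume.restrict (Ioo a b)] ρ t) {t : ℝ}
    (ht : t ∈ Ioc 0 T)
    (hlim : Tendsto (fun s => ∫ x in Ioo a b, r s x) (𝓝[<] t) (𝓝 (∫ x in Ioo a b, r t x))) {y : ℝ}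
    (hy : y < ∫ x in Ioo a b, r t x) :
    ∀ᶠ k in atTop, y < ∫ x in Ioo a b, rhoOf n (ε k) (u k) t x := by
  by_contra hcon
  obtain ⟨τ, hτ, hτy⟩ := extraction_of_frequently_atTop (not_eventually.1 hcon)
  have hSτ := hS.comp hτ.tendsto_atTop
  obtain ⟨σ, hσ, hgood⟩ := hSτ.exists_subseq_isBumpLimit hρ hp (hconv.comp hτ.tendsto_atTop)
  have hSσ := hSτ.comp hσ.tendsto_atTop
  have hfr := frequently_nhdsLT_of_ae ht (hgood.and hr)
  refine absurd hy (not_lt.2 (le_of_tendsto_of_frequently hlim (hfr.mono ?_)))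
  rintro s ⟨⟨hs0, hst⟩, hs, hrs⟩
  rw [integral_congr_ae hrs]
  refine le_of_tendsto' (hSσ.tendsto_integral_Ioo hs0.le hs le_rfl hS.lt.le le_rfl) fun k => ?_
  exact ((hSσ.setting k).integral_rho_mono hs0.le hst.le).trans (not_lt.1 (hτy (σ k)))

end SettingSeq

end

end ThinFilm

end

theorem mainTheorem4 (n a b T p : ℝ) (hn : 0 < n ∧ n < 3) (hab : a < b) (hT : 0 < T) (hp : 1 ≤ p)
    (uin duin : ℝ → ℝ) (huin : ThinFilm.IsInitialDatum a b uin duin)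
    (ε : ℕ → ℝ) (hε : ∀ k, 0 < ε k ∧ ε k < 1) (hε0 : Tendsto ε atTop (𝓝 0))
    (u ux uxx uxxx : ℕ → ℝ → ℝ → ℝ)
    (hu : ∀ k, ThinFilm.IsSolution n a b (ε k) uin duin (u k) (ux k) (uxx k) (uxxx k))
    (ρ : ℝ → ℝ → ℝ) (hρ : IntegrableOn (Function.uncurry ρ) (Ioo 0 T ×ˢ Ioo a b))
    (hconv : ThinFilm.TendstoLpNegSobolev p T a b
      (fun k => ThinFilm.rhoOf n (ε k) (u k)) ρ) :
    ∃ r : ℝ → ℝ → ℝ, ThinFilm.IsTimeVersion T a b uin ρ r ∧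
      (∀ t ∈ Icc 0 T,
        ENNReal.ofReal (∫ x in Ioo a b, r t x) ≤
            liminf (fun k => volume {x ∈ Ioo a b | ε k ≤ u k t x}) atTop ∧
          min ((63 * t + volume.real {x ∈ Ioo a b | 0 < uin x} ^ 7) ^ (1 / 7 : ℝ)) (b - a) ≤
            ∫ x in Ioo a b, r t x) ∧
      ∀ t₀ ∈ Icc 0 T, frontier (ThinFilm.SigmaSet a b (r t₀)) ⊆ Ioo a b →
        ∀ t ∈ Icc 0 t₀,
          (1008 * t + volume.real {x ∈ Ioo a b | 0 < uin x} ^ 7) ^ (1 / 7 : ℝ) ≤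
            ∫ x in Ioo a b, r t x := by
  open ThinFilm in
  obtain ⟨K, hK⟩ := exists_isEntropyConst hn.1 hn.2
  have hS : SettingSeq n a b K uin duin ε u ux uxx uxxx :=
    ⟨fun k => ⟨hab, huin, hn.1, hn.2, hK, (hε k).1, (hε k).2, hu k⟩, hε0⟩
  obtain ⟨σ, hσ, hgood⟩ := hS.exists_subseq_isBumpLimit hρ hp hconv
  have hSσ := hS.comp hσ.tendsto_atTop
  have hpos : ∀ t ∈ {t ∈ Ioo 0 T | IsBumpLimit a b
      (fun k => rhoOf n (ε (σ k)) (u (σ k)) t) (ρ t)}, 0 ≤ t := fun t ht => ht.1.1.le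
  obtain ⟨r, rint, rae, rmono, rleft, rzero, rle_one, rge⟩ := exists_leftContinuous_version
    (a := a) (b := b) (ρ := ρ) hT (hgood.and (ae_restrict_mem measurableSet_Ioo) |>.mono
      fun t ht => (⟨ht.2, ht.1⟩ : t ∈ {t ∈ Ioo 0 T | IsBumpLimit a b
        (fun k => rhoOf n (ε (σ k)) (u (σ k)) t) (ρ t)}))
    hSσ.isBumpLimit_zero.integrable (fun t ht => ht.2.integrable)
    (fun t ht => hSσ.ae_nonneg (hpos t ht) ht.2) (fun t ht => hSσ.ae_le_one (hpos t ht) ht.2)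
    (fun t ht => hSσ.ae_le_of_le le_rfl (hpos t ht) hSσ.isBumpLimit_zero ht.2)
    (fun s hs t ht hst => hSσ.ae_le_of_le (hpos s hs) hst hs.2 ht.2)
  have hL := hS.integral_indicator_initial
  have hL0 : (0 : ℝ) ≤ volume.real {x ∈ Ioo a b | 0 < uin x} := measureReal_nonneg
  have hinit : ∫ x in Ioo a b, r 0 x = volume.real {x ∈ Ioo a b | 0 < uin x} := by
    rw [rzero, hL]
  have hrlim : ∀ t ∈ Ioc 0 T, Tendsto (fun s => ∫ x in Ioo a b, r s x) (𝓝[<] t)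
      (𝓝 (∫ x in Ioo a b, r t x)) := fun t ht =>
    tendsto_integral_of_tendsto_integral_abs_sub rint (rleft t ht)
  have hbound : ∀ t ∈ Ioc 0 T, ∀ F : ℝ → ℝ, Continuous F → (∀ s ∈ {t ∈ Ioo 0 T | IsBumpLimit a b
      (fun k => rhoOf n (ε (σ k)) (u (σ k)) t) (ρ t)}, s < t → F s ≤ ∫ x in Ioo a b, ρ s x) →
      F t ≤ ∫ x in Ioo a b, r t x := fun t ht F hF h => by
    refine le_of_tendsto_of_frequently (hF.tendsto t |>.mono_left nhdsWithin_le_nhds)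
      ((frequently_nhdsLT_of_ae ht hgood).mono ?_)
    rintro s ⟨⟨hs0, hst⟩, hs⟩
    have hsG : s ∈ {t ∈ Ioo 0 T | IsBumpLimit a b
      (fun k => rhoOf n (ε (σ k)) (u (σ k)) t) (ρ t)} := ⟨⟨hs0, hst.trans_le ht.2⟩, hs⟩
    exact (h s hsG hst).trans
      (integral_mono_ae hs.integrable (rint t) (rge s hsG hs0 t ht.2 hst))
  have hρ0 : ∀ s ∈ {t ∈ Ioo 0 T | IsBumpLimit a b
      (fun k => rhoOf n (ε (σ k)) (u (σ k)) t) (ρ t)}, 0 ≤ ∫ x in Ioo a b, ρ s x := fun s hs =>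
    integral_nonneg_of_ae (hSσ.ae_nonneg (hpos s hs) hs.2)
  have hF : ∀ c : ℝ, Continuous fun s : ℝ =>
      (c * s + volume.real {x ∈ Ioo a b | 0 < uin x} ^ 7) ^ (1 / 7 : ℝ) := fun c =>
    ((continuous_const.mul continuous_id).add continuous_const).rpow_const
      fun _ => Or.inr (by norm_num)
  have hzero : ∀ c : ℝ, (c * 0 + volume.real {x ∈ Ioo a b | 0 < uin x} ^ 7) ^ (1 / 7 : ℝ) ≤
      ∫ x in Ioo a b, r 0 x := fun c => by
    rw [hinit, mul_zero, zero_add]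
    exact rpow_one_div_seven_le (by positivity) hL0 le_rfl
  refine ⟨r, ⟨fun t _ => rint t, rae, fun s _ t _ => rmono s t, rleft, fun x _ => by rw [rzero]⟩,
    fun t ht => ⟨hS.ofReal_le_liminf_volume ht.1 fun y hy => ?_, ?_⟩, fun t₀ ht₀ hfr t ht => ?_⟩
  · rcases ht.1.eq_or_lt with rfl | h0
    · rw [hinit] at hy
      exact hS.tendsto_integral_initial.eventually (lt_mem_nhds hy)
    · exact hS.eventually_lt_integral_rho hρ hp hconv rae ⟨h0, ht.2⟩ (hrlim t ⟨h0, ht.2⟩) hy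
  · rcases ht.1.eq_or_lt with rfl | h0
    · exact (min_le_left _ _).trans (hzero 63)
    · refine hbound t ⟨h0, ht.2⟩ _ ((hF 63).min continuous_const) fun s hs _ => ?_
      rcases lt_or_ge (∫ x in Ioo a b, ρ s x) (b - a) with hlt | hge
      · have hs0 := hpos s hs
        exact (min_le_left _ _).trans (rpow_one_div_seven_le (by positivity) (hρ0 s hs)
          (hSσ.growth_of_lt hs0 hs.2 hlt))
      · exact (min_le_right _ _).trans hge
  · rcases ht.1.eq_or_lt with rfl | h0
    · exact hzero 1008
    · have ht₀0 : 0 < t₀ := h0.trans_le ht.2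
      refine hbound t ⟨h0, ht.2.trans ht₀.2⟩ _ (hF 1008) fun s hs hst => ?_
      have hs0 := hpos s hs
      refine rpow_one_div_seven_le (by positivity) (hρ0 s hs)
        (hSσ.growth_of_endpoints hs0 hs.2 fun z hz η hη => ?_)
      obtain ⟨c, d, hac, hcd, hdb, hnear, hlt⟩ := exists_interval_of_frontier_subset hab (rint t₀)
        (ae_of_all _ (rle_one t₀ ht₀0)) hfr hz hη
      have hsub : Ioo c d ⊆ Ioo a b := Ioo_subset_Ioo hac hdb
      refine ⟨c, d, hac, hcd, hdb, hnear, lt_of_le_of_lt (integral_mono_ae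
        (hs.2.integrable.mono_set hsub) ((rint t₀).mono_set hsub) ?_) hlt⟩
      exact ae_restrict_of_ae_restrict_of_subset hsub
        (rge s hs hs.1.1 t₀ ht₀.2 (hst.trans_le ht.2))
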